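/- In the problem \textsc{Dissimilar Shortest Paths}, the input consists of a finite directed graph $D=(V,A)$ with $A\subseteq V\times V$, an arc-length function $\ell\colon A\to\mathbb R_{>0}$, two vertices $s,t\in V$, and nonnegative integers $k,d$. The question is whether there are $k$ shortest paths $P_1,\dots,P_k$ from $s$ to $t$ in $D$ (directed $s$–$t$ paths of minimum total length) such that $|A(P_i)\mathbin{\triangle}A(P_j)|\ge d$ for all $1\le i<j\le k$, where $A(P)$ is the set of arcs of a path $P$ and $\triangle$ is the symmetric difference. Theorem. There is a deterministic algorithm that decides \textsc{Dissimilar Shortest Paths} in time $2^{O(3^k d k^2)}\,n^{O(1)}$, where $n=|V|$; that is, there is a constant $c$ such that the algorithm halts with the correct answer after at most $c\cdot 2^{c\,3^k d k^2}\, n^{c}$ steps on every instance. In particular, \textsc{Dissimilar Shortest Paths} is fixed-parameter tractable with parameter $k+d$: it is decided in time $f(k+d)\,n^{O(1)}$ for a computable function $f$. Here an algorithm is a program for a random access machine that can store both natural and real numbers, receives the arc lengths as real numbers, and can, at unit cost, move numbers between registers and memory, add, (truncatedly) subtract and compare natural numbers, and add and compare real numbers. -/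

import Mathlib

namespace DissimilarPaths

/-! ### Arc-weighted digraphs and shortest paths -/

/-- A directed graph (at most one arc for each ordered pair of vertices) with positive real arc
lengths. The values of `len` on pairs that are not arcs are irrelevant. -/
structure WeightedDigraph (V : Type*) extends Digraph V where
  len : V → V → ℝ
  len_pos : ∀ u v, Adj u v → 0 < len u v

/-- The list `p` of vertices is a directed path from `s` to `t`: it starts in `s`, ends in `t`,
consecutive vertices are joined by arcs, and no vertex is repeated. -/
def IsPath {V : Type*} (G : WeightedDigraph V) (s t : V) (p : List V) : Prop :=
  p.head? = some s ∧ p.getLast? = some t ∧ p.IsChain G.Adj ∧ p.Nodup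

/-- The arcs traversed by a path, given by its vertices, in order. -/
def arcList {V : Type*} (p : List V) : List (V × V) := p.zip p.tail

/-- The arc set `A(P)` of a path. -/
def arcSet {V : Type*} [DecidableEq V] (p : List V) : Finset (V × V) := (arcList p).toFinset

/-- The length of a path: the sum of the lengths of its arcs. -/
def pathLength {V : Type*} (G : WeightedDigraph V) (p : List V) : ℝ :=
  ((arcList p).map fun a => G.len a.1 a.2).sum

/-- `p` is a path from `s` to `t` of minimum length. -/
def IsShortestPath {V : Type*} (G : WeightedDigraph V) (s t : V) (p : List V) : Prop :=
  IsPath G s t p ∧ ∀ q, IsPath G s t q → pathLength G p ≤ pathLength G q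

/-- There are `k` shortest paths `P 1, …, P k` from `s` to `t` with
`|A(P i) ∆ A(P j)| ≥ d` for all `i < j`. -/
def HasDissimilarShortestPaths {V : Type*} [DecidableEq V] (G : WeightedDigraph V) (s t : V)
    (k d : ℕ) : Prop :=
  ∃ P : Fin k → List V, (∀ i, IsShortestPath G s t (P i)) ∧
    ∀ i j, i < j → d ≤ (symmDiff (arcSet (P i)) (arcSet (P j))).card

/-- An instance of the problem Dissimilar Shortest Paths, on the vertices `0, …, n - 1`. -/
structure Instance where
  n : ℕ
  G : WeightedDigraph (Fin n)
  s : Fin n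
  t : Fin n
  k : ℕ
  d : ℕ

/-- The yes-instances. -/
def Instance.IsYes (I : Instance) : Prop := HasDissimilarShortestPaths I.G I.s I.t I.k I.d

/-! ### The machine model

A deterministic random access machine with real numbers, in the comparison-addition model.
There are registers and an indirectly addressed memory for natural numbers, and registers and a
memory (addressed through natural number registers) for real numbers. Natural numbers can be
added, subtracted (truncated at `0`) and compared, real numbers can be added and compared.
Every instruction and every test costs one step. There is no multiplication (and no bit
operation), so that the bit length of a natural number grows by at most one in a step, and unit
costs are polynomially related to bit costs. Real numbers cannot be rounded or turned
into natural numbers. -/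

/-- Contents of the registers and of the memory. -/
structure State where
  /-- natural number registers -/
  reg : ℕ → ℕ
  /-- natural number memory -/
  mem : ℕ → ℕ
  /-- real number registers -/
  rreg : ℕ → ℝ
  /-- real number memory -/
  rmem : ℕ → ℝ

/-- Elementary instructions; the arguments are numbers of registers, except for the constant `c`. -/
inductive Instr where
  /-- `reg i := c` -/
  | const (i c : ℕ)
  /-- `reg i := reg j` -/
  | move (i j : ℕ)
  /-- `reg i := reg j + reg l` -/
  | add (i j l : ℕ)
  /-- `reg i := max (reg j - reg l) 0` -/
  | sub (i j l : ℕ)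
  /-- `reg i := mem (reg j)` -/
  | load (i j : ℕ)
  /-- `mem (reg i) := reg j` -/
  | store (i j : ℕ)
  /-- `rreg i := rreg j` -/
  | rmove (i j : ℕ)
  /-- `rreg i := rreg j + rreg l` -/
  | radd (i j l : ℕ)
  /-- `rreg i := rmem (reg j)` -/
  | rload (i j : ℕ)
  /-- `rmem (reg i) := rreg j` -/
  | rstore (i j : ℕ)

/-- The effect of an elementary instruction. -/
def Instr.run (σ : State) : Instr → State
  | .const i c => { σ with reg := Function.update σ.reg i c }
  | .move i j => { σ with reg := Function.update σ.reg i (σ.reg j) }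
  | .add i j l => { σ with reg := Function.update σ.reg i (σ.reg j + σ.reg l) }
  | .sub i j l => { σ with reg := Function.update σ.reg i (σ.reg j - σ.reg l) }
  | .load i j => { σ with reg := Function.update σ.reg i (σ.mem (σ.reg j)) }
  | .store i j => { σ with mem := Function.update σ.mem (σ.reg i) (σ.reg j) }
  | .rmove i j => { σ with rreg := Function.update σ.rreg i (σ.rreg j) }
  | .radd i j l => { σ with rreg := Function.update σ.rreg i (σ.rreg j + σ.rreg l) }
  | .rload i j => { σ with rreg := Function.update σ.rreg i (σ.rmem (σ.reg j)) }
  | .rstore i j => { σ with rmem := Function.update σ.rmem (σ.reg i) (σ.rreg j) }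

/-- Tests: comparison of two natural number registers or of two real number registers. -/
inductive Test where
  /-- `reg i < reg j` -/
  | lt (i j : ℕ)
  /-- `rreg i < rreg j` -/
  | rlt (i j : ℕ)

/-- The truth of a test in a state. -/
def Test.Holds (σ : State) : Test → Prop
  | .lt i j => σ.reg i < σ.reg j
  | .rlt i j => σ.rreg i < σ.rreg j

/-- Programs. -/
inductive Program where
  | skip
  | instr (a : Instr)
  | seq (p q : Program)
  | ite (b : Test) (p q : Program)
  | while (b : Test) (p : Program)

/-- `Exec p σ σ' T`: the program `p`, started in state `σ`, halts in state `σ'` after exactly `T`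
steps, where each elementary instruction and each evaluation of a test counts as one step. -/
inductive Exec : Program → State → State → ℕ → Prop where
  | skip (σ : State) : Exec .skip σ σ 0
  | instr (a : Instr) (σ : State) : Exec (.instr a) σ (a.run σ) 1
  | seq {p q : Program} {σ σ' σ'' : State} {T T' : ℕ}
      (h : Exec p σ σ' T) (h' : Exec q σ' σ'' T') : Exec (.seq p q) σ σ'' (T + T')
  | ite_true {b : Test} {p q : Program} {σ σ' : State} {T : ℕ}
      (hb : b.Holds σ) (h : Exec p σ σ' T) : Exec (.ite b p q) σ σ' (1 + T)
  | ite_false {b : Test} {p q : Program} {σ σ' : State} {T : ℕ}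
      (hb : ¬ b.Holds σ) (h : Exec q σ σ' T) : Exec (.ite b p q) σ σ' (1 + T)
  | while_true {b : Test} {p : Program} {σ σ' σ'' : State} {T T' : ℕ}
      (hb : b.Holds σ) (h : Exec p σ σ' T) (h' : Exec (.while b p) σ' σ'' T') :
      Exec (.while b p) σ σ'' (1 + T + T')
  | while_false {b : Test} {p : Program} {σ : State}
      (hb : ¬ b.Holds σ) : Exec (.while b p) σ σ 1

/-- The machine is deterministic. -/
theorem Exec.deterministic {p : Program} {σ σ₁ σ₂ : State} {T₁ T₂ : ℕ}
    (h₁ : Exec p σ σ₁ T₁) (h₂ : Exec p σ σ₂ T₂) : σ₁ = σ₂ ∧ T₁ = T₂ := by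
  induction h₁ generalizing σ₂ T₂ with
  | skip => cases h₂; exact ⟨rfl, rfl⟩
  | instr => cases h₂; exact ⟨rfl, rfl⟩
  | seq _ _ ih ih' =>
    cases h₂ with
    | seq g g' =>
      obtain ⟨rfl, rfl⟩ := ih g
      obtain ⟨rfl, rfl⟩ := ih' g'
      exact ⟨rfl, rfl⟩
  | ite_true hb _ ih =>
    cases h₂ with
    | ite_true _ g => obtain ⟨rfl, rfl⟩ := ih g; exact ⟨rfl, rfl⟩
    | ite_false hb' _ => exact absurd hb hb'
  | ite_false hb _ ih =>
    cases h₂ with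
    | ite_true hb' _ => exact absurd hb' hb
    | ite_false _ g => obtain ⟨rfl, rfl⟩ := ih g; exact ⟨rfl, rfl⟩
  | while_true hb _ _ ih ih' =>
    cases h₂ with
    | while_true _ g g' =>
      obtain ⟨rfl, rfl⟩ := ih g
      obtain ⟨rfl, rfl⟩ := ih' g'
      exact ⟨rfl, rfl⟩
    | while_false hb' => exact absurd hb hb'
  | while_false hb =>
    cases h₂ with
    | while_true hb' _ _ => exact absurd hb' hb
    | while_false _ => exact ⟨rfl, rfl⟩

open Classical in
/-- The initial state for an instance: the registers `0, …, 4` hold `n, s, t, k, d`, the memory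
holds the adjacency matrix at the addresses `u * n + v`, and the real memory holds the length of
each arc `(u, v)` at the address `u * n + v`. Everything else is `0`. -/
noncomputable def Instance.initialState (I : Instance) : State where
  reg := fun a =>
    if a = 0 then I.n else if a = 1 then I.s else if a = 2 then I.t
    else if a = 3 then I.k else if a = 4 then I.d else 0
  mem := fun a =>
    if h : a < I.n * I.n then
      if I.G.Adj (⟨a, h⟩ : Fin (I.n * I.n)).divNat (⟨a, h⟩ : Fin (I.n * I.n)).modNat then 1 else 0
    else 0
  rreg := fun _ => 0
  rmem := fun a =>
    if h : a < I.n * I.n then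
      if I.G.Adj (⟨a, h⟩ : Fin (I.n * I.n)).divNat (⟨a, h⟩ : Fin (I.n * I.n)).modNat then
        I.G.len (⟨a, h⟩ : Fin (I.n * I.n)).divNat (⟨a, h⟩ : Fin (I.n * I.n)).modNat
      else 0
    else 0

/-- The program `p` decides Dissimilar Shortest Paths in time `B`: on every instance `I` it halts
after at most `B I` steps, and register `0` is `1` at the end if and only if `I` is a
yes-instance. -/
def DecidesInTime (p : Program) (B : Instance → ℕ) : Prop :=
  ∀ I : Instance, ∃ (σ : State) (T : ℕ),
    Exec p I.initialState σ T ∧ T ≤ B I ∧ (σ.reg 0 = 1 ↔ I.IsYes)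

/-- Dissimilar Shortest Paths is fixed-parameter tractable with respect to the parameter `κ`. -/
def FixedParameterTractable (κ : Instance → ℕ) : Prop :=
  ∃ (p : Program) (f : ℕ → ℕ) (c : ℕ), Computable f ∧
    DecidesInTime p fun I => f (κ I) * I.n ^ c

end DissimilarPaths

/-! Let D(v) be the distance of v from s. The shortest paths from s to t are exactly the routes from
s to t along tight arcs, that is, arcs uv with D(u) + ℓ(uv) = D(v) (`IsDist.isShortestPath_iff`).
Since D increases along tight arcs, they form an acyclic digraph, and k of its routes at pairwise
Hamming distance at least d are sought.

Centres A_0, A_1, … are chosen greedily: A_m is any route at distance at least 3^(k-1-m) d from all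
earlier centres. If k centres are found, they are a solution. Otherwise the choice gets stuck with m
< k centres. Put τ = 3^(k-1-m) d. Every route is then at distance less than τ from some centre,
while two centres are at distance at least 3τ. Routes near different centres are more than τ ≥ d
apart, so only routes with the same centre interact. If P_i and P_j have the centre A and D_i = P_i
∆ A, D_j = P_j ∆ A, then |P_i ∆ P_j| = |D_i \ D_j| + |D_j \ D_i|, and all the sets D_i have fewer
than τ elements.

Colour coding makes the k paths independent. Guess the centre c(i) of each path, numbers a(i,j), and
a bit χ(e,i) for each arc e and index i, with a(i,j) + a(j,i) ≥ d whenever c(i) = c(j). Path i must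
have χ(e,i) ≠ 0 for all e in D_i, must be far from the other centres, and must have at least a(i,j)
arcs e in D_i with χ(e,j) = 0; such arcs lie outside D_j. Paths found in this way are a solution
whatever χ is (`le_setDist_of_colouring`). Conversely, for a given solution χ has to be right only
on the union of the D_i (`exists_small_of_le_setDist`), hence on at most E = 3^k d k² pairs of an
arc and an index.

Two tools turn this into a deterministic algorithm. By two-stage hashing, every 0/1 function on at
most E points is described by a seed with 2^O(E) n^O(1) possible values (`exists_colour_eq`,
`exists_tableSum_eq`), and all seeds are tried. And because a route crosses each level of the
acyclic digraph exactly once, a weighted count of P ∆ A is a sum of weights of the arcs of P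
(`sum_diffWeight`). A query for one path is therefore a dynamic program over pairs of a vertex and a
vector of at most 2k remaining demands (`reaches_iff`).

The algorithm is written in a small language whose loops are truncated at a bound V; its statements
are compiled to machine programs running in time polynomial in V (`Stmt.performs`), and V = (n
2^E)^200 is large enough (`sizes_of_pos`). -/

namespace DissimilarPaths

/-! ### Polynomially bounded functions -/

/-- `f` is bounded by a polynomial. -/
def PolyBound (f : ℕ → ℕ) : Prop := ∃ C D, ∀ V, f V ≤ C * (V + 1) ^ D

theorem PolyBound.const (c : ℕ) : PolyBound fun _ => c := ⟨c, 0, fun V => by simp⟩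

theorem PolyBound.id : PolyBound fun V => V := ⟨1, 1, fun V => by simp⟩

theorem PolyBound.add {f g : ℕ → ℕ} (hf : PolyBound f) (hg : PolyBound g) :
    PolyBound fun V => f V + g V := by
  obtain ⟨C, D, h⟩ := hf
  obtain ⟨C', D', h'⟩ := hg
  refine ⟨C + C', D + D', fun V => ?_⟩
  have h1 : (V + 1) ^ D ≤ (V + 1) ^ (D + D') := Nat.pow_le_pow_right (by omega) (by omega)
  have h2 : (V + 1) ^ D' ≤ (V + 1) ^ (D + D') := Nat.pow_le_pow_right (by omega) (by omega)
  calc f V + g V ≤ C * (V + 1) ^ D + C' * (V + 1) ^ D' := add_le_add (h V) (h' V)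
    _ ≤ C * (V + 1) ^ (D + D') + C' * (V + 1) ^ (D + D') := by gcongr
    _ = _ := by ring

theorem PolyBound.mul {f g : ℕ → ℕ} (hf : PolyBound f) (hg : PolyBound g) :
    PolyBound fun V => f V * g V := by
  obtain ⟨C, D, h⟩ := hf
  obtain ⟨C', D', h'⟩ := hg
  refine ⟨C * C', D + D', fun V => ?_⟩
  calc f V * g V ≤ (C * (V + 1) ^ D) * (C' * (V + 1) ^ D') := Nat.mul_le_mul (h V) (h' V)
    _ = _ := by ring

/-! ### A language of bounded loops -/

/-- The environment of a program of the language: scalar variables, arrays, a read-only input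
array, real registers and a real memory. -/
structure Env where
  x : ℕ → ℕ
  arr : Fin 16 → ℕ → ℕ
  inp : ℕ → ℕ
  rreg : ℕ → ℝ
  rmem : ℕ → ℝ

/-- Assignment to a scalar variable. -/
def Env.set (e : Env) (i v : ℕ) : Env := { e with x := Function.update e.x i v }

/-- Assignment to an entry of an array. -/
def Env.store (e : Env) (a : Fin 16) (i v : ℕ) : Env :=
  { e with arr := Function.update e.arr a (Function.update (e.arr a) i v) }

/-- Expressions with values in the natural numbers. -/
inductive Expr where
  | const (c : ℕ)
  | var (i : ℕ)
  | add (a b : Expr)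
  | sub (a b : Expr)
  | mul (a b : Expr)
  | div (a b : Expr)
  | pow (a b : Expr)
  | rd (i : Fin 16) (a : Expr)
  | inp (a : Expr)
  | ite (a b c d : Expr)
  | sum (i : ℕ) (b f : Expr)
  | letE (i : ℕ) (a f : Expr)

/-- The value of an expression. The number of iterations of each loop is truncated at `V`. -/
def Expr.eval (V : ℕ) : Expr → Env → ℕ
  | .const c, _ => c
  | .var i, e => e.x i
  | .add a b, e => a.eval V e + b.eval V e
  | .sub a b, e => a.eval V e - b.eval V e
  | .mul a b, e => min (a.eval V e) V * b.eval V e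
  | .div a b, e =>
    if b.eval V e = 0 then min (a.eval V e) V else min (a.eval V e / b.eval V e) V
  | .pow a b, e => min (a.eval V e) V ^ min (b.eval V e) V
  | .rd i a, e => e.arr i (a.eval V e)
  | .inp a, e => e.inp (a.eval V e)
  | .ite a b c d, e => if a.eval V e < b.eval V e then c.eval V e else d.eval V e
  | .sum i b f, e => ∑ j ∈ Finset.range (min (b.eval V e) V), f.eval V (e.set i j)
  | .letE i a f, e => f.eval V (e.set i (a.eval V e))

/-- Statements. -/
inductive Stmt where
  | skip
  | set (i : ℕ) (a : Expr)
  | store (i : Fin 16) (a b : Expr)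
  | seq (p q : Stmt)
  | ite (a b : Expr) (p q : Stmt)
  | loop (i : ℕ) (b : Expr) (p : Stmt)
  | rload (r : ℕ) (a : Expr)
  | rstore (a : Expr) (r : ℕ)
  | radd (r r₁ r₂ : ℕ)
  | rite (r₁ r₂ : ℕ) (p q : Stmt)

/-- The environment after `j` iterations of a loop with body `f` and loop variable `i`. -/
def iterate (f : Env → Env) (i : ℕ) : ℕ → Env → Env
  | 0, e => e
  | j + 1, e => f ((iterate f i j e).set i j)

open Classical in
/-- The effect of a statement. The number of iterations of each loop is truncated at `V`, and loop
variables are restored after the loop. -/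
noncomputable def Stmt.run (V : ℕ) : Stmt → Env → Env
  | .skip, e => e
  | .set i a, e => e.set i (a.eval V e)
  | .store i a b, e => e.store i (a.eval V e) (b.eval V e)
  | .seq p q, e => q.run V (p.run V e)
  | .ite a b p q, e => if a.eval V e < b.eval V e then p.run V e else q.run V e
  | .loop i b p, e => (iterate (p.run V) i (min (b.eval V e) V) e).set i (e.x i)
  | .rload r a, e => { e with rreg := Function.update e.rreg r (e.rmem (a.eval V e)) }
  | .rstore a r, e => { e with rmem := Function.update e.rmem (a.eval V e) (e.rreg r) }
  | .radd r r₁ r₂, e => { e with rreg := Function.update e.rreg r (e.rreg r₁ + e.rreg r₂) }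
  | .rite r₁ r₂ p q, e => if e.rreg r₁ < e.rreg r₂ then p.run V e else q.run V e

/-! ### Compilation -/

/-- The environment represented by a state of the machine: the variable `i` is kept in the register
`2 * i`, the register `1` holds the bound `V`, and the odd registers from `3` are temporary. The
memory below `V` is the input, and the arrays are interleaved in the memory from `V`. -/
def State.env (σ : State) : Env where
  x i := σ.reg (2 * i)
  arr a i := σ.mem (σ.reg 1 + (16 * i + a))
  inp i := if i < σ.reg 1 then σ.mem i else 0
  rreg := σ.rreg
  rmem := σ.rmem

/-! ### Executions with bounded time and temporary registers -/

/-- `σ'` differs from `σ` only in temporary registers from number `q`. -/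
def Keeps (q : ℕ) (σ σ' : State) : Prop :=
  (∀ i, σ'.reg (2 * i) = σ.reg (2 * i)) ∧ σ'.reg 1 = σ.reg 1 ∧
    (∀ j < q, σ'.reg (2 * j + 3) = σ.reg (2 * j + 3)) ∧ σ'.mem = σ.mem ∧ σ'.rreg = σ.rreg ∧
    σ'.rmem = σ.rmem

theorem Keeps.trans {q : ℕ} {σ₁ σ₂ σ₃ : State} (h : Keeps q σ₁ σ₂) (h' : Keeps q σ₂ σ₃) :
    Keeps q σ₁ σ₃ :=
  ⟨fun i => (h'.1 i).trans (h.1 i), h'.2.1.trans h.2.1,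
    fun j hj => (h'.2.2.1 j hj).trans (h.2.2.1 j hj), h'.2.2.2.1.trans h.2.2.2.1,
    h'.2.2.2.2.1.trans h.2.2.2.2.1, h'.2.2.2.2.2.trans h.2.2.2.2.2⟩

theorem Keeps.mono {q q' : ℕ} {σ₁ σ₂ : State} (h : Keeps q σ₁ σ₂) (hq : q' ≤ q) :
    Keeps q' σ₁ σ₂ :=
  ⟨h.1, h.2.1, fun j hj => h.2.2.1 j (by omega), h.2.2.2⟩

theorem Keeps.env {q : ℕ} {σ σ' : State} (h : Keeps q σ σ') : σ'.env = σ.env := by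
  obtain ⟨h1, h2, h3, h4, h5, h6⟩ := h
  simp [State.env, h1, h2, h4, h5, h6]

theorem keeps_update {q r : ℕ} {σ : State} (v : ℕ) (hr : q ≤ r) :
    Keeps q σ { σ with reg := Function.update σ.reg (2 * r + 3) v } := by
  refine ⟨fun i => ?_, ?_, fun j hj => ?_, rfl, rfl, rfl⟩
  all_goals simp (disch := omega) only [Function.update_of_ne]

/-- Execution in a bounded number of steps. -/
def Runs (p : Program) (σ σ' : State) (B : ℕ) : Prop := ∃ T, Exec p σ σ' T ∧ T ≤ B

theorem Runs.mono {p : Program} {σ σ' : State} {B B' : ℕ} (h : Runs p σ σ' B) (hB : B ≤ B') :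
    Runs p σ σ' B' := by
  obtain ⟨T, h, hT⟩ := h
  exact ⟨T, h, hT.trans hB⟩

theorem Runs.seq {p q : Program} {σ σ' σ'' : State} {B B' : ℕ} (h : Runs p σ σ' B)
    (h' : Runs q σ' σ'' B') : Runs (.seq p q) σ σ'' (B + B') := by
  obtain ⟨T, h, hT⟩ := h
  obtain ⟨T', h', hT'⟩ := h'
  exact ⟨_, .seq h h', by omega⟩

theorem Runs.instr (a : Instr) (σ : State) : Runs (.instr a) σ (a.run σ) 1 :=
  ⟨1, .instr a σ, le_rfl⟩

theorem Runs.skip (σ : State) : Runs .skip σ σ 0 := ⟨0, .skip σ, le_rfl⟩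

theorem Runs.ite_true {b : Test} {p q : Program} {σ σ' : State} {B : ℕ} (hb : b.Holds σ)
    (h : Runs p σ σ' B) : Runs (.ite b p q) σ σ' (1 + B) := by
  obtain ⟨T, h, hT⟩ := h
  exact ⟨_, .ite_true hb h, by omega⟩

theorem Runs.ite_false {b : Test} {p q : Program} {σ σ' : State} {B : ℕ} (hb : ¬ b.Holds σ)
    (h : Runs q σ σ' B) : Runs (.ite b p q) σ σ' (1 + B) := by
  obtain ⟨T, h, hT⟩ := h
  exact ⟨_, .ite_false hb h, by omega⟩

/-- The invariant `I j` holds after j iterations and decides the test, so the number N of iterations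
is known in advance. The time consists of N bodies, N successful tests and one failing test. -/
theorem runs_while {b : Test} {p : Program} (I : ℕ → State → Prop) (N B : ℕ)
    (h : ∀ j < N, ∀ σ, I j σ → b.Holds σ ∧ ∃ σ', Runs p σ σ' B ∧ I (j + 1) σ')
    (hN : ∀ σ, I N σ → ¬ b.Holds σ) (σ : State) (h0 : I 0 σ) :
    ∃ σ', Runs (.while b p) σ σ' (N * (B + 1) + 1) ∧ I N σ' := by
  suffices H : ∀ m j, j + m = N → ∀ σ, I j σ →
      ∃ σ', Runs (.while b p) σ σ' (m * (B + 1) + 1) ∧ I N σ' from H N 0 (by omega) σ h0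
  intro m
  induction m with
  | zero =>
    intro j hj σ hI
    obtain rfl : j = N := by omega
    exact ⟨σ, ⟨1, .while_false (hN σ hI), by omega⟩, hI⟩
  | succ m ih =>
    intro j hj σ hI
    obtain ⟨hb, σ₁, ⟨T, hT, hTB⟩, hI₁⟩ := h j (by omega) σ hI
    obtain ⟨σ₂, ⟨T', hT', hTB'⟩, hI₂⟩ := ih (j + 1) (by omega) σ₁ hI₁
    refine ⟨σ₂, ⟨_, .while_true hb hT hT', ?_⟩, hI₂⟩
    calc 1 + T + T' ≤ 1 + B + (m * (B + 1) + 1) := by omega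
      _ = _ := by ring

/-- Assignment of the value `v` to the temporary register `r`. -/
def State.tmp (σ : State) (r v : ℕ) : State :=
  { σ with reg := Function.update σ.reg (2 * r + 3) v }

/-- Repetition of `p`; the number of iterations is in the temporary register `q`, and the temporary
registers `q + 1` and `q + 2` hold a counter and the constant `1`. -/
def Program.repeat (q : ℕ) (p : Program) : Program :=
  .seq (.instr (.const (2 * (q + 1) + 3) 0)) (.seq (.instr (.const (2 * (q + 2) + 3) 1))
    (.while (.lt (2 * (q + 1) + 3) (2 * q + 3))
      (.seq p (.instr (.add (2 * (q + 1) + 3) (2 * (q + 1) + 3) (2 * (q + 2) + 3))))))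

/-- The invariant vouches for the three control registers (`hJ`); the body has to preserve only the
counter and the constant, because the increment is already applied in the `tmp` of its conclusion.
An iteration costs a test, the body and an increment; the summand 3 pays for the two constants and
the last test. -/
theorem runs_repeat {q : ℕ} {p : Program} (J : ℕ → State → Prop) (N B : ℕ) (σ : State)
    (h0 : J 0 ((σ.tmp (q + 1) 0).tmp (q + 2) 1))
    (hJ : ∀ j σ, J j σ → σ.reg (2 * q + 3) = N ∧ σ.reg (2 * (q + 1) + 3) = j ∧
      σ.reg (2 * (q + 2) + 3) = 1)
    (h : ∀ j < N, ∀ σ, J j σ → ∃ σ', Runs p σ σ' B ∧ σ'.reg (2 * (q + 1) + 3) = j ∧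
      σ'.reg (2 * (q + 2) + 3) = 1 ∧ J (j + 1) (σ'.tmp (q + 1) (j + 1))) :
    ∃ σ', Runs (Program.repeat q p) σ σ' (N * (B + 2) + 3) ∧ J N σ' := by
  obtain ⟨σ', hr, hJ'⟩ := runs_while (b := .lt (2 * (q + 1) + 3) (2 * q + 3))
    (p := .seq p (.instr (.add (2 * (q + 1) + 3) (2 * (q + 1) + 3) (2 * (q + 2) + 3)))) J N (B + 1)
    (fun j hj σ hI => by
      obtain ⟨σ', hr, h1, h2, h3⟩ := h j hj σ hI
      obtain ⟨e1, e2, e3⟩ := hJ j σ hI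
      refine ⟨by simp [Test.Holds, e1, e2, hj], _, hr.seq (Runs.instr _ _), ?_⟩
      simp only [Instr.run, h1, h2]
      exact h3)
    (fun σ hI => by
      obtain ⟨e1, e2, e3⟩ := hJ N σ hI
      simp only [Test.Holds, e1, e2]
      omega) _ h0
  refine ⟨σ', ((Runs.instr _ _).seq ((Runs.instr _ _).seq hr)).mono ?_, hJ'⟩
  have : N * (B + 2) = N * (B + 1 + 1) := by ring
  omega

/-- Truncation of the temporary register `q` at `V`. -/
def Program.truncate (q : ℕ) : Program :=
  .ite (.lt 1 (2 * q + 3)) (.instr (.move (2 * q + 3) 1)) .skip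

theorem runs_truncate (q : ℕ) (σ : State) :
    Runs (Program.truncate q) σ (σ.tmp q (min (σ.reg (2 * q + 3)) (σ.reg 1))) 2 := by
  by_cases h : σ.reg 1 < σ.reg (2 * q + 3)
  · have := Runs.ite_true (b := .lt 1 (2 * q + 3)) (q := .skip) h
      (Runs.instr (.move (2 * q + 3) 1) σ)
    rw [min_eq_right h.le]
    exact this
  · have := Runs.ite_false (b := .lt 1 (2 * q + 3)) (p := .instr (.move (2 * q + 3) 1)) h
      (Runs.skip σ)
    simp only [State.tmp, min_eq_left (not_lt.1 h), Function.update_eq_self]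
    exact this.mono (by omega)

@[simp] theorem tmp_reg_self (σ : State) (r v : ℕ) : (σ.tmp r v).reg (2 * r + 3) = v := by
  simp [State.tmp]

theorem tmp_reg_of_ne (σ : State) {r i : ℕ} (v : ℕ) (h : i ≠ 2 * r + 3) :
    (σ.tmp r v).reg i = σ.reg i := by
  simp [State.tmp, Function.update_of_ne h]

theorem keeps_tmp {q r : ℕ} (σ : State) (v : ℕ) (hr : q ≤ r) : Keeps q σ (σ.tmp r v) :=
  keeps_update v hr

/-! ### Compilation of expressions -/

/-- A function of the environment is computed by programs in polynomial time. -/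
def Realizes (f : ℕ → Env → ℕ) : Prop :=
  ∀ q, ∃ p B, PolyBound B ∧ ∀ σ, ∃ σ', Runs p σ σ' (B (σ.reg 1)) ∧ Keeps q σ σ' ∧
    σ'.reg (2 * q + 3) = f (σ.reg 1) σ.env

/-- A binary operation is computed by programs in polynomial time. -/
def RealizesOp (o : ℕ → ℕ → ℕ → ℕ) : Prop :=
  ∀ q, ∃ p B, PolyBound B ∧ ∀ σ, ∃ σ', Runs p σ σ' (B (σ.reg 1)) ∧ Keeps q σ σ' ∧
    σ'.reg (2 * q + 3) = o (σ.reg 1) (σ.reg (2 * q + 3)) (σ.reg (2 * (q + 1) + 3))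

theorem RealizesOp.realizes {o : ℕ → ℕ → ℕ → ℕ} (ho : RealizesOp o) {f g : ℕ → Env → ℕ}
    (hf : Realizes f) (hg : Realizes g) : Realizes fun V e => o V (f V e) (g V e) := by
  intro q
  obtain ⟨p₁, B₁, hB₁, h₁⟩ := hf q
  obtain ⟨p₂, B₂, hB₂, h₂⟩ := hg (q + 1)
  obtain ⟨p₃, B₃, hB₃, h₃⟩ := ho q
  refine ⟨.seq p₁ (.seq p₂ p₃), _, hB₁.add (hB₂.add hB₃), fun σ => ?_⟩
  obtain ⟨σ₁, r₁, k₁, e₁⟩ := h₁ σ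
  obtain ⟨σ₂, r₂, k₂, e₂⟩ := h₂ σ₁
  obtain ⟨σ₃, r₃, k₃, e₃⟩ := h₃ σ₂
  rw [k₂.2.1, k₁.2.1] at r₃ e₃
  rw [k₁.2.1] at r₂ e₂
  refine ⟨σ₃, r₁.seq (r₂.seq r₃), k₁.trans ((k₂.mono (by omega)).trans k₃), ?_⟩
  rw [e₃, e₂, k₂.2.2.1 q (by omega), e₁, k₁.env]

theorem realizesOp_add : RealizesOp fun _ a b => a + b := fun q =>
  ⟨.instr (.add (2 * q + 3) (2 * q + 3) (2 * (q + 1) + 3)), _, .const 1, fun σ =>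
    ⟨_, Runs.instr _ _, keeps_update _ le_rfl, by simp [Instr.run]⟩⟩

theorem realizesOp_sub : RealizesOp fun _ a b => a - b := fun q =>
  ⟨.instr (.sub (2 * q + 3) (2 * q + 3) (2 * (q + 1) + 3)), _, .const 1, fun σ =>
    ⟨_, Runs.instr _ _, keeps_update _ le_rfl, by simp [Instr.run]⟩⟩

theorem keeps_trans_tmp {q r : ℕ} {σ σ' : State} (v : ℕ) (h : Keeps q σ σ') (hr : q ≤ r) :
    Keeps q σ (σ'.tmp r v) := h.trans (keeps_tmp σ' v hr)

/-- The machine only adds and subtracts, so the other operations are obtained by recursion along a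
counter that never exceeds V (`hc`); this keeps the time polynomial in V. The temporary register q
holds the number of iterations and finally the result, q + 1 and q + 2 belong to `Program.repeat`, q
+ 3 and q + 4 keep the operands, and q + 5 is the accumulator. -/
theorem realizesOp_of_iterate (init : ℕ → ℕ → ℕ → ℕ) (step : ℕ → ℕ → ℕ → ℕ → ℕ → ℕ)
    (cnt : ℕ → ℕ → ℕ → ℕ) (hc : ∀ V a b, cnt V a b ≤ V)
    (hinit : ∀ q, ∃ p B, PolyBound B ∧ ∀ σ, ∃ σ', Runs p σ σ' (B (σ.reg 1)) ∧ Keeps q σ σ' ∧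
      σ'.reg (2 * q + 3) = cnt (σ.reg 1) (σ.reg (2 * q + 3)) (σ.reg (2 * (q + 1) + 3)) ∧
      σ'.reg (2 * (q + 3) + 3) = σ.reg (2 * q + 3) ∧
      σ'.reg (2 * (q + 4) + 3) = σ.reg (2 * (q + 1) + 3) ∧
      σ'.reg (2 * (q + 5) + 3) = init (σ.reg 1) (σ.reg (2 * q + 3)) (σ.reg (2 * (q + 1) + 3)))
    (hstep : ∀ q, ∃ p B, PolyBound B ∧ ∀ σ, ∃ σ', Runs p σ σ' (B (σ.reg 1)) ∧ Keeps (q + 5) σ σ' ∧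
      σ'.reg (2 * (q + 5) + 3) = step (σ.reg 1) (σ.reg (2 * (q + 3) + 3))
        (σ.reg (2 * (q + 4) + 3)) (σ.reg (2 * (q + 1) + 3)) (σ.reg (2 * (q + 5) + 3))) :
    RealizesOp fun V a b => Nat.rec (init V a b) (fun j c => step V a b j c) (cnt V a b) := by
  intro q
  obtain ⟨p₁, B₁, hB₁, h₁⟩ := hinit q
  obtain ⟨p₂, B₂, hB₂, h₂⟩ := hstep q
  refine ⟨.seq p₁ (.seq (Program.repeat q p₂) (.instr (.move (2 * q + 3) (2 * (q + 5) + 3)))),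
    _, hB₁.add (((PolyBound.id.mul (hB₂.add (.const 2))).add (.const 3)).add (.const 1)),
    fun σ => ?_⟩
  obtain ⟨σ₁, r₁, k₁, e₁, e₂, e₃, e₄⟩ := h₁ σ
  set V := σ.reg 1 with hV
  set a := σ.reg (2 * q + 3) with ha
  set b := σ.reg (2 * (q + 1) + 3) with hb
  obtain ⟨σ₂, r₂, ⟨k₂, f₁, f₂, f₃, f₄, f₅, f₆⟩⟩ := runs_repeat (q := q) (p := p₂)
    (fun j σ' => Keeps q σ σ' ∧ σ'.reg (2 * q + 3) = cnt V a b ∧ σ'.reg (2 * (q + 1) + 3) = j ∧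
      σ'.reg (2 * (q + 2) + 3) = 1 ∧ σ'.reg (2 * (q + 3) + 3) = a ∧
      σ'.reg (2 * (q + 4) + 3) = b ∧
      σ'.reg (2 * (q + 5) + 3) = Nat.rec (init V a b) (fun j c => step V a b j c) j)
    (cnt V a b) (B₂ V) σ₁
    ⟨keeps_trans_tmp _ (keeps_trans_tmp _ k₁ (by omega)) (by omega),
      by simp (disch := omega) only [tmp_reg_of_ne, e₁],
      by simp (disch := omega) only [tmp_reg_of_ne, tmp_reg_self],
      by simp (disch := omega) only [tmp_reg_self],
      by simp (disch := omega) only [tmp_reg_of_ne, e₂],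
      by simp (disch := omega) only [tmp_reg_of_ne, e₃],
      by simp (disch := omega) only [tmp_reg_of_ne, e₄]; rfl⟩
    (fun j σ' h => ⟨h.2.1, h.2.2.1, h.2.2.2.1⟩)
    (fun j _ σ' ⟨k, g₁, g₂, g₃, g₄, g₅, g₆⟩ => by
      obtain ⟨σ'', r, k', g⟩ := h₂ σ'
      rw [k.2.1] at r g
      have h1 := k'.2.2.1 q (by omega)
      have h2 := k'.2.2.1 (q + 1) (by omega)
      have h3 := k'.2.2.1 (q + 2) (by omega)
      have h4 := k'.2.2.1 (q + 3) (by omega)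
      have h5 := k'.2.2.1 (q + 4) (by omega)
      refine ⟨σ'', r, by rw [h2, g₂], by rw [h3, g₃],
        keeps_trans_tmp _ (k.trans (k'.mono (by omega))) (by omega), ?_, ?_, ?_, ?_, ?_, ?_⟩
      · simp (disch := omega) only [tmp_reg_of_ne, h1, g₁]
      · simp (disch := omega) only [tmp_reg_self]
      · simp (disch := omega) only [tmp_reg_of_ne, h3, g₃]
      · simp (disch := omega) only [tmp_reg_of_ne, h4, g₄]
      · simp (disch := omega) only [tmp_reg_of_ne, h5, g₅]
      · simp (disch := omega) only [tmp_reg_of_ne, g, g₂, g₄, g₅, g₆]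
        rfl)
  refine ⟨_, r₁.seq ((r₂.mono ?_).seq (Runs.instr _ _)), k₂.trans (keeps_update _ le_rfl), ?_⟩
  · gcongr
    exact hc _ _ _
  · simp only [Instr.run, Function.update_self, f₆]

/-- Repeated addition of b. Only the left factor is a number of iterations, so only it is truncated;
the right factor and the product may exceed V. -/
theorem realizesOp_mul : RealizesOp fun V a b => min a V * b := by
  have := realizesOp_of_iterate (fun _ _ _ => 0) (fun _ _ b _ c => c + b) (fun V a _ => min a V)
    (fun _ _ _ => min_le_right _ _)
    (fun q => ⟨.seq (.instr (.move (2 * (q + 3) + 3) (2 * q + 3)))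
      (.seq (.instr (.move (2 * (q + 4) + 3) (2 * (q + 1) + 3)))
      (.seq (.instr (.const (2 * (q + 5) + 3) 0)) (Program.truncate q))), _, .const 5, fun σ => by
        refine ⟨_, (Runs.instr _ _).seq ((Runs.instr _ _).seq ((Runs.instr _ _).seq
          (runs_truncate _ _))), keeps_trans_tmp _ ((keeps_update _ (by omega)).trans
            ((keeps_update _ (by omega)).trans (keeps_update _ (by omega)))) le_rfl, ?_⟩
        simp (disch := omega) [Instr.run, tmp_reg_of_ne, Function.update_of_ne]⟩)
    (fun q => ⟨.instr (.add (2 * (q + 5) + 3) (2 * (q + 5) + 3) (2 * (q + 4) + 3)), _, .const 1,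
      fun σ => ⟨_, Runs.instr _ _, keeps_update _ le_rfl, by simp [Instr.run]⟩⟩)
  convert this using 4 with V a b
  induction min a V with
  | zero => simp
  | succ m ih => simp [Nat.add_mul, ih]

/-- Repeated multiplication by the base, which is truncated as a left factor; the exponent is
truncated as a number of iterations. The power itself is not truncated, and this is how the bound V
can later be raised exponentially. -/
theorem realizesOp_pow : RealizesOp fun V a b => min a V ^ min b V := by
  have := realizesOp_of_iterate (fun _ _ _ => 1) (fun V a _ _ c => min a V * c)
    (fun V _ b => min b V) (fun _ _ _ => min_le_right _ _)
    (fun q => ⟨.seq (.instr (.move (2 * (q + 3) + 3) (2 * q + 3)))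
      (.seq (.instr (.move (2 * (q + 4) + 3) (2 * (q + 1) + 3)))
      (.seq (.instr (.const (2 * (q + 5) + 3) 1)) (.seq (.instr (.move (2 * q + 3) (2 * (q + 1) + 3)))
      (Program.truncate q)))), _, .const 6, fun σ => by
        refine ⟨_, (Runs.instr _ _).seq ((Runs.instr _ _).seq ((Runs.instr _ _).seq
          ((Runs.instr _ _).seq (runs_truncate _ _)))),
          keeps_trans_tmp _ ((keeps_update _ (by omega)).trans ((keeps_update _ (by omega)).trans
            ((keeps_update _ (by omega)).trans (keeps_update _ le_rfl)))) le_rfl, ?_⟩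
        simp (disch := omega) [Instr.run, tmp_reg_of_ne, Function.update_of_ne]⟩)
    (fun q => by
      obtain ⟨p, B, hB, h⟩ := realizesOp_mul (q + 6)
      refine ⟨.seq (.instr (.move (2 * (q + 6) + 3) (2 * (q + 3) + 3)))
        (.seq (.instr (.move (2 * (q + 7) + 3) (2 * (q + 5) + 3)))
        (.seq p (.instr (.move (2 * (q + 5) + 3) (2 * (q + 6) + 3))))), _,
        (PolyBound.const 1).add ((PolyBound.const 1).add (hB.add (.const 1))), fun σ => ?_⟩
      obtain ⟨σ', r, k, e⟩ := h (Instr.run (Instr.run σ (.move (2 * (q + 6) + 3) (2 * (q + 3) + 3)))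
        (.move (2 * (q + 7) + 3) (2 * (q + 5) + 3)))
      have hV := (keeps_update (q := q + 6) (r := q + 6) (σ := σ) (σ.reg (2 * (q + 3) + 3))
        le_rfl).trans (keeps_update (r := q + 7) (σ.reg (2 * (q + 5) + 3)) (by omega))
      simp (disch := omega) [Instr.run, Function.update_of_ne] at e
      refine ⟨_, (Runs.instr _ _).seq ((Runs.instr _ _).seq (Runs.seq (r.mono ?_)
        (Runs.instr _ _))), ?_, ?_⟩
      · simp (disch := omega) [Instr.run, Function.update_of_ne]
      · exact ((keeps_update _ (by omega)).trans (keeps_update _ (by omega))).trans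
          ((k.mono (by omega)).trans (keeps_update _ le_rfl))
      · simp [Instr.run, e])
  convert this using 4 with V a b
  induction min b V with
  | zero => simp
  | succ m ih => rw [pow_succ, ih, mul_comm]

/-- The accumulator c grows as long as (c + 1) b ≤ a. During the N ≤ V rounds c + 1 stays at most V,
so the truncation in the product has no effect. -/
theorem rec_div_aux {a b V N : ℕ} (hb : b ≠ 0) (hN : N ≤ V) :
    (Nat.rec 0 (fun _ c => if a < min (c + 1) V * b then c else c + 1) N : ℕ) =
      min N (a / b) := by
  induction N with
  | zero => simp
  | succ m ih =>
    simp only [ih (by omega)]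
    have := Nat.div_lt_iff_lt_mul (Nat.pos_of_ne_zero hb) (x := a) (y := min m (a / b) + 1)
    rw [min_eq_left (show min m (a / b) + 1 ≤ V by omega)]
    simp only [← this]
    split_ifs <;> omega

theorem realizesOp_div :
    RealizesOp fun V a b => if b = 0 then min a V else min (a / b) V := by
  have := realizesOp_of_iterate (fun _ _ _ => 0)
    (fun V a b _ c => if a < min (c + 1) V * b then c else c + 1) (fun V a _ => min a V)
    (fun _ _ _ => min_le_right _ _)
    (fun q => ⟨.seq (.instr (.move (2 * (q + 3) + 3) (2 * q + 3)))
      (.seq (.instr (.move (2 * (q + 4) + 3) (2 * (q + 1) + 3)))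
      (.seq (.instr (.const (2 * (q + 5) + 3) 0)) (Program.truncate q))), _, .const 5, fun σ => by
        refine ⟨_, (Runs.instr _ _).seq ((Runs.instr _ _).seq ((Runs.instr _ _).seq
          (runs_truncate _ _))), keeps_trans_tmp _ ((keeps_update _ (by omega)).trans
            ((keeps_update _ (by omega)).trans (keeps_update _ (by omega)))) le_rfl, ?_⟩
        simp (disch := omega) [Instr.run, tmp_reg_of_ne, Function.update_of_ne]⟩)
    (fun q => by
      obtain ⟨p, B, hB, h⟩ := realizesOp_mul (q + 6)
      refine ⟨.seq (.instr (.const (2 * (q + 8) + 3) 1))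
        (.seq (.instr (.add (2 * (q + 6) + 3) (2 * (q + 5) + 3) (2 * (q + 8) + 3)))
        (.seq (.instr (.move (2 * (q + 8) + 3) (2 * (q + 6) + 3)))
        (.seq (.instr (.move (2 * (q + 7) + 3) (2 * (q + 4) + 3)))
        (.seq p (.ite (.lt (2 * (q + 3) + 3) (2 * (q + 6) + 3)) .skip
          (.seq (.instr (.const (2 * (q + 6) + 3) 1))
            (.instr (.add (2 * (q + 5) + 3) (2 * (q + 5) + 3) (2 * (q + 6) + 3))))))))), _,
        (PolyBound.const 1).add ((PolyBound.const 1).add ((PolyBound.const 1).add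
          ((PolyBound.const 1).add (hB.add (.const 3))))), fun σ => ?_⟩
      obtain ⟨σ', r, k, e⟩ := h (Instr.run (Instr.run (Instr.run (Instr.run σ
        (.const (2 * (q + 8) + 3) 1))
        (.add (2 * (q + 6) + 3) (2 * (q + 5) + 3) (2 * (q + 8) + 3)))
        (.move (2 * (q + 8) + 3) (2 * (q + 6) + 3)))
        (.move (2 * (q + 7) + 3) (2 * (q + 4) + 3)))
      have k3 := k.2.2.1 (q + 3) (by omega)
      have k5 := k.2.2.1 (q + 5) (by omega)
      simp (disch := omega) [Instr.run, Function.update_of_ne] at e k3 k5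
      have k' := (((((keeps_update (σ := σ) (q := q + 5) (r := q + 8) _ (by omega)).trans
        (keeps_update _ (by omega))).trans (keeps_update _ (by omega))).trans
        (keeps_update _ (by omega))).trans (k.mono (q' := q + 5) (by omega)))
      by_cases hlt : σ'.reg (2 * (q + 3) + 3) < σ'.reg (2 * (q + 6) + 3)
      · refine ⟨σ', (Runs.instr _ _).seq ((Runs.instr _ _).seq ((Runs.instr _ _).seq
          ((Runs.instr _ _).seq (Runs.seq (r.mono ?_)
          ((Runs.ite_true (b := .lt _ _) hlt (Runs.skip _)).mono (by omega)))))), k', ?_⟩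
        · simp (disch := omega) [Instr.run, Function.update_of_ne]
        · rw [e, k3] at hlt
          rw [k5, if_pos hlt]
      · refine ⟨_, (Runs.instr _ _).seq ((Runs.instr _ _).seq ((Runs.instr _ _).seq
          ((Runs.instr _ _).seq (Runs.seq (r.mono ?_)
          (Runs.ite_false (b := .lt _ _) hlt ((Runs.instr _ _).seq (Runs.instr _ _))))))), k'.trans
            ((keeps_update _ (by omega)).trans (keeps_update _ (by omega))), ?_⟩
        · simp (disch := omega) [Instr.run, Function.update_of_ne]
        · rw [e, k3] at hlt
          rw [if_neg hlt]
          simp (disch := omega) [Instr.run, Function.update_of_ne, k5])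
  convert this using 4 with V a b
  split_ifs with hb
  -- For b = 0 the test a < 0 fails in every round, so the accumulator counts all the rounds. The
  -- value that `Expr.eval` assigns to a division by zero is chosen accordingly.
  · subst hb
    simp only [mul_zero, not_lt_zero, if_false]
    induction min a V with
    | zero => rfl
    | succ m ih => exact congrArg (· + 1) ih
  · rw [rec_div_aux hb (min_le_right _ _)]
    have := Nat.div_le_self a b
    omega

theorem realizes_const (c : ℕ) : Realizes fun _ _ => c := fun q =>
  ⟨.instr (.const (2 * q + 3) c), _, .const 1, fun σ =>
    ⟨_, Runs.instr _ _, keeps_update _ le_rfl, by simp [Instr.run]⟩⟩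

theorem realizes_var (i : ℕ) : Realizes fun _ e => e.x i := fun q =>
  ⟨.instr (.move (2 * q + 3) (2 * i)), _, .const 1, fun σ =>
    ⟨_, Runs.instr _ _, keeps_update _ le_rfl, by simp [Instr.run, State.env]⟩⟩

/-- The guard is needed because the memory from the address V on belongs to the arrays and not to
the input. -/
theorem Realizes.inp {f : ℕ → Env → ℕ} (hf : Realizes f) : Realizes fun V e => e.inp (f V e) := by
  intro q
  obtain ⟨p, B, hB, h⟩ := hf q
  refine ⟨.seq p (.ite (.lt (2 * q + 3) 1) (.instr (.load (2 * q + 3) (2 * q + 3)))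
    (.instr (.const (2 * q + 3) 0))), _, hB.add (.const 2), fun σ => ?_⟩
  obtain ⟨σ', r, k, e⟩ := h σ
  by_cases hlt : σ'.reg (2 * q + 3) < σ'.reg 1
  · refine ⟨_, r.seq (Runs.ite_true (b := .lt _ _) hlt (Runs.instr _ _)),
      k.trans (keeps_update _ le_rfl), ?_⟩
    rw [e, k.2.1] at hlt
    simp only [Instr.run, Function.update_self, e, k.2.2.2.1]
    exact (if_pos hlt).symm
  · refine ⟨_, r.seq (Runs.ite_false (b := .lt _ _) hlt (Runs.instr _ _)),
      k.trans (keeps_update _ le_rfl), ?_⟩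
    rw [e, k.2.1] at hlt
    simp only [Instr.run, Function.update_self]
    exact (if_neg hlt).symm

theorem Realizes.rd {f : ℕ → Env → ℕ} (hf : Realizes f) (i : Fin 16) :
    Realizes fun V e => e.arr i (f V e) := by
  intro q
  obtain ⟨p, B, hB, h⟩ := hf q
  -- Four doublings multiply the index by 16, the number of interleaved arrays; then the number of
  -- the array and the base address V are added.
  refine ⟨.seq p (.seq (.instr (.add (2 * q + 3) (2 * q + 3) (2 * q + 3)))
    (.seq (.instr (.add (2 * q + 3) (2 * q + 3) (2 * q + 3)))
    (.seq (.instr (.add (2 * q + 3) (2 * q + 3) (2 * q + 3)))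
    (.seq (.instr (.add (2 * q + 3) (2 * q + 3) (2 * q + 3)))
    (.seq (.instr (.const (2 * (q + 1) + 3) i))
    (.seq (.instr (.add (2 * q + 3) (2 * q + 3) (2 * (q + 1) + 3)))
    (.seq (.instr (.add (2 * q + 3) 1 (2 * q + 3)))
    (.instr (.load (2 * q + 3) (2 * q + 3)))))))))), _, hB.add (.const 8), fun σ => ?_⟩
  obtain ⟨σ', r, k, e⟩ := h σ
  refine ⟨_, r.seq ((Runs.instr _ _).seq ((Runs.instr _ _).seq ((Runs.instr _ _).seq
    ((Runs.instr _ _).seq ((Runs.instr _ _).seq ((Runs.instr _ _).seq ((Runs.instr _ _).seq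
    (Runs.instr _ _)))))))), ?_, ?_⟩
  · exact k.trans ((keeps_update _ le_rfl).trans ((keeps_update _ le_rfl).trans
      ((keeps_update _ le_rfl).trans ((keeps_update _ le_rfl).trans ((keeps_update _ (by omega)).trans
      ((keeps_update _ le_rfl).trans ((keeps_update _ le_rfl).trans (keeps_update _ le_rfl))))))))
  · simp (disch := omega) only [Instr.run, Function.update_of_ne, Function.update_self, e, k.2.1,
      k.2.2.2.1, State.env]
    congr 1
    omega

theorem Realizes.ite {f g u v : ℕ → Env → ℕ} (hf : Realizes f) (hg : Realizes g)
    (hu : Realizes u) (hv : Realizes v) :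
    Realizes fun V e => if f V e < g V e then u V e else v V e := by
  intro q
  obtain ⟨p₁, B₁, hB₁, h₁⟩ := hf q
  obtain ⟨p₂, B₂, hB₂, h₂⟩ := hg (q + 1)
  obtain ⟨p₃, B₃, hB₃, h₃⟩ := hu q
  obtain ⟨p₄, B₄, hB₄, h₄⟩ := hv q
  refine ⟨.seq p₁ (.seq p₂ (.ite (.lt (2 * q + 3) (2 * (q + 1) + 3)) p₃ p₄)), _,
    hB₁.add (hB₂.add ((PolyBound.const 1).add (hB₃.add hB₄))), fun σ => ?_⟩
  obtain ⟨σ₁, r₁, k₁, e₁⟩ := h₁ σ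
  obtain ⟨σ₂, r₂, k₂, e₂⟩ := h₂ σ₁
  have k₁₂ := k₁.trans (k₂.mono (q' := q) (by omega))
  have e₃ := k₂.2.2.1 q (by omega)
  rw [k₁.2.1, k₁.env] at e₂
  rw [k₁.2.1] at r₂
  by_cases hlt : σ₂.reg (2 * q + 3) < σ₂.reg (2 * (q + 1) + 3)
  · obtain ⟨σ₃, r₃, k₃, e₄⟩ := h₃ σ₂
    rw [k₁₂.2.1] at r₃ e₄
    refine ⟨σ₃, (r₁.seq (r₂.seq (Runs.ite_true (b := .lt _ _) hlt r₃))).mono (by omega),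
      k₁₂.trans k₃, ?_⟩
    rw [e₂, e₃, e₁] at hlt
    beta_reduce at hlt ⊢
    rw [if_pos hlt, e₄, k₁₂.env]
  · obtain ⟨σ₃, r₃, k₃, e₄⟩ := h₄ σ₂
    rw [k₁₂.2.1] at r₃ e₄
    refine ⟨σ₃, (r₁.seq (r₂.seq (Runs.ite_false (b := .lt _ _) hlt r₃))).mono (by omega),
      k₁₂.trans k₃, ?_⟩
    rw [e₂, e₃, e₁] at hlt
    beta_reduce at hlt ⊢
    rw [if_neg hlt, e₄, k₁₂.env]

/-- Assignment of the value `v` to the variable `i`. -/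
def State.setv (σ : State) (i v : ℕ) : State :=
  { σ with reg := Function.update σ.reg (2 * i) v }

theorem env_setv (σ : State) (i v : ℕ) : (σ.setv i v).env = σ.env.set i v := by
  have : (fun j => Function.update σ.reg (2 * i) v (2 * j)) =
      Function.update (fun j => σ.reg (2 * j)) i v := by
    funext j
    by_cases h : j = i
    · subst h; simp
    · rw [Function.update_of_ne h, Function.update_of_ne (by omega)]
  simp (disch := omega) [State.env, State.setv, Env.set, this, Function.update_of_ne]

theorem setv_reg_of_ne (σ : State) {i j : ℕ} (v : ℕ) (h : j ≠ 2 * i) :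
    (σ.setv i v).reg j = σ.reg j := by
  simp [State.setv, Function.update_of_ne h]

theorem setv_setv (σ : State) (i v w : ℕ) : (σ.setv i v).setv i w = σ.setv i w := by
  simp [State.setv]

theorem setv_self (σ : State) (i : ℕ) : σ.setv i (σ.reg (2 * i)) = σ := by
  simp [State.setv]

theorem Keeps.setv {q : ℕ} {σ σ' : State} (h : Keeps q σ σ') (i v : ℕ) :
    Keeps q (σ.setv i v) (σ'.setv i v) := by
  obtain ⟨h1, h2, h3, h4⟩ := h
  refine ⟨fun j => ?_, ?_, fun j hj => ?_, h4⟩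
  · by_cases h : j = i
    · subst h; simp [State.setv]
    · rw [setv_reg_of_ne _ _ (by omega), setv_reg_of_ne _ _ (by omega), h1]
  · rw [setv_reg_of_ne _ _ (by omega), setv_reg_of_ne _ _ (by omega), h2]
  · rw [setv_reg_of_ne _ _ (by omega), setv_reg_of_ne _ _ (by omega), h3 j hj]

/-- The old value of the variable waits in the temporary register q + 1 and is written back, so that
an expression changes temporary registers only. The body is therefore compiled to use registers from
q + 2. -/
theorem Realizes.letE {f g : ℕ → Env → ℕ} (hf : Realizes f) (hg : Realizes g) (i : ℕ) :
    Realizes fun V e => g V (e.set i (f V e)) := by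
  intro q
  obtain ⟨p₁, B₁, hB₁, h₁⟩ := hf q
  obtain ⟨p₂, B₂, hB₂, h₂⟩ := hg (q + 2)
  refine ⟨.seq p₁ (.seq (.instr (.move (2 * (q + 1) + 3) (2 * i)))
    (.seq (.instr (.move (2 * i) (2 * q + 3))) (.seq p₂
    (.seq (.instr (.move (2 * i) (2 * (q + 1) + 3)))
    (.instr (.move (2 * q + 3) (2 * (q + 2) + 3))))))), _,
    hB₁.add ((PolyBound.const 1).add ((PolyBound.const 1).add (hB₂.add (.const 2)))), fun σ => ?_⟩
  obtain ⟨σ₁, r₁, k₁, e₁⟩ := h₁ σ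
  have k₂ := (k₁.trans (keeps_tmp (r := q + 1) σ₁ (σ₁.reg (2 * i)) (by omega))).setv i
    (f (σ.reg 1) σ.env)
  set σ₂ := (σ₁.tmp (q + 1) (σ₁.reg (2 * i))).setv i (f (σ.reg 1) σ.env) with hσ₂
  obtain ⟨σ₃, r₃, k₃, e₃⟩ := h₂ σ₂
  have hr : Runs (.instr (.move (2 * i) (2 * q + 3))) (σ₁.tmp (q + 1) (σ₁.reg (2 * i))) σ₂ 1 := by
    have := Runs.instr (.move (2 * i) (2 * q + 3)) (σ₁.tmp (q + 1) (σ₁.reg (2 * i)))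
    simp (disch := omega) only [Instr.run, tmp_reg_of_ne, e₁] at this
    exact this
  have hV : σ₂.reg 1 = σ.reg 1 := by rw [k₂.2.1, setv_reg_of_ne _ _ (by omega)]
  rw [hV] at r₃ e₃
  have hs : σ₃.reg (2 * (q + 1) + 3) = σ.reg (2 * i) := by
    rw [k₃.2.2.1 (q + 1) (by omega), hσ₂, setv_reg_of_ne _ _ (by omega), tmp_reg_self, k₁.1]
  refine ⟨_, r₁.seq ((Runs.instr _ _).seq (hr.seq (r₃.seq ((Runs.instr _ _).seq
    (Runs.instr _ _))))), ?_, ?_⟩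
  · have k := (k₂.trans (k₃.mono (by omega))).setv i (σ.reg (2 * i))
    rw [setv_setv, setv_self] at k
    refine k.trans ?_
    simp (disch := omega) only [Instr.run, Function.update_of_ne, hs]
    exact keeps_update (σ := σ₃.setv i (σ.reg (2 * i))) _ le_rfl
  · simp (disch := omega) only [Instr.run, Function.update_of_ne, Function.update_self, e₃]
    rw [k₂.env, env_setv]

theorem Realizes.sum {f g : ℕ → Env → ℕ} (hf : Realizes f) (hg : Realizes g) (i : ℕ) :
    Realizes fun V e => ∑ j ∈ Finset.range (min (f V e) V), g V (e.set i j) := by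
  intro q
  obtain ⟨p₁, B₁, hB₁, h₁⟩ := hf q
  obtain ⟨p₂, B₂, hB₂, h₂⟩ := hg (q + 5)
  refine ⟨.seq p₁ (.seq (Program.truncate q) (.seq (.instr (.move (2 * (q + 3) + 3) (2 * i)))
    (.seq (.instr (.const (2 * (q + 4) + 3) 0)) (.seq (Program.repeat q
      (.seq (.instr (.move (2 * i) (2 * (q + 1) + 3))) (.seq p₂
        (.instr (.add (2 * (q + 4) + 3) (2 * (q + 4) + 3) (2 * (q + 5) + 3))))))
    (.seq (.instr (.move (2 * i) (2 * (q + 3) + 3)))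
    (.instr (.move (2 * q + 3) (2 * (q + 4) + 3)))))))), _,
    hB₁.add ((PolyBound.const 2).add ((PolyBound.const 1).add ((PolyBound.const 1).add
      (((PolyBound.id.mul (((PolyBound.const 1).add (hB₂.add (.const 1))).add (.const 2))).add
        (.const 3)).add (.const 2))))), fun σ => ?_⟩
  obtain ⟨σ₁, r₁, k₁, e₁⟩ := h₁ σ
  set V := σ.reg 1 with hV
  set N := min (f V σ.env) V with hN
  obtain ⟨σ₂, r₂, k₂, f₁, f₂, f₃, f₄, f₅⟩ := runs_repeat (q := q)
    (p := .seq (.instr (.move (2 * i) (2 * (q + 1) + 3))) (.seq p₂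
        (.instr (.add (2 * (q + 4) + 3) (2 * (q + 4) + 3) (2 * (q + 5) + 3)))))
    -- The variable `i` changes during the loop, so the comparison is with σ after `i` has been
    -- overwritten by its current value.
    (fun j σ' => Keeps q (σ.setv i (σ'.reg (2 * i))) σ' ∧
      σ'.reg (2 * q + 3) = N ∧ σ'.reg (2 * (q + 1) + 3) = j ∧
      σ'.reg (2 * (q + 2) + 3) = 1 ∧ σ'.reg (2 * (q + 3) + 3) = σ.reg (2 * i) ∧
      σ'.reg (2 * (q + 4) + 3) = ∑ j ∈ Finset.range j, g V (σ.env.set i j))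
    N (1 + (B₂ V + 1)) (((σ₁.tmp q N).tmp (q + 3) (σ.reg (2 * i))).tmp (q + 4) 0)
    ⟨by
      simp (disch := omega) only [tmp_reg_of_ne]
      rw [k₁.1, setv_self]
      exact keeps_trans_tmp _ (keeps_trans_tmp _ (keeps_trans_tmp _ (keeps_trans_tmp _
        (keeps_trans_tmp _ k₁ (by omega)) (by omega)) (by omega)) (by omega)) (by omega),
      by simp (disch := omega) only [tmp_reg_of_ne, tmp_reg_self],
      by simp (disch := omega) only [tmp_reg_of_ne, tmp_reg_self],
      by simp (disch := omega) only [tmp_reg_self],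
      by simp (disch := omega) only [tmp_reg_of_ne, tmp_reg_self],
      by simp (disch := omega) only [tmp_reg_of_ne, tmp_reg_self, Finset.range_zero,
        Finset.sum_empty]⟩
    (fun j σ' h => ⟨h.2.1, h.2.2.1, h.2.2.2.1⟩)
    (fun j hj σ' ⟨k, g₁, g₂, g₃, g₄, g₅⟩ => by
      have kj := k.setv i j
      rw [setv_setv] at kj
      obtain ⟨σ'', r, k', e⟩ := h₂ (σ'.setv i j)
      have hV' : (σ'.setv i j).reg 1 = V := by
        rw [kj.2.1, setv_reg_of_ne _ _ (by omega)]
      rw [hV', kj.env, env_setv] at e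
      rw [hV'] at r
      have l (m : ℕ) (hm : m < q + 5) : σ''.reg (2 * m + 3) = σ'.reg (2 * m + 3) := by
        rw [k'.2.2.1 m hm, setv_reg_of_ne _ _ (by omega)]
      have hr : Runs (.instr (.move (2 * i) (2 * (q + 1) + 3))) σ' (σ'.setv i j) 1 := by
        have := Runs.instr (.move (2 * i) (2 * (q + 1) + 3)) σ'
        rw [Instr.run, g₂] at this
        exact this
      refine ⟨σ''.tmp (q + 4) (σ''.reg (2 * (q + 4) + 3) + σ''.reg (2 * (q + 5) + 3)),
        hr.seq (r.seq (Runs.instr _ _)), ?_, ?_, ?_, ?_, ?_, ?_, ?_, ?_⟩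
      · rw [tmp_reg_of_ne _ _ (by omega), l _ (by omega), g₂]
      · rw [tmp_reg_of_ne _ _ (by omega), l _ (by omega), g₃]
      · simp (disch := omega) only [tmp_reg_of_ne]
        rw [k'.1 i]
        have : (σ'.setv i j).reg (2 * i) = j := by simp [State.setv]
        rw [this]
        exact keeps_trans_tmp _ (keeps_trans_tmp _ (kj.trans (k'.mono (by omega))) (by omega))
          (by omega)
      · simp (disch := omega) only [tmp_reg_of_ne, l, g₁]
      · simp (disch := omega) only [tmp_reg_self]
      · simp (disch := omega) only [tmp_reg_of_ne, l, g₃]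
      · simp (disch := omega) only [tmp_reg_of_ne, l, g₄]
      · simp (disch := omega) only [tmp_reg_of_ne, tmp_reg_self]
        rw [l _ (by omega), g₅, e, Finset.sum_range_succ])
  have hr₂ : Runs (Program.truncate q) σ₁ (σ₁.tmp q N) 2 := by
    have := runs_truncate q σ₁
    rwa [e₁, k₁.2.1] at this
  have hr₃ : Runs (.instr (.move (2 * (q + 3) + 3) (2 * i))) (σ₁.tmp q N)
      ((σ₁.tmp q N).tmp (q + 3) (σ.reg (2 * i))) 1 := by
    have := Runs.instr (.move (2 * (q + 3) + 3) (2 * i)) (σ₁.tmp q N)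
    simp (disch := omega) only [Instr.run, tmp_reg_of_ne, k₁.1] at this
    exact this
  refine ⟨_, r₁.seq (hr₂.seq (hr₃.seq (Runs.seq (Runs.instr _ _) ((r₂.mono ?_).seq
    ((Runs.instr _ _).seq (Runs.instr _ _)))))), ?_, ?_⟩
  · gcongr
    exact min_le_right _ _
  · have k := k₂.setv i (σ.reg (2 * i))
    rw [setv_setv, setv_self] at k
    refine k.trans ?_
    simp (disch := omega) only [Instr.run, Function.update_of_ne, f₄]
    exact keeps_update (σ := σ₂.setv i (σ.reg (2 * i))) _ le_rfl
  · simp (disch := omega) only [Instr.run, Function.update_of_ne, Function.update_self, f₅]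
    rfl

theorem Expr.realizes (a : Expr) : Realizes fun V e => a.eval V e := by
  induction a with
  | const c => exact realizes_const c
  | var i => exact realizes_var i
  | add a b iha ihb => exact realizesOp_add.realizes iha ihb
  | sub a b iha ihb => exact realizesOp_sub.realizes iha ihb
  | mul a b iha ihb => exact realizesOp_mul.realizes iha ihb
  | div a b iha ihb => exact realizesOp_div.realizes iha ihb
  | pow a b iha ihb => exact realizesOp_pow.realizes iha ihb
  | rd i a iha => exact iha.rd i
  | inp a iha => exact iha.inp
  | ite a b c d iha ihb ihc ihd => exact iha.ite ihb ihc ihd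
  | sum i b f ihb ihf => exact ihb.sum ihf i
  | letE i a f iha ihf => exact iha.letE ihf i

/-! ### Compilation of statements -/

/-- A transformation of the environment is computed by programs in polynomial time. -/
def Performs (f : ℕ → Env → Env) : Prop :=
  ∀ q, ∃ p B, PolyBound B ∧ ∀ σ, ∃ σ', Runs p σ σ' (B (σ.reg 1)) ∧ σ'.reg 1 = σ.reg 1 ∧
    (∀ j < q, σ'.reg (2 * j + 3) = σ.reg (2 * j + 3)) ∧ σ'.env = f (σ.reg 1) σ.env

theorem performs_skip : Performs fun _ e => e := fun _ =>
  ⟨.skip, _, .const 0, fun σ => ⟨σ, Runs.skip σ, rfl, fun _ _ => rfl, rfl⟩⟩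

theorem performs_set (i : ℕ) (a : Expr) : Performs fun V e => e.set i (a.eval V e) := by
  intro q
  obtain ⟨p, B, hB, h⟩ := a.realizes q
  refine ⟨.seq p (.instr (.move (2 * i) (2 * q + 3))), _, hB.add (.const 1), fun σ => ?_⟩
  obtain ⟨σ', r, k, e⟩ := h σ
  have h' : (Instr.move (2 * i) (2 * q + 3)).run σ' = σ'.setv i (a.eval (σ.reg 1) σ.env) := by
    beta_reduce at e
    rw [← e]; rfl
  refine ⟨_, r.seq (Runs.instr _ _), ?_, fun j hj => ?_, ?_⟩
  · rw [h', setv_reg_of_ne _ _ (by omega), k.2.1]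
  · rw [h', setv_reg_of_ne _ _ (by omega), k.2.2.1 j hj]
  · rw [h', env_setv, k.env]

theorem performs_store (i : Fin 16) (a b : Expr) :
    Performs fun V e => e.store i (a.eval V e) (b.eval V e) := by
  intro q
  obtain ⟨p₁, B₁, hB₁, h₁⟩ := a.realizes q
  obtain ⟨p₂, B₂, hB₂, h₂⟩ := b.realizes (q + 1)
  refine ⟨.seq p₁ (.seq p₂ (.seq (.instr (.add (2 * q + 3) (2 * q + 3) (2 * q + 3)))
    (.seq (.instr (.add (2 * q + 3) (2 * q + 3) (2 * q + 3)))
    (.seq (.instr (.add (2 * q + 3) (2 * q + 3) (2 * q + 3)))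
    (.seq (.instr (.add (2 * q + 3) (2 * q + 3) (2 * q + 3)))
    (.seq (.instr (.const (2 * (q + 2) + 3) i))
    (.seq (.instr (.add (2 * q + 3) (2 * q + 3) (2 * (q + 2) + 3)))
    (.seq (.instr (.add (2 * q + 3) 1 (2 * q + 3)))
    (.instr (.store (2 * q + 3) (2 * (q + 1) + 3))))))))))), _, hB₁.add (hB₂.add (.const 8)),
    fun σ => ?_⟩
  obtain ⟨σ₁, r₁, k₁, e₁⟩ := h₁ σ
  obtain ⟨σ₂, r₂, k₂, e₂⟩ := h₂ σ₁
  rw [k₁.2.1] at r₂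
  rw [k₁.2.1, k₁.env] at e₂
  beta_reduce at e₁ e₂ ⊢
  generalize a.eval (σ.reg 1) σ.env = A at *
  generalize b.eval (σ.reg 1) σ.env = C at *
  have k₁₂ := k₁.trans (k₂.mono (q' := q) (by omega))
  have e₃ := k₂.2.2.1 q (by omega)
  refine ⟨_, r₁.seq (r₂.seq ((Runs.instr _ _).seq ((Runs.instr _ _).seq ((Runs.instr _ _).seq
    ((Runs.instr _ _).seq ((Runs.instr _ _).seq ((Runs.instr _ _).seq ((Runs.instr _ _).seq
    (Runs.instr _ _))))))))), ?_, fun j hj => ?_, ?_⟩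
  · simp (disch := omega) only [Instr.run, Function.update_of_ne, k₁₂.2.1]
  · simp (disch := omega) only [Instr.run, Function.update_of_ne, k₁₂.2.2.1 j hj]
  · simp (disch := omega) only [Instr.run, Function.update_of_ne, Function.update_self, e₂, e₃, e₁,
      k₁₂.2.1, k₁₂.2.2.2.1, k₁₂.2.2.2.2.1, k₁₂.2.2.2.2.2, k₁₂.1, State.env, Env.store]
    have hi := i.2
    congr 1
    · funext c m
      by_cases hc : c = i
      · subst hc
        rw [Function.update_self]
        by_cases hm : m = A
        · subst hm
          rw [Function.update_self, Function.update_apply, if_pos (by omega)]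
        · rw [Function.update_of_ne hm, Function.update_of_ne (by omega)]
      · rw [Function.update_of_ne hc, Function.update_of_ne]
        -- Addresses in different arrays differ modulo 16.
        have : (c : ℕ) ≠ i := fun h => hc (Fin.ext h)
        omega

theorem Performs.seq {f g : ℕ → Env → Env} (hf : Performs f) (hg : Performs g) :
    Performs fun V e => g V (f V e) := by
  intro q
  obtain ⟨p₁, B₁, hB₁, h₁⟩ := hf q
  obtain ⟨p₂, B₂, hB₂, h₂⟩ := hg q
  refine ⟨.seq p₁ p₂, _, hB₁.add hB₂, fun σ => ?_⟩
  obtain ⟨σ₁, r₁, v₁, k₁, e₁⟩ := h₁ σ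
  obtain ⟨σ₂, r₂, v₂, k₂, e₂⟩ := h₂ σ₁
  rw [v₁] at r₂ v₂ e₂
  exact ⟨σ₂, r₁.seq r₂, v₂, fun j hj => (k₂ j hj).trans (k₁ j hj), by rw [e₂, e₁]⟩

theorem Performs.ite {f g : ℕ → Env → Env} (a b : Expr) (hf : Performs f) (hg : Performs g) :
    Performs fun V e => if a.eval V e < b.eval V e then f V e else g V e := by
  intro q
  obtain ⟨p₁, B₁, hB₁, h₁⟩ := a.realizes q
  obtain ⟨p₂, B₂, hB₂, h₂⟩ := b.realizes (q + 1)
  obtain ⟨p₃, B₃, hB₃, h₃⟩ := hf q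
  obtain ⟨p₄, B₄, hB₄, h₄⟩ := hg q
  refine ⟨.seq p₁ (.seq p₂ (.ite (.lt (2 * q + 3) (2 * (q + 1) + 3)) p₃ p₄)), _,
    hB₁.add (hB₂.add ((PolyBound.const 1).add (hB₃.add hB₄))), fun σ => ?_⟩
  obtain ⟨σ₁, r₁, k₁, e₁⟩ := h₁ σ
  obtain ⟨σ₂, r₂, k₂, e₂⟩ := h₂ σ₁
  have k₁₂ := k₁.trans (k₂.mono (q' := q) (by omega))
  have e₃ := k₂.2.2.1 q (by omega)
  rw [k₁.2.1, k₁.env] at e₂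
  rw [k₁.2.1] at r₂
  by_cases hlt : σ₂.reg (2 * q + 3) < σ₂.reg (2 * (q + 1) + 3)
  · obtain ⟨σ₃, r₃, v₃, k₃, e₄⟩ := h₃ σ₂
    rw [k₁₂.2.1] at r₃ v₃ e₄
    refine ⟨σ₃, (r₁.seq (r₂.seq (Runs.ite_true (b := .lt _ _) hlt r₃))).mono (by omega), v₃,
      fun j hj => (k₃ j hj).trans (k₁₂.2.2.1 j hj), ?_⟩
    rw [e₂, e₃, e₁] at hlt
    beta_reduce at hlt ⊢
    rw [if_pos hlt, e₄, k₁₂.env]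
  · obtain ⟨σ₃, r₃, v₃, k₃, e₄⟩ := h₄ σ₂
    rw [k₁₂.2.1] at r₃ v₃ e₄
    refine ⟨σ₃, (r₁.seq (r₂.seq (Runs.ite_false (b := .lt _ _) hlt r₃))).mono (by omega), v₃,
      fun j hj => (k₃ j hj).trans (k₁₂.2.2.1 j hj), ?_⟩
    rw [e₂, e₃, e₁] at hlt
    beta_reduce at hlt ⊢
    rw [if_neg hlt, e₄, k₁₂.env]

/-- The body is a statement and may overwrite the loop variable. The count is therefore kept in a
temporary register and copied to the variable before each execution of the body. -/
theorem Performs.loop {f : ℕ → Env → Env} (hf : Performs f) (i : ℕ) (b : Expr) :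
    Performs fun V e => (iterate (f V) i (min (b.eval V e) V) e).set i (e.x i) := by
  intro q
  obtain ⟨p₁, B₁, hB₁, h₁⟩ := b.realizes q
  obtain ⟨p₂, B₂, hB₂, h₂⟩ := hf (q + 4)
  refine ⟨.seq p₁ (.seq (Program.truncate q) (.seq (.instr (.move (2 * (q + 3) + 3) (2 * i)))
    (.seq (Program.repeat q (.seq (.instr (.move (2 * i) (2 * (q + 1) + 3))) p₂))
    (.instr (.move (2 * i) (2 * (q + 3) + 3)))))), _,
    hB₁.add ((PolyBound.const 2).add ((PolyBound.const 1).add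
      (((PolyBound.id.mul (((PolyBound.const 1).add hB₂).add (.const 2))).add
        (.const 3)).add (.const 1)))), fun σ => ?_⟩
  obtain ⟨σ₁, r₁, k₁, e₁⟩ := h₁ σ
  set V := σ.reg 1 with hV
  set N := min (b.eval V σ.env) V with hN
  set σ₀ := (σ₁.tmp q N).tmp (q + 3) (σ.reg (2 * i)) with hσ₀
  have k₀ : Keeps q σ ((σ₀.tmp (q + 1) 0).tmp (q + 2) 1) :=
    keeps_trans_tmp _ (keeps_trans_tmp _ (keeps_trans_tmp _ (keeps_trans_tmp _ k₁ (by omega))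
      (by omega)) (by omega)) (by omega)
  obtain ⟨σ₂, r₂, g₁, g₂, g₃, f₁, f₂, f₃, f₄⟩ := runs_repeat (q := q)
    (p := .seq (.instr (.move (2 * i) (2 * (q + 1) + 3))) p₂)
    (fun j σ' => σ'.env = iterate (f V) i j σ.env ∧ σ'.reg 1 = V ∧
      (∀ j < q, σ'.reg (2 * j + 3) = σ.reg (2 * j + 3)) ∧
      σ'.reg (2 * q + 3) = N ∧ σ'.reg (2 * (q + 1) + 3) = j ∧
      σ'.reg (2 * (q + 2) + 3) = 1 ∧ σ'.reg (2 * (q + 3) + 3) = σ.reg (2 * i))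
    N (1 + B₂ V) σ₀
    ⟨k₀.env, k₀.2.1, k₀.2.2.1,
      by simp (disch := omega) only [hσ₀, tmp_reg_of_ne, tmp_reg_self],
      by simp (disch := omega) only [hσ₀, tmp_reg_of_ne, tmp_reg_self],
      by simp (disch := omega) only [tmp_reg_self],
      by simp (disch := omega) only [hσ₀, tmp_reg_of_ne, tmp_reg_self]⟩
    (fun j σ' h => ⟨h.2.2.2.1, h.2.2.2.2.1, h.2.2.2.2.2.1⟩)
    (fun j hj σ' ⟨ke, kv, kt, g₁, g₂, g₃, g₄⟩ => by
      obtain ⟨σ'', r, v, k, e⟩ := h₂ (σ'.setv i j)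
      have hV' : (σ'.setv i j).reg 1 = V := by rw [setv_reg_of_ne _ _ (by omega), kv]
      rw [hV', env_setv, ke] at e
      rw [hV'] at r v
      have l (m : ℕ) (hm : m < q + 4) : σ''.reg (2 * m + 3) = σ'.reg (2 * m + 3) := by
        rw [k m hm, setv_reg_of_ne _ _ (by omega)]
      have hr : Runs (.instr (.move (2 * i) (2 * (q + 1) + 3))) σ' (σ'.setv i j) 1 := by
        have := Runs.instr (.move (2 * i) (2 * (q + 1) + 3)) σ'
        rw [Instr.run, g₂] at this
        exact this
      refine ⟨σ'', hr.seq r, by rw [l _ (by omega), g₂], by rw [l _ (by omega), g₃],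
        ?_, ?_, fun m hm => ?_, ?_, ?_, ?_, ?_⟩
      · rw [(keeps_tmp (q := q) σ'' (j + 1) (by omega)).env, e]
        rfl
      · rw [tmp_reg_of_ne _ _ (by omega), v]
      · rw [tmp_reg_of_ne _ _ (by omega), l _ (by omega), kt m hm]
      · simp (disch := omega) only [tmp_reg_of_ne, l, g₁]
      · simp (disch := omega) only [tmp_reg_self]
      · simp (disch := omega) only [tmp_reg_of_ne, l, g₃]
      · simp (disch := omega) only [tmp_reg_of_ne, l, g₄])
  have hr₂ : Runs (Program.truncate q) σ₁ (σ₁.tmp q N) 2 := by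
    have := runs_truncate q σ₁
    rwa [e₁, k₁.2.1] at this
  have hr₃ : Runs (.instr (.move (2 * (q + 3) + 3) (2 * i))) (σ₁.tmp q N) σ₀ 1 := by
    have := Runs.instr (.move (2 * (q + 3) + 3) (2 * i)) (σ₁.tmp q N)
    simp (disch := omega) only [Instr.run, tmp_reg_of_ne, k₁.1] at this
    exact this
  have h' : (Instr.move (2 * i) (2 * (q + 3) + 3)).run σ₂ = σ₂.setv i (σ.reg (2 * i)) := by
    rw [← f₄]; rfl
  refine ⟨_, r₁.seq (hr₂.seq (hr₃.seq ((r₂.mono ?_).seq (Runs.instr _ _)))), ?_, fun j hj => ?_, ?_⟩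
  · gcongr
    exact min_le_right _ _
  · rw [h', setv_reg_of_ne _ _ (by omega), g₂]
  · rw [h', setv_reg_of_ne _ _ (by omega), g₃ j hj]
  · rw [h', env_setv, g₁]
    rfl

theorem performs_rload (r : ℕ) (a : Expr) : Performs fun V e =>
    { e with rreg := Function.update e.rreg r (e.rmem (a.eval V e)) } := by
  intro q
  obtain ⟨p, B, hB, h⟩ := a.realizes q
  refine ⟨.seq p (.instr (.rload r (2 * q + 3))), _, hB.add (.const 1), fun σ => ?_⟩
  obtain ⟨σ', hr, k, e⟩ := h σ
  refine ⟨_, hr.seq (Runs.instr _ _), k.2.1, k.2.2.1, ?_⟩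
  beta_reduce
  rw [← k.env, show a.eval (σ.reg 1) σ'.env = σ'.reg (2 * q + 3) by rw [e, k.env]]
  rfl

theorem performs_rstore (r : ℕ) (a : Expr) : Performs fun V e =>
    { e with rmem := Function.update e.rmem (a.eval V e) (e.rreg r) } := by
  intro q
  obtain ⟨p, B, hB, h⟩ := a.realizes q
  refine ⟨.seq p (.instr (.rstore (2 * q + 3) r)), _, hB.add (.const 1), fun σ => ?_⟩
  obtain ⟨σ', hr, k, e⟩ := h σ
  refine ⟨_, hr.seq (Runs.instr _ _), k.2.1, k.2.2.1, ?_⟩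
  beta_reduce
  rw [← k.env, show a.eval (σ.reg 1) σ'.env = σ'.reg (2 * q + 3) by rw [e, k.env]]
  rfl

theorem performs_radd (r r₁ r₂ : ℕ) : Performs fun _ e =>
    { e with rreg := Function.update e.rreg r (e.rreg r₁ + e.rreg r₂) } := fun _ =>
  ⟨.instr (.radd r r₁ r₂), _, .const 1, fun _ =>
    ⟨_, Runs.instr _ _, rfl, fun _ _ => rfl, rfl⟩⟩

open Classical in
theorem Performs.rite {f g : ℕ → Env → Env} (r₁ r₂ : ℕ) (hf : Performs f) (hg : Performs g) :
    Performs fun V e => if e.rreg r₁ < e.rreg r₂ then f V e else g V e := by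
  intro q
  obtain ⟨p₃, B₃, hB₃, h₃⟩ := hf q
  obtain ⟨p₄, B₄, hB₄, h₄⟩ := hg q
  refine ⟨.ite (.rlt r₁ r₂) p₃ p₄, _, (PolyBound.const 1).add (hB₃.add hB₄), fun σ => ?_⟩
  by_cases hlt : σ.rreg r₁ < σ.rreg r₂
  · obtain ⟨σ₃, hr, v, k, e⟩ := h₃ σ
    exact ⟨σ₃, (Runs.ite_true (b := .rlt _ _) hlt hr).mono (by omega), v, k,
      e.trans (if_pos hlt).symm⟩
  · obtain ⟨σ₃, hr, v, k, e⟩ := h₄ σ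
    exact ⟨σ₃, (Runs.ite_false (b := .rlt _ _) hlt hr).mono (by omega), v, k,
      e.trans (if_neg hlt).symm⟩

/-- Statements are compiled to programs that run in time polynomial in `V`. -/
theorem Stmt.performs (p : Stmt) : Performs fun V e => p.run V e := by
  induction p with
  | skip => exact performs_skip
  | set i a => exact performs_set i a
  | store i a b => exact performs_store i a b
  | seq p q ihp ihq => exact ihp.seq ihq
  | ite a b p q ihp ihq => exact ihp.ite a b ihq
  | loop i b p ih => exact ih.loop i b
  | rload r a => exact performs_rload r a
  | rstore a r => exact performs_rstore r a
  | radd r r₁ r₂ => exact performs_radd r r₁ r₂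
  | rite r₁ r₂ p q ihp ihq => exact ihp.rite r₁ r₂ ihq

/-! ### A family of hash functions -/

/-- The multiplicative hash function with multiplier `a` modulo `p` and range `K`. -/
def hash (a p K x : ℕ) : ℕ := a * x % p % K

/-- For a multiplier a counted here, the difference of the residues of ax and ay is a multiple of K
between 1 and p - 1. It is congruent to a(x - y) modulo p, so different multipliers have different
differences. -/
theorem card_hash_lt {p K x y : ℕ} (hp : p.Prime) (hx : x < p) (hy : y < p) (hxy : x ≠ y) :
    ((Finset.range p).filter fun a => a * y % p < a * x % p ∧ hash a p K x = hash a p K y).card ≤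
      (p - 1) / K := by
  rw [← Nat.card_multiples (p - 1) K]
  have := Fact.mk hp
  -- The shift by one matches `Nat.card_multiples`, which counts the numbers m < p - 1 such that K
  -- divides m + 1.
  apply Finset.card_le_card_of_injOn (fun a => a * x % p - a * y % p - 1)
  · intro a ha
    have ha := Finset.mem_filter.1 (Finset.mem_coe.1 ha)
    simp only [hash, Finset.mem_range] at ha
    apply Finset.mem_coe.2
    rw [Finset.mem_filter, Finset.mem_range]
    obtain ⟨h1, h2, h3⟩ := ha
    have h4 := Nat.mod_lt (a * x) hp.pos
    beta_reduce
    refine ⟨by omega, ?_⟩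
    rw [show a * x % p - a * y % p - 1 + 1 = a * x % p - a * y % p by omega]
    exact (Nat.modEq_iff_dvd' h2.le).1 h3.symm
  · intro a ha b hb hab
    have ha := Finset.mem_filter.1 (Finset.mem_coe.1 ha)
    have hb := Finset.mem_filter.1 (Finset.mem_coe.1 hb)
    simp only [Finset.mem_range] at ha hb hab
    have e : a * x % p + b * y % p = b * x % p + a * y % p := by omega
    have e' := congrArg (Nat.cast : ℕ → ZMod p) e
    push_cast at e'
    simp only [ZMod.natCast_mod, Nat.cast_mul] at e'
    have h : ((a : ZMod p) - b) * ((x : ZMod p) - y) = 0 := by linear_combination e'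
    rcases mul_eq_zero.1 h with h | h
    · have := (ZMod.natCast_eq_natCast_iff' _ _ _).1 (sub_eq_zero.1 h)
      rwa [Nat.mod_eq_of_lt ha.1, Nat.mod_eq_of_lt hb.1] at this
    · have := (ZMod.natCast_eq_natCast_iff' _ _ _).1 (sub_eq_zero.1 h)
      rw [Nat.mod_eq_of_lt hx, Nat.mod_eq_of_lt hy] at this
      exact absurd this hxy

/-- Either of the two residues may be the larger one, which doubles the previous bound. They are
never equal, because multipliers from 1 to p - 1 are invertible modulo p. -/
theorem card_hash_eq {p K x y : ℕ} (hp : p.Prime) (hx : x < p) (hy : y < p) (hxy : x ≠ y) :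
    K * ((Finset.Ico 1 p).filter fun a => hash a p K x = hash a p K y).card ≤ 2 * (p - 1) := by
  have := Fact.mk hp
  have h1 := card_hash_lt (K := K) hp hx hy hxy
  have h2 := card_hash_lt (K := K) hp hy hx hxy.symm
  have h3 : ((Finset.Ico 1 p).filter fun a => hash a p K x = hash a p K y) ⊆
      ((Finset.range p).filter fun a => a * y % p < a * x % p ∧ hash a p K x = hash a p K y) ∪
      ((Finset.range p).filter fun a => a * x % p < a * y % p ∧ hash a p K y = hash a p K x) := by
    intro a ha
    simp only [Finset.mem_filter, Finset.mem_Ico, Finset.mem_union, Finset.mem_range] at ha ⊢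
    rcases lt_trichotomy (a * y % p) (a * x % p) with h | h | h
    · exact .inl ⟨by omega, h, ha.2⟩
    · exfalso
      have e := (ZMod.natCast_eq_natCast_iff' _ _ _).2 h
      push_cast at e
      have ha0 : (a : ZMod p) ≠ 0 := by
        intro h0
        have := (ZMod.natCast_eq_zero_iff _ _).1 h0
        have := Nat.le_of_dvd (by omega) this
        omega
      have := (ZMod.natCast_eq_natCast_iff' _ _ _).1 (mul_left_cancel₀ ha0 e)
      rw [Nat.mod_eq_of_lt hx, Nat.mod_eq_of_lt hy] at this
      exact hxy this.symm
    · exact .inr ⟨by omega, h, ha.2.symm⟩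
  have h4 := (Finset.card_le_card h3).trans (Finset.card_union_le _ _)
  calc _ ≤ K * ((p - 1) / K + (p - 1) / K) := Nat.mul_le_mul_left _ (by omega)
    _ = 2 * (K * ((p - 1) / K)) := by ring
    _ ≤ 2 * (p - 1) := Nat.mul_le_mul_left _ (Nat.mul_div_le _ _)

/-- The pairs of distinct elements of `S` that collide under a hash function. -/
def collisions (S : Finset ℕ) (a p K : ℕ) : Finset (ℕ × ℕ) :=
  (S ×ˢ S).filter fun z => z.1 ≠ z.2 ∧ hash a p K z.1 = hash a p K z.2

/-- Averaging: each ordered pair of distinct elements collides for at most 2(p - 1) / K of the p - 1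
nonzero multipliers, so some multiplier has at most 2|S|² / K colliding pairs. -/
theorem exists_few_collisions {p K : ℕ} (hp : p.Prime) {S : Finset ℕ}
    (hS : ∀ x ∈ S, x < p) :
    ∃ a < p, K * (collisions S a p K).card ≤ 2 * S.card ^ 2 := by
  by_contra! hcon
  have h1 : ∑ a ∈ Finset.Ico 1 p, K * (collisions S a p K).card ≤
      ∑ a ∈ Finset.Ico 1 p, 2 * S.card ^ 2 := by
    have : ∀ a, (collisions S a p K).card =
        ∑ z ∈ (S ×ˢ S).filter (fun z => z.1 ≠ z.2),
          if hash a p K z.1 = hash a p K z.2 then 1 else 0 := by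
      intro a
      rw [← Finset.card_filter, Finset.filter_filter]
      rfl
    simp_rw [this, Finset.mul_sum]
    rw [Finset.sum_comm]
    calc _ ≤ ∑ z ∈ (S ×ˢ S).filter (fun z => z.1 ≠ z.2), 2 * (p - 1) := by
          apply Finset.sum_le_sum
          intro z hz
          simp only [Finset.mem_filter, Finset.mem_product] at hz
          rw [← Finset.mul_sum, ← Finset.card_filter]
          exact card_hash_eq hp (hS _ hz.1.1) (hS _ hz.1.2) hz.2
      _ ≤ (S.card ^ 2) * (2 * (p - 1)) := by
          rw [Finset.sum_const, smul_eq_mul]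
          apply Nat.mul_le_mul_right
          calc _ ≤ (S ×ˢ S).card := Finset.card_filter_le _ _
            _ = _ := by rw [Finset.card_product, sq]
      _ = _ := by rw [Finset.sum_const, Nat.card_Ico, smul_eq_mul]; ring
  have h2 : ∑ a ∈ Finset.Ico 1 p, 2 * S.card ^ 2 <
      ∑ a ∈ Finset.Ico 1 p, K * (collisions S a p K).card := by
    apply Finset.sum_lt_sum_of_nonempty
    · exact ⟨1, by simp [hp.one_lt]⟩
    · intro a ha
      exact hcon a (Finset.mem_Ico.1 ha).2
  omega

/-- With a range larger than 2|S|² the number of collisions of the previous lemma is less than 1. -/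
theorem exists_injOn_hash {p K : ℕ} (hp : p.Prime) {S : Finset ℕ} (hS : ∀ x ∈ S, x < p)
    (hK : 2 * S.card ^ 2 < K) : ∃ a < p, Set.InjOn (hash a p K) S := by
  obtain ⟨a, ha, h⟩ := exists_few_collisions hp (K := K) hS
  refine ⟨a, ha, fun x hx y hy hxy => ?_⟩
  by_contra hne
  have : 0 < (collisions S a p K).card := Finset.card_pos.2 ⟨(x, y), by
    simp only [collisions, Finset.mem_filter, Finset.mem_product]
    exact ⟨⟨hx, hy⟩, hne, hxy⟩⟩
  nlinarith

/-! ### Bits on a small set, encoded in a table of linear size -/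

/-- A function with values in `{0, 1}` that depends on a table `T` of bits through hash functions
with ranges of the sizes `4, 8, …, 2 ^ (L + 2)`. -/
def tableSum (T a : ℕ → ℕ) (p L z : ℕ) : ℕ :=
  (∑ i ∈ Finset.range (L + 1), T (2 ^ (i + 2) + hash (a i) p (2 ^ (i + 2)) z)) % 2

theorem hash_lt {a p K x : ℕ} (hK : 0 < K) : hash a p K x < K := Nat.mod_lt _ hK

/-- Level i reads only table entries with positions from 2^(i+2) to 2^(i+3) - 1. The levels use
disjoint blocks, and all levels up to L together use positions below 2^(L+3). -/
theorem tableSum_congr {T T' a a' : ℕ → ℕ} {p L : ℕ} (z : ℕ)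
    (hT : ∀ m < 2 ^ (L + 3), T m = T' m) (ha : ∀ i ≤ L, a i = a' i) :
    tableSum T a p L z = tableSum T' a' p L z := by
  unfold tableSum
  congr 1
  apply Finset.sum_congr rfl
  intro i hi
  have hi' : i ≤ L := by simpa [Nat.lt_succ_iff] using hi
  rw [ha i hi', hT]
  have h1 : hash (a' i) p (2 ^ (i + 2)) z < 2 ^ (i + 2) := hash_lt (by positivity)
  have h2 : 2 ^ (i + 3) ≤ 2 ^ (L + 3) := Nat.pow_le_pow_right (by omega) (by omega)
  have h3 : 2 ^ (i + 3) = 2 * 2 ^ (i + 2) := by ring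
  omega

theorem tableSum_succ (T a : ℕ → ℕ) (p L z : ℕ) : tableSum T a p (L + 1) z =
    (tableSum T a p L z + T (2 ^ (L + 3) + hash (a (L + 1)) p (2 ^ (L + 3)) z)) % 2 := by
  unfold tableSum
  rw [Finset.sum_range_succ, Nat.mod_add_mod]

open Classical in
/-- The elements of `S` that collide with no other element. -/
noncomputable def isolated (S : Finset ℕ) (a p K : ℕ) : Finset ℕ :=
  S.filter fun x => ∀ y ∈ S, hash a p K y = hash a p K x → y = x

theorem card_not_isolated_le (S : Finset ℕ) (a p K : ℕ) :
    (S \ isolated S a p K).card ≤ (collisions S a p K).card := by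
  classical
  calc _ ≤ ((collisions S a p K).image Prod.fst).card := by
        apply Finset.card_le_card
        intro x hx
        simp only [isolated, Finset.mem_sdiff, Finset.mem_filter, not_and, not_forall] at hx
        obtain ⟨y, hy, hyx, hne⟩ := hx.2 hx.1
        simp only [collisions, Finset.mem_image, Finset.mem_filter, Finset.mem_product, Prod.exists]
        exact ⟨x, y, ⟨⟨hx.1, hy⟩, Ne.symm hne, hyx.symm⟩, rfl⟩
    _ ≤ _ := Finset.card_image_le

/-- Induction on L. For |S| ≤ 2^(L+1) and K = 2^(L+3) some multiplier has at most 2|S|² / K ≤ 2^L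
collisions, so at most 2^L elements share their top-level entry with another element. These are
handled by the lower levels, whatever the lower levels give for the isolated elements; each isolated
element corrects the parity in its own entry of the top level. The table has only O(|S|) bits, and
this keeps the number of tables at 2^O(|S|). -/
theorem exists_tableSum_eq {p : ℕ} (hp : p.Prime) {g : ℕ → ℕ} (hg : ∀ x, g x < 2) (L : ℕ)
    {S : Finset ℕ} (hS : ∀ x ∈ S, x < p) (hL : S.card ≤ 2 ^ L) :
    ∃ a T : ℕ → ℕ, (∀ i, a i < p) ∧ (∀ i, T i < 2) ∧ ∀ z ∈ S, tableSum T a p L z = g z := by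
  classical
  induction L generalizing S with
  | zero =>
    refine ⟨fun _ => 0, fun i => if h : ∃ z ∈ S, True then g h.choose else 0,
      fun _ => hp.pos, fun i => ?_, fun z hz => ?_⟩
    · dsimp only
      split_ifs
      · exact hg _
      · omega
    · have h : ∃ z ∈ S, True := ⟨z, hz, trivial⟩
      have : h.choose = z := Finset.card_le_one.1 (by simpa using hL) _ h.choose_spec.1 _ hz
      simp only [tableSum, Finset.sum_range_succ, Finset.sum_range_zero, zero_add, dif_pos h, this]
      exact Nat.mod_eq_of_lt (hg z)
  | succ L ih =>
    obtain ⟨b, hb, hcol⟩ := exists_few_collisions hp (K := 2 ^ (L + 3)) hS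
    set K := 2 ^ (L + 3) with hK
    have hcard : (S \ isolated S b p K).card ≤ 2 ^ L := by
      have h1 := card_not_isolated_le S b p K
      have h2 : 2 * S.card ^ 2 ≤ 2 * (2 ^ (L + 1)) ^ 2 := by gcongr
      have h3 : 2 * (2 ^ (L + 1)) ^ 2 = K * 2 ^ L := by rw [hK]; ring
      have h4 : K * (collisions S b p K).card ≤ K * 2 ^ L := by omega
      have h5 := Nat.le_of_mul_le_mul_left h4 (by positivity)
      omega
    obtain ⟨a, T, ha, hT, h⟩ := ih (S := S \ isolated S b p K)
      (fun x hx => hS x (Finset.mem_sdiff.1 hx).1) hcard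
    refine ⟨fun i => if i = L + 1 then b else a i, fun m =>
      if m < K then T m else if h : ∃ x ∈ isolated S b p K, K + hash b p K x = m then
        (g h.choose + tableSum T a p L h.choose) % 2 else 0, fun i => ?_, fun m => ?_,
        fun z hz => ?_⟩
    · dsimp only
      split_ifs
      exacts [hb, ha i]
    · dsimp only
      split_ifs
      exacts [hT m, Nat.mod_lt _ (by omega), by omega]
    · rw [tableSum_succ, tableSum_congr (T' := T) (a' := a) z
        (fun m hm => if_pos hm) (fun i hi => if_neg (by omega))]
      simp only [if_true, ← hK]
      rw [if_neg (by omega)]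
      by_cases hz' : z ∈ isolated S b p K
      · have hex : ∃ x ∈ isolated S b p K, K + hash b p K x = K + hash b p K z := ⟨z, hz', rfl⟩
        rw [dif_pos hex]
        have heq : hex.choose = z := by
          obtain ⟨h1, h2⟩ := hex.choose_spec
          generalize hex.choose = y at h1 h2
          simp only [isolated, Finset.mem_filter] at h1 hz'
          exact hz'.2 _ h1.1 (by omega)
        rw [heq]
        have h1 := hg z
        have h2 : tableSum T a p L z < 2 := Nat.mod_lt _ (by omega)
        omega
      · rw [dif_neg, h z (Finset.mem_sdiff.2 ⟨hz, hz'⟩)]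
        · exact Nat.mod_eq_of_lt (hg z)
        -- An element that is not isolated shares no entry with an isolated one, so its top entry
        -- has the default value 0 and does not disturb the lower levels.
        · rintro ⟨x, hx, hxz⟩
          simp only [isolated, Finset.mem_filter] at hx hz'
          have := hx.2 z hz (by omega)
          subst this
          exact hz' hx

/-! ### Packing of vectors into numbers, and the description of colourings by seeds -/

/-- The digit number `i` of `s` in base `b`. -/
def digit (b i s : ℕ) : ℕ := s / b ^ i % b

theorem digit_lt {b : ℕ} (hb : 0 < b) (i s : ℕ) : digit b i s < b := Nat.mod_lt _ hb

theorem sum_digits_lt {b : ℕ} {f : ℕ → ℕ} {m : ℕ} (hf : ∀ i < m, f i < b) :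
    ∑ i ∈ Finset.range m, f i * b ^ i < b ^ m := by
  induction m with
  | zero => simp
  | succ m ih =>
    rw [Finset.sum_range_succ, pow_succ]
    have h1 := ih fun i hi => hf i (by omega)
    have h2 := hf m (by omega)
    calc _ < b ^ m + f m * b ^ m := by omega
      _ = (f m + 1) * b ^ m := by ring
      _ ≤ b * b ^ m := Nat.mul_le_mul_right _ h2
      _ = _ := mul_comm _ _

theorem digit_sum {b : ℕ} {f : ℕ → ℕ} {m : ℕ} (hf : ∀ i < m, f i < b) {i : ℕ} (hi : i < m) :
    digit b i (∑ i ∈ Finset.range m, f i * b ^ i) = f i := by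
  induction m with
  | zero => omega
  | succ m ih =>
    have hb : 0 < b := lt_of_le_of_lt (Nat.zero_le _) (hf i hi)
    rw [Finset.sum_range_succ]
    rcases Nat.lt_succ_iff_lt_or_eq.1 hi with h | rfl
    · rw [← ih (fun i hi => hf i (by omega)) h]
      unfold digit
      obtain ⟨c, rfl⟩ : ∃ c, m = i + 1 + c := ⟨m - (i + 1), by omega⟩
      rw [show f (i + 1 + c) * b ^ (i + 1 + c) = b ^ i * (b * (f (i + 1 + c) * b ^ c)) by ring,
        Nat.add_mul_div_left _ _ (by positivity), Nat.add_mul_mod_self_left]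
    · unfold digit
      have h1 := sum_digits_lt (m := i) fun j hj => hf j (by omega)
      rw [Nat.add_mul_div_right _ _ (by positivity), Nat.div_eq_of_lt h1, zero_add,
        Nat.mod_eq_of_lt (hf i hi)]

theorem exists_digits {b : ℕ} {f : ℕ → ℕ} {m : ℕ} (hf : ∀ i < m, f i < b) :
    ∃ s < b ^ m, ∀ i < m, digit b i s = f i :=
  ⟨_, sum_digits_lt hf, fun _ hi => digit_sum hf hi⟩

/-- The colour of `x` under the colouring with the given parameters. -/
def colour (p₀ a₀ M p₁ H T L x : ℕ) : ℕ :=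
  (∑ i ∈ Finset.range (L + 1),
    digit 2 (2 ^ (i + 2) + hash (digit p₁ i H) p₁ (2 ^ (i + 2)) (hash a₀ p₀ M x)) T) % 2

/-- Every colouring of a small set is induced by a colouring with small parameters. -/
theorem exists_colour_eq {X N : ℕ} {S : Finset ℕ} (hX : ∀ x ∈ S, x < X) (hS : S.card ≤ N)
    (hX0 : 0 < X) (hN0 : 0 < N) {g : ℕ → ℕ} (hg : ∀ x, g x < 2) :
    ∃ p₀ a₀ p₁ H T L, 0 < p₀ ∧ p₀ ≤ 2 * X ∧ a₀ < p₀ ∧ 0 < p₁ ∧ p₁ ≤ 2 * (2 * N ^ 2 + 1) ∧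
      2 ^ L ≤ 2 * N ∧ H < p₁ ^ (L + 1) ∧ T < 2 ^ (2 ^ (L + 3)) ∧
      ∀ x ∈ S, colour p₀ a₀ (2 * N ^ 2 + 1) p₁ H T L x = g x := by
  classical
  -- The first hash function maps S injectively into a range of size 2N² + 1. The second stage then
  -- works modulo a prime p₁ bounded in terms of N alone, so only p₀ and a₀ depend on the size X of
  -- the universe.
  obtain ⟨p₀, hp₀, hX1, hX2⟩ := Nat.exists_prime_lt_and_le_two_mul X (by omega)
  obtain ⟨p₁, hp₁, hM1, hM2⟩ := Nat.exists_prime_lt_and_le_two_mul (2 * N ^ 2 + 1) (by omega)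
  have hSN : 2 * S.card ^ 2 < 2 * N ^ 2 + 1 := Nat.lt_succ_iff.2 (by gcongr)
  obtain ⟨a₀, ha₀, hinj⟩ := exists_injOn_hash hp₀ (fun x hx => (hX x hx).trans hX1) hSN
  set h₀ := hash a₀ p₀ (2 * N ^ 2 + 1) with hh₀
  obtain ⟨L, hL1, hL2⟩ : ∃ L, N ≤ 2 ^ L ∧ 2 ^ L ≤ 2 * N := by
    refine ⟨Nat.clog 2 N, Nat.le_pow_clog (by omega) N, ?_⟩
    rcases Nat.lt_or_ge 1 N with h | h
    · have h1 := Nat.pow_pred_clog_lt_self (b := 2) (by omega) h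
      have h2 : 0 < Nat.clog 2 N := Nat.clog_pos (by omega) h
      obtain ⟨c, hc⟩ : ∃ c, Nat.clog 2 N = c + 1 := ⟨Nat.clog 2 N - 1, by omega⟩
      rw [hc] at h1 ⊢
      simp only [Nat.pred_eq_sub_one, Nat.add_sub_cancel] at h1
      rw [pow_succ]
      omega
    · obtain rfl : N = 1 := by omega
      simp
  obtain ⟨a, T, ha, hT, h⟩ := exists_tableSum_eq hp₁ (S := S.image h₀)
    (g := fun z => if h : ∃ x ∈ S, h₀ x = z then g h.choose else 0)
    (fun z => by split_ifs; exacts [hg _, by omega]) L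
    (fun z hz => by
      obtain ⟨x, hx, rfl⟩ := Finset.mem_image.1 hz
      exact (hash_lt (by omega)).trans hM1)
    (Finset.card_image_le.trans (hS.trans hL1))
  obtain ⟨H, hH, hHd⟩ := exists_digits (b := p₁) (f := a) (m := L + 1) fun i _ => ha i
  obtain ⟨B, hB, hBd⟩ := exists_digits (b := 2) (f := T) (m := 2 ^ (L + 3)) fun i _ => hT i
  refine ⟨p₀, a₀, p₁, H, B, L, hp₀.pos, hX2, ha₀, hp₁.pos, hM2, hL2, hH, hB, fun x hx => ?_⟩
  have h1 := h (h₀ x) (Finset.mem_image_of_mem _ hx)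
  have hex : ∃ y ∈ S, h₀ y = h₀ x := ⟨x, hx, rfl⟩
  rw [dif_pos hex, hinj hex.choose_spec.1 hx hex.choose_spec.2] at h1
  rw [← h1, tableSum_congr (T' := fun m => digit 2 m B) (a' := fun i => digit p₁ i H)
    (h₀ x) (fun m hm => (hBd m hm).symm) (fun i hi => (hHd i (by omega)).symm)]
  rfl

/-! ### Paths in acyclic digraphs -/

section Lists

variable {V : Type*}

/-- `p` is a walk from `s` to `t` with respect to the relation `R`. -/
def IsRoute (R : V → V → Prop) (s t : V) (p : List V) : Prop :=
  p.head? = some s ∧ p.getLast? = some t ∧ p.IsChain R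

theorem arcList_singleton (a : V) : arcList [a] = [] := rfl

theorem arcList_cons_cons (a b : V) (l : List V) :
    arcList (a :: b :: l) = (a, b) :: arcList (b :: l) := rfl

theorem arcList_append (l₁ : List V) (v : V) (l₂ : List V) :
    arcList (l₁ ++ v :: l₂) = arcList (l₁ ++ [v]) ++ arcList (v :: l₂) := by
  induction l₁ with
  | nil => rfl
  | cons a l ih =>
    cases l with
    | nil => rfl
    | cons b l => simp only [List.cons_append, arcList_cons_cons] at ih ⊢; rw [ih]

theorem isRoute_iff_cons {R : V → V → Prop} {s t : V} {p : List V} :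
    IsRoute R s t p ↔ ∃ l, p = s :: l ∧ (s :: l).getLast? = some t ∧ (s :: l).IsChain R := by
  constructor
  · rintro ⟨h1, h2, h3⟩
    cases p with
    | nil => simp at h1
    | cons a l =>
      obtain rfl : a = s := by simpa using h1
      exact ⟨l, rfl, h2, h3⟩
  · rintro ⟨l, rfl, h2, h3⟩
    exact ⟨rfl, h2, h3⟩

theorem isRoute_singleton {R : V → V → Prop} (s : V) : IsRoute R s s [s] := by simp [IsRoute]

theorem isRoute_cons_cons {R : V → V → Prop} {s t a b : V} {l : List V} :
    IsRoute R s t (a :: b :: l) ↔ a = s ∧ R a b ∧ IsRoute R b t (b :: l) := by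
  simp only [IsRoute, List.head?_cons, Option.some.injEq, List.getLast?_cons_cons,
    List.isChain_cons_cons]
  tauto

theorem isRoute_singleton_iff {R : V → V → Prop} {s t a : V} :
    IsRoute R s t [a] ↔ a = s ∧ a = t := by
  simp [IsRoute]

theorem IsRoute.mono {R R' : V → V → Prop} (h : ∀ u v, R u v → R' u v) {s t : V} {p : List V}
    (hp : IsRoute R s t p) : IsRoute R' s t p :=
  ⟨hp.1, hp.2.1, hp.2.2.imp h⟩

theorem IsRoute.concat {R : V → V → Prop} {s u v : V} {p : List V} (hp : IsRoute R s u p)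
    (h : R u v) : IsRoute R s v (p ++ [v]) := by
  obtain ⟨h1, h2, h3⟩ := hp
  refine ⟨?_, by simp, ?_⟩
  · cases p with
    | nil => simp at h1
    | cons a l => simpa using h1
  · rw [List.isChain_append]
    refine ⟨h3, by simp, ?_⟩
    rintro x hx y hy
    rw [h2] at hx
    simp only [Option.mem_def, Option.some.injEq, List.head?_cons] at hx hy
    subst hx; subst hy
    exact h

theorem arcList_concat {p : List V} {u : V} (h : p.getLast? = some u) (v : V) :
    arcList (p ++ [v]) = arcList p ++ [(u, v)] := by
  obtain ⟨l, rfl⟩ := List.getLast?_eq_some_iff.1 h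
  rw [List.append_assoc]
  exact arcList_append l u [v]

theorem IsRoute.rel_of_mem {R : V → V → Prop} {s t : V} {p : List V} (hp : IsRoute R s t p)
    {f : V × V} (hf : f ∈ arcList p) : R f.1 f.2 := by
  induction p generalizing s with
  | nil => simp [arcList] at hf
  | cons a l ih =>
    cases l with
    | nil => simp [arcList_singleton] at hf
    | cons b l =>
      obtain ⟨_, h1, h2⟩ := isRoute_cons_cons.1 hp
      rw [arcList_cons_cons, List.mem_cons] at hf
      rcases hf with rfl | hf
      exacts [h1, ih h2 hf]

theorem IsRoute.of_forall_mem {R R' : V → V → Prop} {s t : V} {p : List V} (hp : IsRoute R s t p)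
    (h : ∀ f ∈ arcList p, R' f.1 f.2) : IsRoute R' s t p := by
  induction p generalizing s with
  | nil => exact ⟨hp.1, hp.2.1, by simp⟩
  | cons a l ih =>
    cases l with
    | nil => exact ⟨hp.1, hp.2.1, by simp⟩
    | cons b l =>
      obtain ⟨h0, h1, h2⟩ := isRoute_cons_cons.1 hp
      rw [arcList_cons_cons] at h
      exact isRoute_cons_cons.2 ⟨h0, h _ List.mem_cons_self,
        ih h2 fun f hf => h f (List.mem_cons_of_mem _ hf)⟩

variable {R : V → V → Prop} {lev : V → ℕ}

theorem IsRoute.lev_le (hlev : ∀ u v, R u v → lev u < lev v) {s t : V} {p : List V}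
    (hp : IsRoute R s t p) : lev s ≤ lev t := by
  induction p generalizing s with
  | nil => simp [IsRoute] at hp
  | cons a l ih =>
    cases l with
    | nil =>
      obtain ⟨rfl, rfl⟩ := isRoute_singleton_iff.1 hp
      exact le_rfl
    | cons b l =>
      obtain ⟨rfl, h1, h2⟩ := isRoute_cons_cons.1 hp
      exact (hlev _ _ h1).le.trans (ih h2)

theorem IsRoute.lev_mem (hlev : ∀ u v, R u v → lev u < lev v) {s t : V} {p : List V}
    (hp : IsRoute R s t p) {f : V × V} (hf : f ∈ arcList p) :
    lev s ≤ lev f.1 ∧ lev f.1 < lev f.2 ∧ lev f.2 ≤ lev t := by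
  induction p generalizing s with
  | nil => simp [arcList] at hf
  | cons a l ih =>
    cases l with
    | nil => simp [arcList_singleton] at hf
    | cons b l =>
      obtain ⟨rfl, h1, h2⟩ := isRoute_cons_cons.1 hp
      have h3 := hlev _ _ h1
      rw [arcList_cons_cons, List.mem_cons] at hf
      rcases hf with rfl | hf
      · exact ⟨le_rfl, h3, h2.lev_le hlev⟩
      · obtain ⟨h4, h5⟩ := ih h2 hf
        exact ⟨by omega, h5⟩

theorem IsRoute.nodup (hlev : ∀ u v, R u v → lev u < lev v) {s t : V} {p : List V}
    (hp : IsRoute R s t p) : p.Nodup := by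
  have h1 : (p.map lev).IsChain (· < ·) := by
    rw [List.isChain_map]
    exact hp.2.2.imp hlev
  have h2 := List.isChain_iff_pairwise.1 h1
  exact List.Nodup.of_map lev (h2.imp fun h => h.ne)

/-- A route passes each level exactly once. -/
theorem IsRoute.exists_arc {s t : V} {p : List V}
    (hp : IsRoute R s t p) {h : ℕ} (h1 : lev s < h) (h2 : h ≤ lev t) :
    ∃ f ∈ arcList p, lev f.1 < h ∧ h ≤ lev f.2 := by
  induction p generalizing s with
  | nil => simp [IsRoute] at hp
  | cons a l ih =>
    cases l with
    | nil =>
      obtain ⟨rfl, rfl⟩ := isRoute_singleton_iff.1 hp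
      omega
    | cons b l =>
      obtain ⟨rfl, h3, h4⟩ := isRoute_cons_cons.1 hp
      rw [arcList_cons_cons]
      by_cases hb : lev b < h
      · obtain ⟨f, hf, h5⟩ := ih h4 hb
        exact ⟨f, List.mem_cons_of_mem _ hf, h5⟩
      · exact ⟨(a, b), List.mem_cons_self, h1, by simpa using hb⟩

/-- Levels increase along a route, so the half-open level intervals of its arcs (from just above the
tail up to the head) are disjoint. -/
theorem IsRoute.arc_unique (hlev : ∀ u v, R u v → lev u < lev v) {s t : V} {p : List V}
    (hp : IsRoute R s t p) {h : ℕ} {f f' : V × V} (hf : f ∈ arcList p) (hf' : f' ∈ arcList p)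
    (h1 : lev f.1 < h ∧ h ≤ lev f.2) (h2 : lev f'.1 < h ∧ h ≤ lev f'.2) : f = f' := by
  induction p generalizing s with
  | nil => simp [arcList] at hf
  | cons a l ih =>
    cases l with
    | nil => simp [arcList_singleton] at hf
    | cons b l =>
      obtain ⟨rfl, h3, h4⟩ := isRoute_cons_cons.1 hp
      rw [arcList_cons_cons, List.mem_cons] at hf hf'
      rcases hf with rfl | hf <;> rcases hf' with rfl | hf'
      · rfl
      · have := (h4.lev_mem hlev hf').1
        simp only at h1
        omega
      · have := (h4.lev_mem hlev hf).1
        simp only at h2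
        omega
      · exact ih h4 hf hf'

/-- The total weight of the arcs of `p`. -/
def listWeight (w : V → V → ℕ) (p : List V) : ℕ := ((arcList p).map fun f => w f.1 f.2).sum

theorem listWeight_cons_cons (w : V → V → ℕ) (a b : V) (l : List V) :
    listWeight w (a :: b :: l) = w a b + listWeight w (b :: l) := by
  simp [listWeight, arcList_cons_cons]

theorem listWeight_singleton (w : V → V → ℕ) (a : V) : listWeight w [a] = 0 := rfl

theorem listWeight_concat (w : V → V → ℕ) {p : List V} {u : V} (h : p.getLast? = some u) (v : V) :
    listWeight w (p ++ [v]) = listWeight w p + w u v := by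
  simp [listWeight, arcList_concat h]

theorem nodup_arcList {p : List V} (hp : p.Nodup) : (arcList p).Nodup := by
  induction p with
  | nil => simp [arcList]
  | cons a l ih =>
    cases l with
    | nil => simp [arcList_singleton]
    | cons b l =>
      rw [arcList_cons_cons, List.nodup_cons]
      refine ⟨fun h => ?_, ih (List.nodup_cons.1 hp).2⟩
      exact (List.nodup_cons.1 hp).1 (List.of_mem_zip h).1

/-! ### Reachability with prescribed weights -/

/-- The componentwise truncated difference of the vector `x`, packed into a number in base `b`, and
the vector `w`. -/
def packedSub (b J : ℕ) (w : ℕ → ℕ) (x : ℕ) : ℕ :=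
  ∑ j ∈ Finset.range J, (digit b j x - w j) * b ^ j

theorem packedSub_lt {b J : ℕ} (hb : 0 < b) (w : ℕ → ℕ) (x : ℕ) : packedSub b J w x < b ^ J :=
  sum_digits_lt fun i _ => lt_of_le_of_lt (Nat.sub_le _ _) (digit_lt hb i x)

theorem digit_packedSub {b J : ℕ} (hb : 0 < b) (w : ℕ → ℕ) (x : ℕ) {j : ℕ} (hj : j < J) :
    digit b j (packedSub b J w x) = digit b j x - w j :=
  digit_sum (f := fun j => digit b j x - w j)
    (fun i _ => lt_of_le_of_lt (Nat.sub_le _ _) (digit_lt hb i x)) hj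

theorem sum_digit (b J x : ℕ) : ∑ j ∈ Finset.range J, digit b j x * b ^ j = x % b ^ J := by
  induction J with
  | zero => simp [Nat.mod_one]
  | succ J ih => rw [Finset.sum_range_succ, ih, Nat.mod_pow_succ, digit]; ring

theorem eq_zero_of_digit {b J x : ℕ} (hx : x < b ^ J) (h : ∀ j < J, digit b j x = 0) : x = 0 := by
  rw [← Nat.mod_eq_of_lt hx, ← sum_digit]
  apply Finset.sum_eq_zero
  intro j hj
  rw [h j (Finset.mem_range.1 hj), zero_mul]

/-- There is a route to `t` of at most `r` arcs whose weights are at least the digits of `x`,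
computed recursively. -/
def Reaches (R : V → V → Prop) (t : V) (b J : ℕ) (W : ℕ → V → V → ℕ) : ℕ → V → ℕ → Prop
  | 0, v, x => v = t ∧ x = 0
  | r + 1, v, x => (v = t ∧ x = 0) ∨
    ∃ v', R v v' ∧ Reaches R t b J W r v' (packedSub b J (fun j => W j v v') x)

/-- A demand is met by a route that starts with a given arc if and only if the demand minus the
weight of this arc, truncated at 0, is met by the rest of the route. Excess weight need not be
recorded, so b^J vectors per vertex suffice. A route with at most r arcs has at most r + 1 vertices.
-/
theorem reaches_iff {t : V} {b J : ℕ} {W : ℕ → V → V → ℕ} (hb : 0 < b) {r : ℕ} {v : V} {x : ℕ}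
    (hx : x < b ^ J) : Reaches R t b J W r v x ↔ ∃ p, IsRoute R v t p ∧ p.length ≤ r + 1 ∧
      ∀ j < J, digit b j x ≤ listWeight (W j) p := by
  have hz : ∀ v x, v = t ∧ x = 0 → ∀ r, ∃ p, IsRoute R v t p ∧ p.length ≤ r + 1 ∧
      ∀ j < J, digit b j x ≤ listWeight (W j) p := by
    rintro v x ⟨rfl, rfl⟩ r
    exact ⟨[v], isRoute_singleton v, by simp, fun j _ => by simp [digit]⟩
  have hs : ∀ v x a, x < b ^ J → IsRoute R v t [a] →
      (∀ j < J, digit b j x ≤ listWeight (W j) [a]) → v = t ∧ x = 0 := by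
    intro v x a hx ha h
    obtain ⟨rfl, rfl⟩ := isRoute_singleton_iff.1 ha
    exact ⟨rfl, eq_zero_of_digit hx fun j hj => by simpa [listWeight_singleton] using h j hj⟩
  induction r generalizing v x with
  | zero =>
    refine ⟨fun h => hz v x h 0, ?_⟩
    rintro ⟨p, hp, hl, h⟩
    match p with
    | [] => simp [IsRoute] at hp
    | [a] => exact hs v x a hx hp h
    | a :: b :: l => simp at hl
  | succ r ih =>
    constructor
    · rintro (h | ⟨v', h1, h2⟩)
      · exact hz v x h _
      · obtain ⟨p, hp, hl, h⟩ := (ih (packedSub_lt hb _ _)).1 h2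
        obtain ⟨l, rfl, h3⟩ := isRoute_iff_cons.1 hp
        refine ⟨v :: v' :: l, isRoute_cons_cons.2 ⟨rfl, h1, hp⟩, by simpa using hl,
          fun j hj => ?_⟩
        have := h j hj
        rw [digit_packedSub hb _ _ hj] at this
        rw [listWeight_cons_cons]
        omega
    · rintro ⟨p, hp, hl, h⟩
      match p with
      | [] => simp [IsRoute] at hp
      | [a] => exact .inl (hs v x a hx hp h)
      | a :: v' :: l =>
        obtain ⟨rfl, h1, h2⟩ := isRoute_cons_cons.1 hp
        refine .inr ⟨v', h1, (ih (packedSub_lt hb _ _)).2 ⟨v' :: l, h2, by simpa using hl,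
          fun j hj => ?_⟩⟩
        have := h j hj
        rw [listWeight_cons_cons] at this
        rw [digit_packedSub hb _ _ hj]
        omega

/-- A route in an acyclic digraph repeats no vertex, so the bound on its number of arcs is no
restriction. -/
theorem reaches_iff_of_acyclic [Fintype V] (hlev : ∀ u v, R u v → lev u < lev v) {t : V} {b J : ℕ}
    {W : ℕ → V → V → ℕ} (hb : 0 < b) {v : V} {x : ℕ} (hx : x < b ^ J) :
    Reaches R t b J W (Fintype.card V) v x ↔
      ∃ p, IsRoute R v t p ∧ ∀ j < J, digit b j x ≤ listWeight (W j) p := by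
  rw [reaches_iff hb hx]
  constructor
  · rintro ⟨p, h1, _, h2⟩
    exact ⟨p, h1, h2⟩
  · rintro ⟨p, h1, h2⟩
    exact ⟨p, h1, (h1.nodup hlev).length_le_card.trans (by omega), h2⟩

/-- The bound on the number of arcs does not drop from v to v', as it would by unfolding the
recursion. A path can therefore be traced in the final table alone. -/
theorem Reaches.exists_next [Fintype V] (hlev : ∀ u v, R u v → lev u < lev v) {t : V} {b J : ℕ}
    {W : ℕ → V → V → ℕ} (hb : 0 < b) {v : V} {x : ℕ} (hx : x < b ^ J)
    (h : Reaches R t b J W (Fintype.card V) v x) (hv : v ≠ t) : ∃ v', R v v' ∧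
      Reaches R t b J W (Fintype.card V) v' (packedSub b J (fun j => W j v v') x) := by
  obtain ⟨p, hp, hw⟩ := (reaches_iff_of_acyclic hlev hb hx).1 h
  match p with
  | [] => simp [IsRoute] at hp
  | [a] =>
    obtain ⟨rfl, rfl⟩ := isRoute_singleton_iff.1 hp
    exact absurd rfl hv
  | a :: v' :: l =>
    obtain ⟨rfl, h1, h2⟩ := isRoute_cons_cons.1 hp
    refine ⟨v', h1, (reaches_iff_of_acyclic hlev hb (packedSub_lt hb _ _)).2 ⟨_, h2, fun j hj => ?_⟩⟩
    have := hw j hj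
    rw [listWeight_cons_cons] at this
    rw [digit_packedSub hb _ _ hj]
    omega

/-- No arc leaves t on a route that ends in t, since the levels would have to return; only the route
without arcs remains, and it has weight 0. -/
theorem Reaches.digit_eq_zero [Fintype V] (hlev : ∀ u v, R u v → lev u < lev v) {t : V} {b J : ℕ}
    {W : ℕ → V → V → ℕ} (hb : 0 < b) {x : ℕ} (hx : x < b ^ J)
    (h : Reaches R t b J W (Fintype.card V) t x) : ∀ j < J, digit b j x = 0 := by
  obtain ⟨p, hp, hw⟩ := (reaches_iff_of_acyclic hlev hb hx).1 h
  match p with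
  | [] => simp [IsRoute] at hp
  | [a] =>
    intro j hj
    simpa [listWeight_singleton] using hw j hj
  | a :: v' :: l =>
    obtain ⟨rfl, h1, h2⟩ := isRoute_cons_cons.1 hp
    have := hlev _ _ h1
    have := h2.lev_le hlev
    omega

/-! ### Symmetric differences as additive weights -/

variable [DecidableEq V]

theorem mem_arcSet {p : List V} {f : V × V} : f ∈ arcSet p ↔ f ∈ arcList p := by
  simp [arcSet]

theorem listWeight_eq_sum (w : V → V → ℕ) {p : List V} (hp : p.Nodup) :
    listWeight w p = ∑ f ∈ arcSet p, w f.1 f.2 := by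
  rw [listWeight, arcSet, List.sum_toFinset _ (nodup_arcList hp)]

/-- The contribution of the arc `f` of a route to a weighted sum over the symmetric difference to
the route `A`: if `f` is not in `A`, then `f` and all the arcs of `A` that end in the levels of `f`
belong to the symmetric difference. -/
def diffWeight (lev : V → ℕ) (A : Finset (V × V)) (g : V × V → ℕ) (f : V × V) : ℕ :=
  if f ∈ A then 0 else
    g f + ∑ a ∈ A.filter (fun a => lev f.1 < lev a.2 ∧ lev a.2 ≤ lev f.2), g a

/-- The arcs of q outside p are partitioned by the arcs f of p outside q: an arc a is assigned to
the f whose level interval contains the head of a. This converts the symmetric difference to a fixed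
route into arc weights that simply add up along p, as the dynamic program requires. -/
theorem sum_diffWeight (hlev : ∀ u v, R u v → lev u < lev v) {s t : V} {p q : List V}
    (hp : IsRoute R s t p) (hq : IsRoute R s t q) (g : V × V → ℕ) :
    ∑ f ∈ arcSet p, diffWeight lev (arcSet q) g f =
      ∑ e ∈ symmDiff (arcSet p) (arcSet q), g e := by
  have h1 : ∑ f ∈ arcSet p, diffWeight lev (arcSet q) g f =
      ∑ f ∈ arcSet p \ arcSet q, (g f + ∑ a ∈ (arcSet q).filter
        (fun a => lev f.1 < lev a.2 ∧ lev a.2 ≤ lev f.2), g a) := by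
    rw [← Finset.filter_notMem_eq_sdiff, Finset.sum_filter]
    apply Finset.sum_congr rfl
    intro f _
    unfold diffWeight
    split_ifs <;> rfl
  have h2 : arcSet q \ arcSet p = (arcSet p \ arcSet q).biUnion fun f =>
      (arcSet q).filter (fun a => lev f.1 < lev a.2 ∧ lev a.2 ≤ lev f.2) := by
    ext a
    simp only [Finset.mem_sdiff, Finset.mem_biUnion, Finset.mem_filter, mem_arcSet]
    constructor
    -- The arc f by which p passes the level of the head of a is not an arc of q, for otherwise f =
    -- a by uniqueness in q, and a would be in p.
    · rintro ⟨haq, hap⟩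
      have hl := hq.lev_mem hlev haq
      obtain ⟨f, hf, hf'⟩ := hp.exists_arc (lev := lev) (h := lev a.2) (by omega) (by omega)
      refine ⟨f, ⟨hf, fun hfq => ?_⟩, haq, hf'⟩
      rw [hq.arc_unique hlev hfq haq hf' ⟨hl.2.1, le_rfl⟩] at hf
      exact hap hf
    · rintro ⟨f, ⟨hf, hfq⟩, haq, hfa⟩
      refine ⟨haq, fun hap => ?_⟩
      have hl := hq.lev_mem hlev haq
      rw [hp.arc_unique hlev hf hap hfa ⟨hl.2.1, le_rfl⟩] at hfq
      exact hfq haq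
  rw [h1, Finset.sum_add_distrib, ← Finset.sum_biUnion, ← h2]
  · rw [symmDiff_def, Finset.sup_eq_union, Finset.sum_union]
    exact disjoint_sdiff_sdiff
  · intro f hf f' hf' hne
    rw [Function.onFun, Finset.disjoint_left]
    intro a ha ha'
    simp only [Finset.coe_sdiff, Set.mem_sdiff, Finset.mem_coe, mem_arcSet, Finset.mem_filter]
      at hf hf' ha ha'
    exact hne (hp.arc_unique hlev hf.1 hf'.1 ha.2 ha'.2)

end Lists

/-! ### Distances between paths -/

section Distance

variable {V : Type*} [DecidableEq V]

/-- The Hamming distance of two sets. -/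
def setDist (A B : Finset (V × V)) : ℕ := (symmDiff A B).card

theorem setDist_comm (A B : Finset (V × V)) : setDist A B = setDist B A := by
  rw [setDist, symmDiff_comm, setDist]

theorem setDist_triangle (A B C : Finset (V × V)) : setDist A C ≤ setDist A B + setDist B C :=
  (Finset.card_le_card (symmDiff_triangle A B C)).trans (Finset.card_union_le _ _)

/-- Sufficient conditions for pairwise distances of at least `d`, in terms of centers `A b` such
that the centers are far apart and each of the sets `P i` is close to the center `A (c i)`, and of a
colouring `χ` that tells which of the sets `P i` may differ from their centers in which arcs. -/
theorem le_setDist_of_colouring {k m d τ : ℕ} {A : ℕ → Finset (V × V)} {P : ℕ → Finset (V × V)}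
    {c : ℕ → ℕ} {χ : V × V → ℕ → ℕ} {a : ℕ → ℕ → ℕ} (hd : d ≤ τ)
    (hA : ∀ b < m, ∀ b' < m, b ≠ b' → 3 * τ ≤ setDist (A b) (A b'))
    (hcov : ∀ i < k, ∃ b < m, setDist (P i) (A b) < τ)
    (hc : ∀ i < k, c i < m)
    (hfar : ∀ i < k, ∀ b < m, b ≠ c i → τ ≤ setDist (P i) (A b))
    (hχ : ∀ i < k, ∀ e ∈ symmDiff (P i) (A (c i)), χ e i ≠ 0)
    (ha : ∀ i < k, ∀ j < k,
      a i j ≤ ((symmDiff (P i) (A (c i))).filter fun e => χ e j = 0).card)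
    (had : ∀ i < k, ∀ j < k, i < j → c i = c j → d ≤ a i j + a j i)
    {i j : ℕ} (hi : i < k) (hj : j < k) (hij : i < j) : d ≤ setDist (P i) (P j) := by
  by_cases hcc : c i = c j
  · refine (had i hi j hj hij hcc).trans ((add_le_add (ha i hi j hj) (ha j hj i hi)).trans ?_)
    -- An arc counted in the first set differs from the common centre in P_i and has colour 0 for j,
    -- so it does not differ from it in P_j and lies in P_i ∆ P_j. The sets are disjoint because an
    -- arc of P_i ∆ A has a nonzero colour for i.
    rw [← Finset.card_union_of_disjoint]
    · apply Finset.card_le_card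
      intro e he
      have h1 := hχ i hi e
      have h2 := hχ j hj e
      rw [← hcc] at h2 he
      simp only [Finset.mem_union, Finset.mem_filter, Finset.mem_symmDiff] at he h1 h2 ⊢
      tauto
    · rw [Finset.disjoint_left]
      intro e he he'
      simp only [Finset.mem_filter] at he he'
      exact hχ i hi e he.1 he'.2
  -- The covering hypothesis gives a centre at distance less than τ, and `hfar` leaves only A (c i).
  -- For different centres the triangle inequality leaves more than 3τ - 2τ = τ ≥ d.
  · have near : ∀ i < k, setDist (P i) (A (c i)) < τ := by
      intro i hi
      obtain ⟨b, hb, h⟩ := hcov i hi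
      by_cases hbc : b = c i
      · rwa [hbc] at h
      · exact absurd (hfar i hi b hb hbc) (by omega)
    have h1 := near i hi
    have h2 := near j hj
    have h3 := hA _ (hc i hi) _ (hc j hj) hcc
    have h4 := setDist_triangle (A (c i)) (P i) (A (c j))
    have h5 := setDist_triangle (P i) (P j) (A (c j))
    rw [setDist_comm (A (c i)) (P i)] at h4
    omega

/-- Conversely, sets of pairwise distance at least `d` that are close to the centers satisfy these
conditions, for every colouring that is right on a small set of arcs. -/
theorem exists_small_of_le_setDist {k m d τ : ℕ} {A : ℕ → Finset (V × V)}
    {P : ℕ → Finset (V × V)}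
    (hA : ∀ b < m, ∀ b' < m, b ≠ b' → 3 * τ ≤ setDist (A b) (A b'))
    (hcov : ∀ i < k, ∃ b < m, setDist (P i) (A b) < τ)
    (hP : ∀ i < k, ∀ j < k, i < j → d ≤ setDist (P i) (P j)) :
    ∃ (c : ℕ → ℕ) (a : ℕ → ℕ → ℕ) (U : Finset (V × V)) (g : V × V → ℕ → ℕ),
      (∀ i < k, c i < m) ∧ (∀ i j, a i j ≤ d) ∧ U.card ≤ k * τ ∧ (∀ e i, g e i < 2) ∧
      (∀ i < k, ∀ j < k, i < j → c i = c j → d ≤ a i j + a j i) ∧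
      (∀ i < k, ∀ b < m, b ≠ c i → τ ≤ setDist (P i) (A b)) ∧
      ∀ χ : V × V → ℕ → ℕ, (∀ e ∈ U, ∀ i < k, χ e i = g e i) →
        (∀ i < k, ∀ e ∈ symmDiff (P i) (A (c i)), χ e i ≠ 0) ∧
        (∀ i < k, ∀ j < k,
          a i j ≤ ((symmDiff (P i) (A (c i))).filter fun e => χ e j = 0).card) := by
  choose! c hc hcP using hcov
  set D : ℕ → Finset (V × V) := fun i => symmDiff (P i) (A (c i)) with hD
  -- The number a(i,j) is |D_i \ D_j| capped at d, so that it fits into a bounded digit; g is the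
  -- indicator of e ∈ D_i, and U is the union of the D_i.
  refine ⟨c, fun i j => if c i = c j then min d (D i \ D j).card else 0,
    (Finset.range k).biUnion D, fun e i => if e ∈ D i then 1 else 0, hc, ?_, ?_, ?_, ?_, ?_, ?_⟩
  · intro i j
    beta_reduce
    split_ifs <;> simp
  · refine Finset.card_biUnion_le.trans ?_
    calc _ ≤ ∑ _i ∈ Finset.range k, τ :=
          Finset.sum_le_sum fun i hi => (hcP i (Finset.mem_range.1 hi)).le
      _ = _ := by simp
  · intro e i
    beta_reduce
    split_ifs <;> simp
  · intro i hi j hj hij hcc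
    have h1 := hP i hi j hj hij
    -- The common centre cancels in the symmetric difference of D_i and D_j.
    have h2 : symmDiff (P i) (P j) = (D i \ D j) ∪ (D j \ D i) := by
      rw [← Finset.sup_eq_union, ← symmDiff_def, hD]
      simp only [hcc]
      rw [symmDiff_symmDiff_symmDiff_comm, symmDiff_self]
      exact (symmDiff_bot _).symm
    rw [setDist, h2, Finset.card_union_of_disjoint disjoint_sdiff_sdiff] at h1
    beta_reduce
    rw [if_pos hcc, if_pos hcc.symm]
    omega
  · intro i hi b hb hbc
    have h1 := hA b hb _ (hc i hi) hbc
    have h2 := setDist_triangle (A b) (P i) (A (c i))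
    have h3 := hcP i hi
    rw [setDist_comm (A b) (P i)] at h2
    omega
  · intro χ hχ
    have hmem : ∀ i < k, ∀ e ∈ D i, e ∈ (Finset.range k).biUnion D := fun i hi e he =>
      Finset.mem_biUnion.2 ⟨i, Finset.mem_range.2 hi, he⟩
    refine ⟨fun i hi e he => ?_, fun i hi j hj => ?_⟩
    · rw [hχ e (hmem i hi e he) i hi]
      beta_reduce
      rw [if_pos he]
      simp
    · dsimp only
      split_ifs with hcc
      · refine (min_le_right _ _).trans (Finset.card_le_card ?_)
        intro e he
        rw [Finset.mem_sdiff] at he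
        rw [Finset.mem_filter]
        refine ⟨he.1, ?_⟩
        rw [hχ e (hmem i hi e he.1) j hj]
        exact if_neg he.2
      · simp

end Distance

/-! ### Shortest paths are the routes of tight arcs -/

section Shortest

variable {V : Type*}

theorem pathLength_singleton (G : WeightedDigraph V) (a : V) : pathLength G [a] = 0 := rfl

theorem pathLength_cons_cons (G : WeightedDigraph V) (a b : V) (l : List V) :
    pathLength G (a :: b :: l) = G.len a b + pathLength G (b :: l) := by
  simp [pathLength, arcList_cons_cons]

theorem pathLength_concat (G : WeightedDigraph V) {p : List V} {u : V} (h : p.getLast? = some u)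
    (v : V) : pathLength G (p ++ [v]) = pathLength G p + G.len u v := by
  simp [pathLength, arcList_concat h]

theorem pathLength_append (G : WeightedDigraph V) (l₁ : List V) (v : V) (l₂ : List V) :
    pathLength G (l₁ ++ v :: l₂) = pathLength G (l₁ ++ [v]) + pathLength G (v :: l₂) := by
  simp [pathLength, arcList_append l₁ v l₂]

theorem isPath_iff {G : WeightedDigraph V} {s t : V} {p : List V} :
    IsPath G s t p ↔ IsRoute G.Adj s t p ∧ p.Nodup := by
  simp [IsPath, IsRoute, and_assoc]

theorem IsRoute.pathLength_nonneg {G : WeightedDigraph V} {s t : V} {p : List V}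
    (hp : IsRoute G.Adj s t p) : 0 ≤ pathLength G p := by
  apply List.sum_nonneg
  intro x hx
  obtain ⟨f, hf, rfl⟩ := List.mem_map.1 hx
  exact (G.len_pos _ _ (hp.rel_of_mem hf)).le

theorem isRoute_append {R : V → V → Prop} {s t v : V} {l₁ l₂ : List V} :
    IsRoute R s t (l₁ ++ v :: l₂) ↔ IsRoute R s v (l₁ ++ [v]) ∧ IsRoute R v t (v :: l₂) := by
  induction l₁ generalizing s with
  | nil =>
    simp only [List.nil_append, isRoute_singleton_iff, and_true]
    constructor
    · intro h
      obtain rfl : v = s := by simpa using h.1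
      exact ⟨rfl, h⟩
    · rintro ⟨rfl, h⟩
      exact h
  | cons a l ih =>
    cases l with
    | nil =>
      simp only [List.cons_append, List.nil_append, isRoute_cons_cons, isRoute_singleton_iff]
      tauto
    | cons b l =>
      simp only [List.cons_append, isRoute_cons_cons] at ih ⊢
      rw [ih]
      tauto

/-- An arc extends a path to a path that is not longer than expected. -/
theorem exists_isPath_concat {G : WeightedDigraph V} {s u v : V} {p : List V} (hp : IsPath G s u p)
    (h : G.Adj u v) :
    ∃ q, IsPath G s v q ∧ q.length ≤ p.length + 1 ∧ pathLength G q ≤ pathLength G p + G.len u v := by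
  rw [isPath_iff] at hp
  by_cases hv : v ∈ p
  -- If v already lies on the path, the part up to v is taken; the omitted part and the new arc have
  -- nonnegative length.
  · obtain ⟨l₁, l₂, rfl⟩ := List.append_of_mem hv
    obtain ⟨h1, h2⟩ := isRoute_append.1 hp.1
    refine ⟨l₁ ++ [v], isPath_iff.2 ⟨h1, ?_⟩, by simp, ?_⟩
    · exact hp.2.sublist (List.Sublist.append_left (by simp) _)
    · rw [pathLength_append G l₁ v l₂]
      have := h2.pathLength_nonneg
      have := G.len_pos _ _ h
      linarith
  · refine ⟨p ++ [v], isPath_iff.2 ⟨hp.1.concat h, ?_⟩, by simp, ?_⟩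
    · rw [List.nodup_append]
      exact ⟨hp.2, by simp, fun a ha b hb => by
        rintro rfl
        simp only [List.mem_singleton] at hb
        exact hv (hb ▸ ha)⟩
    · rw [pathLength_concat G hp.1.2.1]

variable {G : WeightedDigraph V} {s t : V} {F : V → Prop} {D : V → ℝ}

/-- The arcs on shortest paths from the source, in terms of the set `F` of reachable vertices and of
the distances `D` from the source. -/
def Tight (G : WeightedDigraph V) (F : V → Prop) (D : V → ℝ) (u v : V) : Prop :=
  F u ∧ G.Adj u v ∧ D u + G.len u v = D v

/-- `F` is the set of the vertices reachable from `s`, and `D` are the distances from `s`. -/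
structure IsDist (G : WeightedDigraph V) (s : V) (F : V → Prop) (D : V → ℝ) : Prop where
  exists_path : ∀ v, F v → ∃ p, IsPath G s v p ∧ pathLength G p ≤ D v
  le_length : ∀ v p, IsPath G s v p → F v ∧ D v ≤ pathLength G p

theorem IsDist.source (h : IsDist G s F D) : F s ∧ D s = 0 := by
  obtain ⟨h1, h2⟩ := h.le_length s [s] (isPath_iff.2 ⟨isRoute_singleton s, by simp⟩)
  obtain ⟨p, hp, hpl⟩ := h.exists_path s h1
  have := (isPath_iff.1 hp).1.pathLength_nonneg
  rw [pathLength_singleton] at h2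
  exact ⟨h1, by linarith⟩

theorem IsDist.step (h : IsDist G s F D) {u v : V} (hu : F u) (huv : G.Adj u v) :
    F v ∧ D v ≤ D u + G.len u v := by
  obtain ⟨p, hp, hpl⟩ := h.exists_path u hu
  obtain ⟨q, hq, _, hql⟩ := exists_isPath_concat hp huv
  obtain ⟨h1, h2⟩ := h.le_length v q hq
  exact ⟨h1, by linarith⟩

/-- The number of the vertices that are closer to the source than `v`. -/
noncomputable def level (F : V → Prop) (D : V → ℝ) (v : V) : ℕ := {u | F u ∧ D u < D v}.ncard

/-- The positive length of the arc gives D u < D v, so every vertex counted for u is counted for v,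
and u itself is counted for v only. -/
theorem level_lt [Finite V] (u v : V) (h : Tight G F D u v) :
    level F D u < level F D v := by
  have hl := G.len_pos _ _ h.2.1
  have hD := h.2.2
  apply Set.ncard_lt_ncard _ (Set.toFinite _)
  refine ⟨fun x hx => ⟨hx.1, by linarith [hx.2]⟩, fun hsub => ?_⟩
  have : u ∈ {x | F x ∧ D x < D u} := hsub ⟨h.1, by linarith⟩
  exact lt_irrefl _ this.2

theorem pathLength_of_isRoute_tight {a b : V} {p : List V} (hp : IsRoute (Tight G F D) a b p) :
    pathLength G p = D b - D a := by
  induction p generalizing a with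
  | nil => simp [IsRoute] at hp
  | cons x l ih =>
    cases l with
    | nil =>
      obtain ⟨rfl, rfl⟩ := isRoute_singleton_iff.1 hp
      simp [pathLength_singleton]
    | cons y l =>
      obtain ⟨rfl, h1, h2⟩ := isRoute_cons_cons.1 hp
      rw [pathLength_cons_cons, ih h2, ← h1.2.2]
      ring

/-- The distances are a feasible potential: the inequalities of `IsDist.step` telescope along the
route. -/
theorem IsDist.le_pathLength (h : IsDist G s F D) {a b : V} {p : List V} (ha : F a)
    (hp : IsRoute G.Adj a b p) : D b - D a ≤ pathLength G p := by
  induction p generalizing a with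
  | nil => simp [IsRoute] at hp
  | cons x l ih =>
    cases l with
    | nil =>
      obtain ⟨rfl, rfl⟩ := isRoute_singleton_iff.1 hp
      simp [pathLength_singleton]
    | cons y l =>
      obtain ⟨rfl, h1, h2⟩ := isRoute_cons_cons.1 hp
      obtain ⟨h3, h4⟩ := h.step ha h1
      rw [pathLength_cons_cons]
      linarith [ih h3 h2]

/-- Every arc has nonnegative slack with respect to D. If the total slack is not positive, then
every arc is tight. -/
theorem IsDist.isRoute_tight (h : IsDist G s F D) {a b : V} {p : List V} (ha : F a)
    (hp : IsRoute G.Adj a b p) (hl : pathLength G p ≤ D b - D a) :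
    IsRoute (Tight G F D) a b p := by
  induction p generalizing a with
  | nil => simp [IsRoute] at hp
  | cons x l ih =>
    cases l with
    | nil =>
      obtain ⟨rfl, rfl⟩ := isRoute_singleton_iff.1 hp
      exact isRoute_singleton _
    | cons y l =>
      obtain ⟨rfl, h1, h2⟩ := isRoute_cons_cons.1 hp
      obtain ⟨h3, h4⟩ := h.step ha h1
      have h5 := h.le_pathLength h3 h2
      rw [pathLength_cons_cons] at hl
      exact isRoute_cons_cons.2 ⟨rfl, ⟨ha, h1, by linarith⟩, ih h3 h2 (by linarith)⟩

/-- A shortest path attains the potential difference, so all its arcs are tight. Conversely, the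
length of a route of tight arcs telescopes to D t, and such a route is automatically a path because
the levels increase. -/
theorem IsDist.isShortestPath_iff [Finite V] (h : IsDist G s F D) {p : List V} :
    IsShortestPath G s t p ↔ IsRoute (Tight G F D) s t p := by
  obtain ⟨hs, hs0⟩ := h.source
  constructor
  · rintro ⟨hp, hmin⟩
    obtain ⟨ht, _⟩ := h.le_length t p hp
    obtain ⟨q, hq, hql⟩ := h.exists_path t ht
    apply h.isRoute_tight hs (isPath_iff.1 hp).1
    linarith [hmin q hq]
  · intro hp
    refine ⟨isPath_iff.2 ⟨hp.mono fun u v huv => huv.2.1, hp.nodup (lev := level F D) level_lt⟩,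
      fun q hq => ?_⟩
    rw [pathLength_of_isRoute_tight hp, hs0, sub_zero]
    exact (h.le_length t q hq).2

end Shortest

/-! ### Reasoning about statements -/

instance : Add Expr := ⟨.add⟩
instance : Sub Expr := ⟨.sub⟩
instance : Mul Expr := ⟨.mul⟩
instance : Div Expr := ⟨.div⟩
instance (n : ℕ) : OfNat Expr n := ⟨.const n⟩

/-- The remainder of a division. -/
def Expr.mod (a b : Expr) : Expr := a - a / b * b

/-- The conditional expression with the condition `a = b`. -/
def Expr.ifEq (a b c d : Expr) : Expr := .ite a b d (.ite b a d c)

section Eval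

variable {V : ℕ} {a b c d : Expr} {e : Env}

@[simp] theorem eval_const (n : ℕ) : (Expr.const n).eval V e = n := rfl
@[simp] theorem eval_zero : (0 : Expr).eval V e = 0 := rfl
@[simp] theorem eval_one : (1 : Expr).eval V e = 1 := rfl
@[simp] theorem eval_two : (2 : Expr).eval V e = 2 := rfl
@[simp] theorem eval_three : (3 : Expr).eval V e = 3 := rfl
@[simp] theorem eval_var (i : ℕ) : (Expr.var i).eval V e = e.x i := rfl
@[simp] theorem eval_add : (a + b).eval V e = a.eval V e + b.eval V e := rfl
@[simp] theorem eval_sub : (a - b).eval V e = a.eval V e - b.eval V e := rfl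
@[simp] theorem eval_rd (i : Fin 16) : (Expr.rd i a).eval V e = e.arr i (a.eval V e) := rfl
@[simp] theorem eval_inp : (Expr.inp a).eval V e = e.inp (a.eval V e) := rfl
@[simp] theorem eval_ite : (Expr.ite a b c d).eval V e =
    if a.eval V e < b.eval V e then c.eval V e else d.eval V e := rfl
theorem eval_ite_pos (h : a.eval V e < b.eval V e) :
    (Expr.ite a b c d).eval V e = c.eval V e := if_pos h

theorem eval_ite_neg (h : ¬ a.eval V e < b.eval V e) :
    (Expr.ite a b c d).eval V e = d.eval V e := if_neg h

@[simp] theorem eval_letE (i : ℕ) :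
    (Expr.letE i a b).eval V e = b.eval V (e.set i (a.eval V e)) := rfl

@[simp] theorem eval_ifEq : (Expr.ifEq a b c d).eval V e =
    if a.eval V e = b.eval V e then c.eval V e else d.eval V e := by
  simp only [Expr.ifEq, eval_ite]
  split_ifs <;> first | rfl | omega

theorem eval_mul (h : a.eval V e ≤ V) : (a * b).eval V e = a.eval V e * b.eval V e := by
  change min _ _ * _ = _
  rw [min_eq_left h]

theorem eval_div (hb : 0 < b.eval V e) (h : a.eval V e / b.eval V e ≤ V) :
    (a / b).eval V e = a.eval V e / b.eval V e := by
  change (if _ then _ else _) = _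
  rw [if_neg (by omega), min_eq_left h]

theorem eval_mod (hb : 0 < b.eval V e) (h : a.eval V e / b.eval V e ≤ V) :
    (a.mod b).eval V e = a.eval V e % b.eval V e := by
  have h1 := eval_div hb h
  rw [Expr.mod, eval_sub, eval_mul (h1 ▸ h), h1]
  have := Nat.div_add_mod' (a.eval V e) (b.eval V e)
  omega

theorem eval_pow (ha : a.eval V e ≤ V) (hb : b.eval V e ≤ V) :
    (Expr.pow a b).eval V e = a.eval V e ^ b.eval V e := by
  change min _ _ ^ min _ _ = _
  rw [min_eq_left ha, min_eq_left hb]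

theorem eval_sum (i : ℕ) (h : a.eval V e ≤ V) : (Expr.sum i a b).eval V e =
    ∑ j ∈ Finset.range (a.eval V e), b.eval V (e.set i j) := by
  change ∑ j ∈ Finset.range (min _ _), _ = _
  rw [min_eq_left h]

@[simp] theorem set_x_self (i v : ℕ) : (e.set i v).x i = v := by simp [Env.set]
theorem set_x (i j v : ℕ) : (e.set i v).x j = if j = i then v else e.x j := by
  simp [Env.set, Function.update_apply]
@[simp] theorem set_arr (i v : ℕ) : (e.set i v).arr = e.arr := rfl
@[simp] theorem set_inp (i v : ℕ) : (e.set i v).inp = e.inp := rfl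

end Eval

/-- The expression does not read the array `a`. -/
def Expr.noRead (a : Fin 16) : Expr → Bool
  | .const _ => true
  | .var _ => true
  | .add p q => p.noRead a && q.noRead a
  | .sub p q => p.noRead a && q.noRead a
  | .mul p q => p.noRead a && q.noRead a
  | .div p q => p.noRead a && q.noRead a
  | .pow p q => p.noRead a && q.noRead a
  | .rd i p => i != a && p.noRead a
  | .inp p => p.noRead a
  | .ite p q r s => p.noRead a && q.noRead a && r.noRead a && s.noRead a
  | .sum _ p q => p.noRead a && q.noRead a
  | .letE _ p q => p.noRead a && q.noRead a

/-- Replacement of the array `a`. -/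
def Env.setArr (e : Env) (a : Fin 16) (f : ℕ → ℕ) : Env :=
  { e with arr := Function.update e.arr a f }

theorem eval_setArr {V : ℕ} {a : Fin 16} {p : Expr} (h : p.noRead a = true) (e : Env) (f : ℕ → ℕ) :
    p.eval V (e.setArr a f) = p.eval V e := by
  induction p generalizing e with
  | const => rfl
  | var => rfl
  | rd i p ih =>
    simp only [Expr.noRead, Bool.and_eq_true, bne_iff_ne, ne_eq] at h
    simp only [Expr.eval, ih h.2]
    simp [Env.setArr, Function.update_of_ne h.1]
  | inp p ih =>
    simp only [Expr.noRead] at h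
    simp only [Expr.eval, ih h]
    rfl
  | ite p q r s ihp ihq ihr ihs =>
    simp only [Expr.noRead, Bool.and_eq_true] at h
    simp only [Expr.eval, ihp h.1.1.1, ihq h.1.1.2, ihr h.1.2, ihs h.2]
  | sum i p q ihp ihq =>
    simp only [Expr.noRead, Bool.and_eq_true] at h
    simp only [Expr.eval, ihp h.1]
    exact Finset.sum_congr rfl fun j _ => ihq h.2 (e.set i j)
  | letE i p q ihp ihq =>
    simp only [Expr.noRead, Bool.and_eq_true] at h
    simp only [Expr.eval, ihp h.1]
    exact ihq h.2 (e.set i _)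
  | _ p q ihp ihq =>
    simp only [Expr.noRead, Bool.and_eq_true] at h
    simp only [Expr.eval, ihp h.1, ihq h.2]

/-- The statement leaves the variable `i` unchanged. -/
def Stmt.keepsVar (i : ℕ) : Stmt → Bool
  | .set j _ => j != i
  | .seq p q => p.keepsVar i && q.keepsVar i
  | .ite _ _ p q => p.keepsVar i && q.keepsVar i
  | .loop j _ p => j == i || p.keepsVar i
  | .rite _ _ p q => p.keepsVar i && q.keepsVar i
  | _ => true

/-- The statement leaves the array `a` unchanged. -/
def Stmt.keepsArr (a : Fin 16) : Stmt → Bool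
  | .store b _ _ => b != a
  | .seq p q => p.keepsArr a && q.keepsArr a
  | .ite _ _ p q => p.keepsArr a && q.keepsArr a
  | .loop _ _ p => p.keepsArr a
  | .rite _ _ p q => p.keepsArr a && q.keepsArr a
  | _ => true

theorem iterate_induction {f : Env → Env} {i : ℕ} {e : Env} (I : ℕ → Env → Prop) {N : ℕ}
    (h0 : I 0 e) (h : ∀ j < N, ∀ e, I j e → I (j + 1) (f (e.set i j))) : I N (iterate f i N e) := by
  induction N with
  | zero => exact h0
  | succ N ih => exact h N (by omega) _ (ih fun j hj => h j (by omega))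

/-- A frame rule whose hypothesis is a syntactic check that evaluates to `true`. A loop always keeps
its own variable, since the old value is restored. -/
theorem run_x {V i : ℕ} {p : Stmt} (h : p.keepsVar i = true) (e : Env) :
    (p.run V e).x i = e.x i := by
  induction p generalizing e with
  | set j a =>
    simp only [Stmt.keepsVar, bne_iff_ne, ne_eq] at h
    simp [Stmt.run, set_x, Ne.symm h]
  | seq p q ihp ihq =>
    simp only [Stmt.keepsVar, Bool.and_eq_true] at h
    simp only [Stmt.run, ihq h.2, ihp h.1]
  | ite a b p q ihp ihq =>
    simp only [Stmt.keepsVar, Bool.and_eq_true] at h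
    simp only [Stmt.run]
    split_ifs
    exacts [ihp h.1 e, ihq h.2 e]
  | loop j b p ih =>
    simp only [Stmt.keepsVar, Bool.or_eq_true, beq_iff_eq] at h
    simp only [Stmt.run, set_x]
    split_ifs with hij
    · rw [hij]
    · refine iterate_induction (fun _ e' => e'.x i = e.x i) rfl fun m _ e' he' => ?_
      rw [ih (h.resolve_left (Ne.symm hij)), set_x, if_neg hij, he']
  | rite r₁ r₂ p q ihp ihq =>
    simp only [Stmt.keepsVar, Bool.and_eq_true] at h
    simp only [Stmt.run]
    split_ifs
    exacts [ihp h.1 e, ihq h.2 e]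
  | _ => rfl

theorem run_arr {V : ℕ} {a : Fin 16} {p : Stmt} (h : p.keepsArr a = true) (e : Env) :
    (p.run V e).arr a = e.arr a := by
  induction p generalizing e with
  | store b _ _ =>
    simp only [Stmt.keepsArr, bne_iff_ne, ne_eq] at h
    simp [Stmt.run, Env.store, Function.update_of_ne (Ne.symm h)]
  | seq p q ihp ihq =>
    simp only [Stmt.keepsArr, Bool.and_eq_true] at h
    simp only [Stmt.run, ihq h.2, ihp h.1]
  | ite a b p q ihp ihq =>
    simp only [Stmt.keepsArr, Bool.and_eq_true] at h
    simp only [Stmt.run]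
    split_ifs
    exacts [ihp h.1 e, ihq h.2 e]
  | loop j b p ih =>
    simp only [Stmt.keepsArr] at h
    simp only [Stmt.run, set_arr]
    refine iterate_induction (fun _ e' => e'.arr a = e.arr a) rfl fun m _ e' he' => ?_
    rw [ih h, set_arr, he']
  | rite r₁ r₂ p q ihp ihq =>
    simp only [Stmt.keepsArr, Bool.and_eq_true] at h
    simp only [Stmt.run]
    split_ifs
    exacts [ihp h.1 e, ihq h.2 e]
  | _ => rfl

theorem run_inp {V : ℕ} (p : Stmt) (e : Env) : (p.run V e).inp = e.inp := by
  induction p generalizing e with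
  | seq p q ihp ihq => simp only [Stmt.run, ihq, ihp]
  | ite a b p q ihp ihq =>
    simp only [Stmt.run]
    split_ifs
    exacts [ihp e, ihq e]
  | loop j b p ih =>
    simp only [Stmt.run, set_inp]
    refine iterate_induction (fun _ e' => e'.inp = e.inp) rfl fun m _ e' he' => ?_
    rw [ih, set_inp, he']
  | rite r₁ r₂ p q ihp ihq =>
    simp only [Stmt.run]
    split_ifs
    exacts [ihp e, ihq e]
  | _ => rfl

/-- Assignment of the values of the expression `p` in the variable `i` to the first entries of the
array `a`. -/
def Stmt.fill (a : Fin 16) (i : ℕ) (b p : Expr) : Stmt := .loop i b (.store a (.var i) p)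

/-- Since p does not read the array being filled, the entries written earlier have no influence on
later ones, and all entries can be described in terms of the environment before the loop. -/
theorem run_fill {V : ℕ} {a : Fin 16} {i : ℕ} {b p : Expr} (hp : p.noRead a = true) {e : Env}
    (hb : b.eval V e ≤ V) : (Stmt.fill a i b p).run V e = e.setArr a
      (fun j => if j < b.eval V e then p.eval V (e.set i j) else e.arr a j) := by
  rw [Stmt.fill, Stmt.run, min_eq_left hb]
  have h := iterate_induction (f := (Stmt.store a (.var i) p).run V) (i := i) (e := e)
    (N := b.eval V e) (fun m e' => ∀ w, e'.set i w = (e.setArr a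
      (fun j => if j < m then p.eval V (e.set i j) else e.arr a j)).set i w)
    (fun w => by simp [Env.setArr]) (fun m _ e' he' w => by
      have h1 := he' m
      rw [h1]
      simp only [Stmt.run, eval_var, set_x_self]
      have h2 : ((e.setArr a fun j => if j < m then p.eval V (e.set i j) else e.arr a j).set i m) =
        (e.set i m).setArr a fun j => if j < m then p.eval V (e.set i j) else e.arr a j := rfl
      rw [h2, eval_setArr hp]
      simp only [Env.store, Env.setArr, Env.set, Function.update_idem, Function.update_self]
      congr 2
      funext j
      rw [Function.update_apply]
      by_cases hj : j = m
      · simp [hj]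
      · rw [if_neg hj]
        have : j < m ↔ j < m + 1 := by omega
        simp only [this])
  rw [h]
  simp [Env.set, Env.setArr]

theorem fill_arr {V : ℕ} {a : Fin 16} {i : ℕ} {b p : Expr} (hp : p.noRead a = true) {e : Env}
    (hb : b.eval V e ≤ V) {j : ℕ} (hj : j < b.eval V e) :
    ((Stmt.fill a i b p).run V e).arr a j = p.eval V (e.set i j) := by
  rw [run_fill hp hb]
  simp [Env.setArr, hj]

theorem fill_x {V : ℕ} {a : Fin 16} {i : ℕ} {b p : Expr} (e : Env) (j : ℕ) :
    ((Stmt.fill a i b p).run V e).x j = e.x j :=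
  run_x (by simp [Stmt.fill, Stmt.keepsVar]) e

theorem fill_arr_of_ne {V : ℕ} {a c : Fin 16} {i : ℕ} {b p : Expr} (h : a ≠ c) (e : Env) :
    ((Stmt.fill a i b p).run V e).arr c = e.arr c :=
  run_arr (by simpa [Stmt.fill, Stmt.keepsArr] using h) e

theorem run_for {V i : ℕ} {b : Expr} {p : Stmt} {e : Env} (hb : b.eval V e ≤ V) :
    (Stmt.loop i b p).run V e = (iterate (p.run V) i (b.eval V e) e).set i (e.x i) := by
  rw [Stmt.run, min_eq_left hb]

theorem pack_div {n v : ℕ} (a : ℕ) (hv : v < n) : (a * n + v) / n = a := by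
  rw [Nat.add_comm, Nat.add_mul_div_right _ _ (by omega), Nat.div_eq_of_lt hv, zero_add]

theorem pack_mod {n v : ℕ} (a : ℕ) (hv : v < n) : (a * n + v) % n = v := by
  rw [Nat.mul_comm, Nat.mul_add_mod, Nat.mod_eq_of_lt hv]

theorem pack_lt {a b n v : ℕ} (ha : a < b) (hv : v < n) : a * n + v < b * n := by
  calc a * n + v < (a + 1) * n := by rw [Nat.succ_mul]; omega
    _ ≤ b * n := Nat.mul_le_mul_right _ ha

theorem pack_inj {a b n u v : ℕ} (hu : u < n) (hv : v < n) (h : a * n + u = b * n + v) :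
    a = b ∧ u = v := by
  have h1 := congrArg (· / n) h
  have h2 := congrArg (· % n) h
  simp only [pack_div _ hu, pack_div _ hv, pack_mod _ hu, pack_mod _ hv] at h1 h2
  exact ⟨h1, h2⟩

open DissimilarPaths.Expr (var rd letE ifEq)

section Loops

variable {V i : ℕ} {b : Expr} {p : Stmt} {e : Env}

/-- Loop invariants. What the body keeps need not be repeated in the invariant. -/
theorem for_induction (I : ℕ → Env → Prop) (hb : b.eval V e ≤ V)
    (hI : ∀ j e' w, I j e' → I j (e'.set i w)) (h0 : I 0 e)
    (h : ∀ j < b.eval V e, ∀ e', e'.x i = j → (∀ v, v ≠ i → p.keepsVar v = true → e'.x v = e.x v) →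
      (∀ a, p.keepsArr a = true → e'.arr a = e.arr a) → e'.inp = e.inp → I j e' →
      I (j + 1) (p.run V e')) : I (b.eval V e) ((Stmt.loop i b p).run V e) := by
  rw [run_for hb]
  apply hI
  have := iterate_induction (f := p.run V) (i := i) (e := e) (N := b.eval V e)
    (fun j e' => I j e' ∧ (∀ v, v ≠ i → p.keepsVar v = true → e'.x v = e.x v) ∧
      (∀ a, p.keepsArr a = true → e'.arr a = e.arr a) ∧ e'.inp = e.inp)
    ⟨h0, fun _ _ _ => rfl, fun _ _ => rfl, rfl⟩ ?_
  · exact this.1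
  · rintro j hj e' ⟨h1, h2, h3, h4⟩
    have h2' : ∀ v, v ≠ i → p.keepsVar v = true → (e'.set i j).x v = e.x v := fun v hv hk => by
      rw [set_x, if_neg hv, h2 v hv hk]
    refine ⟨h j hj _ (set_x_self i j) h2' (fun a ha => h3 a ha) h4 (hI _ _ _ h1), fun v hv hk => ?_,
      fun a ha => ?_, ?_⟩
    · rw [run_x hk, h2' v hv hk]
    · rw [run_arr ha, set_arr, h3 a ha]
    · rw [run_inp, set_inp, h4]

end Loops

theorem run_ite_pos {V : ℕ} {a b : Expr} {p q : Stmt} {e : Env} (h : a.eval V e < b.eval V e) :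
    (Stmt.ite a b p q).run V e = p.run V e := if_pos h

theorem run_ite_neg {V : ℕ} {a b : Expr} {p q : Stmt} {e : Env} (h : ¬ a.eval V e < b.eval V e) :
    (Stmt.ite a b p q).run V e = q.run V e := if_neg h

/-- A digit of a number. -/
def digitE (b i s : Expr) : Expr := (s / Expr.pow b i).mod b

theorem eval_digitE {V : ℕ} {b i s : Expr} {e : Env} (hb0 : 0 < b.eval V e) (hb : b.eval V e ≤ V)
    (hi : i.eval V e ≤ V) (hs : s.eval V e ≤ V) :
    (digitE b i s).eval V e = digit (b.eval V e) (i.eval V e) (s.eval V e) := by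
  have h1 : (s / Expr.pow b i).eval V e = s.eval V e / b.eval V e ^ i.eval V e := by
    rw [eval_div, eval_pow hb hi]
    · rw [eval_pow hb hi]; positivity
    · exact (Nat.div_le_self _ _).trans hs
  rw [digitE, eval_mod hb0, h1, digit]
  rw [h1]
  exact (Nat.div_le_self _ _).trans ((Nat.div_le_self _ _).trans hs)

/-! ### Dynamic programming -/

/-- The sizes of the numbers that occur in the dynamic program. -/
structure DpSize (V n b J : ℕ) : Prop where
  b_pos : 0 < b
  b_le : b ≤ V
  J_le : J ≤ V
  Jn_le : J * n ≤ V
  n_le : n ≤ V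
  nB_le : n * b ^ J ≤ V

/-- The scalar variables of the dynamic program. -/
structure DpVars (n t b J : ℕ) (e : Env) : Prop where
  n_eq : e.x 0 = n
  t_eq : e.x 1 = t
  J_eq : e.x 10 = J
  b_eq : e.x 11 = b

/-- The packed vector in the variable `32`, minus the weights of the arc from the variable `31` to
the variable `41`. -/
def subE : Expr := .sum 40 (var 10)
  ((digitE (var 11) (var 40) (var 32) - rd 5 ((var 40 * var 0 + var 31) * var 0 + var 41)) *
    .pow (var 11) (var 40))

theorem eval_subE {V n t b J : ℕ} {e : Env} (hs : DpSize V n b J) (h : DpVars n t b J e)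
    (hx : e.x 32 ≤ V) (hv : e.x 31 < n) : subE.eval V e =
      packedSub b J (fun j => e.arr 5 ((j * n + e.x 31) * n + e.x 41)) (e.x 32) := by
  have hJV := hs.J_le
  rw [subE, eval_sum _ (by simpa [h.J_eq] using hJV), packedSub]
  simp only [eval_var, h.J_eq]
  apply Finset.sum_congr rfl
  intro j hj
  have hj := Finset.mem_range.1 hj
  have hd : (digitE (var 11) (var 40) (var 32)).eval V (e.set 40 j) = digit b j (e.x 32) := by
    rw [eval_digitE] <;> simp [set_x, h.b_eq, hs.b_pos, hs.b_le, hx]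
    omega
  have h1 : (var 40 * var 0 + var 31).eval V (e.set 40 j) = j * n + e.x 31 := by
    rw [eval_add, eval_mul] <;> simp [set_x, h.n_eq]
    omega
  have h2 : ((var 40 * var 0 + var 31) * var 0 + var 41).eval V (e.set 40 j) =
      (j * n + e.x 31) * n + e.x 41 := by
    rw [eval_add, eval_mul, h1]
    · simp [set_x, h.n_eq]
    · rw [h1]
      exact (pack_lt hj hv).le.trans hs.Jn_le
  rw [eval_mul, eval_sub, hd, eval_rd, h2, eval_pow]
  · simp [set_x, h.b_eq]
  · simpa [set_x, h.b_eq] using hs.b_le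
  · simp; omega
  · rw [eval_sub, hd]
    exact (Nat.sub_le _ _).trans ((digit_lt hs.b_pos _ _).le.trans hs.b_le)

/-- Whether the arc from the variable `31` to the variable `41` leads to a success for the packed
vector in the variable `32`. -/
def arcE : Expr := .ite 0 (rd 6 (var 31 * var 0 + var 41))
  (.ite 0 (rd 7 (var 41 * var 12 + subE)) 1 0) 0

theorem eval_arcE {V n t b J : ℕ} {e : Env} (hs : DpSize V n b J) (h : DpVars n t b J e)
    (hB : e.x 12 = b ^ J) (hx : e.x 32 ≤ V) (hv : e.x 31 < n) (hy : e.x 41 < n) : arcE.eval V e =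
      if 0 < e.arr 6 (e.x 31 * n + e.x 41) ∧ 0 < e.arr 7 (e.x 41 * b ^ J +
        packedSub b J (fun j => e.arr 5 ((j * n + e.x 31) * n + e.x 41)) (e.x 32)) then 1 else 0 := by
  have hn := hs.n_le
  have h1 : (var 31 * var 0 + var 41).eval V e = e.x 31 * n + e.x 41 := by
    rw [eval_add, eval_mul] <;> simp [h.n_eq]
    omega
  have h2 : (var 41 * var 12 + subE).eval V e = e.x 41 * b ^ J +
      packedSub b J (fun j => e.arr 5 ((j * n + e.x 31) * n + e.x 41)) (e.x 32) := by
    rw [eval_add, eval_mul, eval_subE hs h hx hv] <;> simp [hB]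
    omega
  rw [arcE, eval_ite, eval_rd, h1, eval_ite, eval_rd, h2]
  simp only [eval_zero, eval_one]
  grind

/-- The new entry of the table at the index in the variable `36`. -/
def dpE : Expr := ifEq (var 36) (var 1 * var 12) 1
  (letE 31 (var 36 / var 12) (letE 32 ((var 36).mod (var 12))
    (.ite 0 (.sum 41 (var 0) arcE) 1 0)))

/-- The adjacency relation stored in the array `6`. -/
def Env.rel (e : Env) (n : ℕ) (u v : Fin n) : Prop := 0 < e.arr 6 (u * n + v)

/-- The weights stored in the array `5`. -/
def Env.wt (e : Env) (n : ℕ) (j : ℕ) (u v : Fin n) : ℕ := e.arr 5 ((j * n + u) * n + v)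

open Classical in
-- One round of the dynamic program at one entry: from the table for at most r arcs, the value for
-- at most r + 1 arcs. The sum over the heads counts the arcs that succeed, so it is positive if and
-- only if one of them does.
theorem eval_dpE {V n b J : ℕ} {t v : Fin n} {r x : ℕ} {e : Env} (hs : DpSize V n b J)
    (h : DpVars n t b J e) (hB : e.x 12 = b ^ J) (hx : x < b ^ J)
    (htab : ∀ (v : Fin n) x, x < b ^ J → e.arr 7 (v * b ^ J + x) =
      if Reaches (e.rel n) t b J (e.wt n) r v x then 1 else 0) (h36 : e.x 36 = v * b ^ J + x) :
    dpE.eval V e = if Reaches (e.rel n) t b J (e.wt n) (r + 1) v x then 1 else 0 := by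
  have hn := hs.n_le
  have hB0 : 0 < b ^ J := pow_pos hs.b_pos _
  have hBV : v * b ^ J + x < n * b ^ J := pack_lt v.2 hx
  have hnV := hs.nB_le
  have hvlt := v.2
  have htlt := t.2
  have htB : (var 1 * var 12).eval V e = t * b ^ J := by
    rw [eval_mul] <;> simp [h.t_eq, hB]
    omega
  have hdiv : (var 36 / var 12).eval V e = v := by
    rw [eval_div] <;> simp only [eval_var, h36, hB, pack_div _ hx] <;> omega
  have hmod : ∀ w, ((var 36).mod (var 12)).eval V (e.set 31 w) = x := by
    intro w
    rw [eval_mod] <;> simp [set_x, h36, hB, pack_div _ hx, Nat.mod_eq_of_lt hx, hs.b_pos]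
    omega
  rw [dpE, eval_ifEq, htB, eval_letE, hdiv, eval_letE, hmod, eval_ite]
  set e' := (e.set 31 v).set 32 x with he'
  have hvars : DpVars n t b J e' := by
    constructor <;> simp [he', set_x, h.n_eq, h.t_eq, h.J_eq, h.b_eq]
  have hsum : (Expr.sum 41 (var 0) arcE).eval V e' = ∑ y ∈ Finset.range n,
      if 0 < e.arr 6 (v * n + y) ∧ 0 < e.arr 7 (y * b ^ J +
        packedSub b J (fun j => e.arr 5 ((j * n + v) * n + y)) x) then 1 else 0 := by
    rw [eval_sum _ (by simpa [hvars.n_eq] using hn)]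
    simp only [eval_var, hvars.n_eq]
    apply Finset.sum_congr rfl
    intro y hy
    have hy := Finset.mem_range.1 hy
    rw [eval_arcE (n := n) (t := t) (b := b) (J := J) hs]
    · simp [set_x, he']
    · constructor <;> simp [set_x, hvars.n_eq, hvars.t_eq, hvars.J_eq, hvars.b_eq]
    · simp [set_x, he', hB]
    · simp [set_x, he']
      nlinarith
    · simp [set_x, he']
    · simpa using hy
  rw [hsum]
  simp only [eval_zero, eval_one, eval_var, h36]
  have hpos : 0 < (∑ y ∈ Finset.range n,
      if 0 < e.arr 6 (v * n + y) ∧ 0 < e.arr 7 (y * b ^ J +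
        packedSub b J (fun j => e.arr 5 ((j * n + v) * n + y)) x) then 1 else 0) ↔
      ∃ v', e.rel n v v' ∧
        Reaches (e.rel n) t b J (e.wt n) r v' (packedSub b J (fun j => e.wt n j v v') x) := by
    rw [Finset.sum_pos_iff]
    constructor
    · rintro ⟨y, hy, hp⟩
      have hy := Finset.mem_range.1 hy
      split_ifs at hp with hc
      · refine ⟨⟨y, hy⟩, hc.1, ?_⟩
        have h1 := htab ⟨y, hy⟩ _ (packedSub_lt hs.b_pos (fun j => e.wt n j v ⟨y, hy⟩) x)
        by_contra hne
        rw [if_neg hne] at h1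
        exact hc.2.ne' h1
      · exact absurd hp (lt_irrefl _)
    · rintro ⟨y, h1, h2⟩
      refine ⟨y, Finset.mem_range.2 y.2, ?_⟩
      have h3 := htab y _ (packedSub_lt hs.b_pos (fun j => e.wt n j v y) x)
      rw [if_pos h2] at h3
      rw [if_pos ⟨h1, h3.symm ▸ one_pos⟩]
      exact one_pos
  -- The index of the pair (t, 0) is t b^J. Packing is injective because x < b^J, so one comparison
  -- of indices tests both conditions of the base case.
  have heq : v * b ^ J + x = t * b ^ J ↔ v = t ∧ x = 0 := by
    constructor
    · intro h
      obtain ⟨h1, h2⟩ := pack_inj hx hB0 (h.trans (add_zero _).symm)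
      exact ⟨Fin.ext h1, h2⟩
    · rintro ⟨rfl, rfl⟩
      rfl
  simp only [hpos, heq, Reaches]
  grind

/-- The dynamic program. The table is the array `7`. -/
def dpS : Stmt :=
  .seq (.set 12 (.pow (var 11) (var 10)))
  (.seq (.fill 7 36 (var 0 * var 12) (ifEq (var 36) (var 1 * var 12) 1 0))
  (.loop 38 (var 0) (.seq (.fill 8 36 (var 0 * var 12) dpE)
    (.fill 7 36 (var 0 * var 12) (rd 8 (var 36))))))

theorem DpVars.congr {n t b J : ℕ} {e e' : Env} (h : DpVars n t b J e) (h0 : e'.x 0 = e.x 0)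
    (h1 : e'.x 1 = e.x 1) (h10 : e'.x 10 = e.x 10) (h11 : e'.x 11 = e.x 11) : DpVars n t b J e' :=
  ⟨h0.trans h.n_eq, h1.trans h.t_eq, h10.trans h.J_eq, h11.trans h.b_eq⟩

open Classical in
-- After r rounds the array 7 describes the routes with at most r arcs. The new entries are first
-- collected in the array 8, so that a round reads only the entries of the previous one.
theorem run_dpS {V n b J : ℕ} {t : Fin n} {e : Env} (hs : DpSize V n b J) (h : DpVars n t b J e) :
    (dpS.run V e).x 12 = b ^ J ∧ ∀ (v : Fin n) x, x < b ^ J → (dpS.run V e).arr 7 (v * b ^ J + x) =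
      if Reaches (e.rel n) t b J (e.wt n) n v x then 1 else 0 := by
  have hn := hs.n_le
  have hnB := hs.nB_le
  have hpow : (Expr.pow (var 11) (var 10)).eval V e = b ^ J := by
    rw [eval_pow] <;> simp [h.b_eq, h.J_eq, hs.b_le, hs.J_le]
  rw [dpS, Stmt.run, Stmt.run, hpow, Stmt.run]
  set e₁ := e.set 12 (b ^ J) with he₁
  have hv₁ : DpVars n t b J e₁ := h.congr (by simp [he₁, set_x]) (by simp [he₁, set_x])
    (by simp [he₁, set_x]) (by simp [he₁, set_x])
  have hB₁ : e₁.x 12 = b ^ J := set_x_self _ _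
  have hlen : ∀ e' : Env, e'.x 0 = n → e'.x 12 = b ^ J →
      (var 0 * var 12).eval V e' = n * b ^ J := by
    intro e' h1 h2
    rw [eval_mul] <;> simp [h1, h2, hn]
  set e₂ := (Stmt.fill 7 36 (var 0 * var 12) (ifEq (var 36) (var 1 * var 12) 1 0)).run V e₁ with he₂
  have hv₂ : DpVars n t b J e₂ := hv₁.congr (fill_x _ _) (fill_x _ _) (fill_x _ _) (fill_x _ _)
  have hB₂ : e₂.x 12 = b ^ J := (fill_x _ _).trans hB₁
  have hrel : e.rel n = e₂.rel n := by
    unfold Env.rel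
    rw [he₂, fill_arr_of_ne (by decide), he₁, set_arr]
  have hwt : e.wt n = e₂.wt n := by
    unfold Env.wt
    rw [he₂, fill_arr_of_ne (by decide), he₁, set_arr]
  refine ⟨by rw [run_x rfl, hB₂], ?_⟩
  rw [hrel, hwt]
  have hnE : (var 0).eval V e₂ = n := hv₂.n_eq
  have main := for_induction (V := V) (i := 38) (b := var 0) (e := e₂)
    (p := .seq (.fill 8 36 (var 0 * var 12) dpE) (.fill 7 36 (var 0 * var 12) (rd 8 (var 36))))
    (fun r e' => ∀ (v : Fin n) x, x < b ^ J → e'.arr 7 (v * b ^ J + x) =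
      if Reaches (e₂.rel n) t b J (e₂.wt n) r v x then 1 else 0) (by rw [hnE]; exact hn)
    (fun _ _ _ h => h) ?_ ?_
  · rw [hnE] at main
    exact main
  · intro v x hx
    rw [he₂, fill_arr rfl (by rw [hlen _ hv₁.n_eq hB₁]; exact hnB)
      (by rw [hlen _ hv₁.n_eq hB₁]; exact pack_lt v.2 hx)]
    have htB : (var 1 * var 12).eval V (e₁.set 36 (v * b ^ J + x)) = t * b ^ J := by
      have := t.2
      rw [eval_mul] <;> simp [set_x, hv₁.t_eq, hB₁]
      omega
    rw [eval_ifEq, htB]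
    simp only [eval_var, set_x_self, eval_zero, eval_one]
    refine if_congr ?_ rfl rfl
    rw [Reaches]
    constructor
    · intro h
      obtain ⟨h1, h2⟩ := pack_inj hx (pow_pos hs.b_pos _) (h.trans (add_zero _).symm)
      exact ⟨Fin.ext h1, h2⟩
    · rintro ⟨rfl, rfl⟩
      rfl
  · intro r _ e' _ hkv hka _ hI v x hx
    have hv' : DpVars n t b J e' := hv₂.congr (hkv 0 (by decide) rfl) (hkv 1 (by decide) rfl)
      (hkv 10 (by decide) rfl) (hkv 11 (by decide) rfl)
    have hB' : e'.x 12 = b ^ J := (hkv 12 (by decide) rfl).trans hB₂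
    have hrel' : e₂.rel n = e'.rel n := by unfold Env.rel; rw [hka 6 rfl]
    have hwt' : e₂.wt n = e'.wt n := by unfold Env.wt; rw [hka 5 rfl]
    rw [hrel', hwt'] at hI ⊢
    have hj : v * b ^ J + x < n * b ^ J := pack_lt v.2 hx
    have hlen' := hlen e' hv'.n_eq hB'
    have hlen'' := hlen ((Stmt.fill 8 36 (var 0 * var 12) dpE).run V e')
      ((fill_x _ _).trans hv'.n_eq) ((fill_x _ _).trans hB')
    rw [Stmt.run, fill_arr rfl (by rw [hlen'']; exact hnB) (by rw [hlen'']; exact hj)]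
    simp only [eval_rd, eval_var, set_x_self, set_arr]
    rw [fill_arr rfl (by rw [hlen']; exact hnB) (by rw [hlen']; exact hj)]
    exact eval_dpE (e := e'.set 36 _) hs (hv'.congr (by simp [set_x]) (by simp [set_x])
      (by simp [set_x]) (by simp [set_x])) (by simp [set_x, hB']) hx hI (by simp)

/-! ### Extraction of a path from the table -/

/-- A search for a number below `n` with `0 < c`; the result is stored in the variable `28`. -/
def searchS (c : Expr) : Stmt := .loop 41 (var 0) (.ite 0 c (.set 28 (var 41)) .skip)

/-- Later successes overwrite earlier ones, so the last number with the property is found; any of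
them would do. -/
theorem run_searchS {V n : ℕ} {c : Expr} {e : Env} (hn : e.x 0 = n) (hnV : n ≤ V) {P : ℕ → Prop}
    (hP : ∀ e' : Env, (∀ i, i ≠ 28 → i ≠ 41 → e'.x i = e.x i) → e'.arr = e.arr → e'.x 41 < n →
      (0 < c.eval V e' ↔ P (e'.x 41))) (h : ∃ y < n, P y) :
    P (((searchS c).run V e).x 28) ∧ ((searchS c).run V e).x 28 < n := by
  have hb : (var 0).eval V e = n := hn
  have := for_induction (V := V) (i := 41) (b := var 0) (e := e)
    (p := .ite 0 c (.set 28 (var 41)) .skip)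
    (fun j e' => (∃ y < j, P y) → P (e'.x 28) ∧ e'.x 28 < n) (by rw [hb]; exact hnV)
    (fun j e' w h => by simpa [set_x] using h) (by simp) ?_
  · rw [hb] at this
    exact this h
  · rw [hb]
    rintro j hj e' h41 hkv hka _ hI ⟨y, hy, hPy⟩
    have hc := hP e' (fun i h1 h2 => hkv i h2 (by simp [Stmt.keepsVar, Ne.symm h1]))
      (funext fun a => hka a rfl) (by omega)
    by_cases h0 : 0 < c.eval V e'
    · rw [run_ite_pos (a := 0) h0, Stmt.run, set_x_self, eval_var, h41]
      rw [hc, h41] at h0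
      exact ⟨h0, hj⟩
    · rw [run_ite_neg (a := 0) h0, Stmt.run]
      apply hI
      rw [hc, h41] at h0
      refine ⟨y, lt_of_le_of_ne (by omega) ?_, hPy⟩
      rintro rfl
      exact h0 hPy

/-- A step of the extraction of a path. The current vertex is the variable `26`, and the required
weights are packed into the variable `27`. -/
def traceStepS : Stmt :=
  .ite (ifEq (var 26) (var 1) 1 0) 1
    (.seq (searchS (letE 31 (var 26) (letE 32 (var 27) arcE)))
    (.seq (.store 3 ((var 8 * var 0 + var 26) * var 0 + var 28) 1)
    (.seq (.set 27 (letE 31 (var 26) (letE 32 (var 27) (letE 41 (var 28) subE))))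
    (.set 26 (var 28))))) .skip

/-- The extraction of a path from the variable `3` to the variable `1` with the weights packed into
the variable `13`. The arcs of the path are marked in the layer of the array `3` with the number
in the variable `8`. -/
def traceS : Stmt :=
  .seq (.set 26 (var 3)) (.seq (.set 27 (var 13)) (.loop 38 (var 0) traceStepS))

open Classical in
/-- The invariant of the extraction: a route to the current vertex has been marked. -/
def TraceInv {n : ℕ} (R : Fin n → Fin n → Prop) (s t : Fin n) (b J : ℕ) (W : ℕ → Fin n → Fin n → ℕ)
    (m x : ℕ) (cen : ℕ → ℕ) (r : ℕ) (e : Env) : Prop :=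
  ∃ (q : List (Fin n)) (c : Fin n), e.x 26 = c ∧ e.x 27 < b ^ J ∧ IsRoute R s c q ∧
    (∀ j < J, digit b j x ≤ listWeight (W j) q + digit b j (e.x 27)) ∧
    Reaches R t b J W n c (e.x 27) ∧ (c = t ∨ q.length = r + 1) ∧
    ∀ i, e.arr 3 i = if ∃ f ∈ arcSet q, i = (m * n + f.1) * n + f.2 then 1 else cen i

open Classical in
-- `Reaches.exists_next` guarantees that the search succeeds, and any successor it finds is good,
-- since the table certifies the remaining demands from there. Each demand is covered by the weight
-- already collected together with the digit that is still required.
theorem run_traceStepS {V n b J m x r : ℕ} {s t : Fin n} {cen : ℕ → ℕ} {lev : Fin n → ℕ} {e : Env}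
    (hs : DpSize V n b J) (h : DpVars n t b J e) (hB : e.x 12 = b ^ J) (hm : e.x 8 = m)
    (hmV : m * n + n ≤ V) (hlev : ∀ u v, e.rel n u v → lev u < lev v)
    (htab : ∀ (v : Fin n) x, x < b ^ J → e.arr 7 (v * b ^ J + x) =
      if Reaches (e.rel n) t b J (e.wt n) n v x then 1 else 0)
    (hI : TraceInv (e.rel n) s t b J (e.wt n) m x cen r e) :
    TraceInv (e.rel n) s t b J (e.wt n) m x cen (r + 1) (traceStepS.run V e) := by
  obtain ⟨q, c, h26, h27, hq, hw, hR, hc, harr⟩ := hI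
  have hnV := hs.n_le
  have hnB := hs.nB_le
  have hcn := c.2
  have hBV : b ^ J ≤ V := by nlinarith
  rw [traceStepS, Stmt.run, eval_ifEq]
  simp only [eval_var, eval_zero, eval_one, h26, h.t_eq]
  by_cases hct : (c : ℕ) = t
  · rw [if_pos hct, if_neg (by omega), Stmt.run]
    exact ⟨q, c, h26, h27, hq, hw, hR, .inl (Fin.ext hct), harr⟩
  rw [if_neg hct, if_pos one_pos]
  have hcard := Fintype.card_fin n
  obtain ⟨v', hv1, hv2⟩ := Reaches.exists_next hlev hs.b_pos h27 (by rwa [hcard])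
    (fun h => hct (congrArg _ h))
  rw [hcard] at hv2
  set e₁ := (searchS (letE 31 (var 26) (letE 32 (var 27) arcE))).run V e with he₁
  have harr₁ : e₁.arr = e.arr := funext fun a => run_arr rfl e
  have hx₁ : ∀ i, i ≠ 28 → e₁.x i = e.x i := by
    intro i hi
    refine run_x ?_ e
    simp [searchS, Stmt.keepsVar, Ne.symm hi]
  have hsearch := run_searchS (V := V) (c := letE 31 (var 26) (letE 32 (var 27) arcE)) h.n_eq hnV
    (P := fun y => 0 < e.arr 6 (c * n + y) ∧ 0 < e.arr 7 (y * b ^ J +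
        packedSub b J (fun j => e.arr 5 ((j * n + c) * n + y)) (e.x 27))) ?_
    ⟨v', v'.2, hv1, by
      have := htab v' _ (packedSub_lt hs.b_pos (fun j => e.wt n j c v') (e.x 27))
      rw [if_pos hv2] at this
      exact this.symm ▸ one_pos⟩
  swap
  · intro e' hxe hae hlt
    rw [eval_letE, eval_letE, eval_arcE (n := n) (t := t) (b := b) (J := J) hs]
    · simp only [set_x, set_arr, hae, hxe, h26, ite_true, ite_false, Nat.reduceEqDiff, ne_eq,
        not_false_eq_true, eval_var]
      split_ifs with hif <;> simp [hif]
    · constructor <;> simp [set_x, hxe, h.n_eq, h.t_eq, h.J_eq, h.b_eq]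
    · simp [set_x, hxe, hB]
    · simp [set_x, hxe]
      omega
    · simp [set_x, hxe, h26]
    · simpa [set_x] using hlt
  rw [← he₁] at hsearch
  obtain ⟨⟨hg1, hg2⟩, hlt⟩ := hsearch
  set w : Fin n := ⟨e₁.x 28, hlt⟩ with hw'
  have h28 : e₁.x 28 = w := rfl
  rw [h28] at hg1 hg2
  have hwR : Reaches (e.rel n) t b J (e.wt n) n w
      (packedSub b J (fun j => e.wt n j c w) (e.x 27)) := by
    have := htab w _ (packedSub_lt hs.b_pos (fun j => e.wt n j c w) (e.x 27))
    by_contra hne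
    rw [if_neg hne] at this
    exact hg2.ne' this
  have hcw : e.rel n c w := hg1
  have hidx : ((var 8 * var 0 + var 26) * var 0 + var 28).eval V e₁ = (m * n + c) * n + w := by
    have h1 : (var 8 * var 0 + var 26).eval V e₁ = m * n + c := by
      rw [eval_add, eval_mul] <;> simp [hx₁, hm, h.n_eq, h26]
      rcases Nat.eq_zero_or_pos m with h0 | h0
      · omega
      · nlinarith
    rw [eval_add, eval_mul, h1]
    · simp [hx₁, h.n_eq, h28]
    · rw [h1]
      omega
  rw [Stmt.run, ← he₁, Stmt.run, Stmt.run, hidx, eval_one, Stmt.run, Stmt.run, Stmt.run]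
  have hsub : (letE 31 (var 26) (letE 32 (var 27) (letE 41 (var 28) subE))).eval V
      (e₁.store 3 ((m * n + c) * n + w) 1) =
      packedSub b J (fun j => e.wt n j c w) (e.x 27) := by
    rw [eval_letE, eval_letE, eval_letE, eval_subE (n := n) (t := t) (b := b) (J := J) hs]
    · simp [set_x, Env.store, hx₁, h26, harr₁, h28, Env.wt]
    · constructor <;> simp [set_x, Env.store, hx₁, h.n_eq, h.t_eq, h.J_eq, h.b_eq]
    · simp [set_x, Env.store, hx₁]
      omega
    · simp [set_x, Env.store, hx₁, h26]
  rw [hsub]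
  refine ⟨q ++ [w], w, ?_, ?_, hq.concat hcw, fun j hj => ?_, ?_, .inr ?_, fun i => ?_⟩
  · simp [set_x, Env.store, h28]
  · simpa [set_x] using packedSub_lt hs.b_pos _ _
  · rw [listWeight_concat _ hq.2.1]
    have := hw j hj
    simp only [set_x, if_true, if_false, show (27 : ℕ) ≠ 26 by decide, digit_packedSub hs.b_pos _ _ hj]
    omega
  · simpa [set_x] using hwR
  · rcases hc with hc | hc
    · exact absurd (congrArg _ hc) hct
    · simp [hc]
  · simp only [set_arr, Env.store, Function.update_self, Function.update_apply, harr₁, harr]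
    have hmem : ∀ f, f ∈ arcSet (q ++ [w]) ↔ f ∈ arcSet q ∨ f = (c, w) := by
      intro f
      rw [mem_arcSet, mem_arcSet, arcList_concat hq.2.1]
      simp
    simp only [hmem, or_and_right, exists_or, exists_eq_left]
    by_cases h1 : i = (m * n + c) * n + w <;> simp [h1]

theorem run_traceS {V n b J m x : ℕ} {s t : Fin n} {lev : Fin n → ℕ} {e : Env}
    (hs : DpSize V n b J) (h : DpVars n t b J e) (hB : e.x 12 = b ^ J) (hm : e.x 8 = m)
    (h3 : e.x 3 = s) (h13 : e.x 13 = x) (hx : x < b ^ J)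
    (hmV : m * n + n ≤ V) (hlev : ∀ u v, e.rel n u v → lev u < lev v)
    (htab : ∀ (v : Fin n) x, x < b ^ J → e.arr 7 (v * b ^ J + x) =
      open Classical in if Reaches (e.rel n) t b J (e.wt n) n v x then 1 else 0)
    (hsx : 0 < e.arr 7 (s * b ^ J + x)) :
    ∃ q, IsRoute (e.rel n) s t q ∧ (∀ j < J, digit b j x ≤ listWeight (e.wt n j) q) ∧
      ∀ i, (traceS.run V e).arr 3 i =
        open Classical in if ∃ f ∈ arcSet q, i = (m * n + f.1) * n + f.2 then 1 else e.arr 3 i := by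
  classical
  rw [traceS, Stmt.run, Stmt.run, Stmt.run, Stmt.run]
  simp only [eval_var, h3, set_x, if_false, show (13 : ℕ) ≠ 26 by decide, h13]
  set e₁ := (e.set 26 s).set 27 x with he₁
  have hb : (var 0).eval V e₁ = n := by simp [he₁, set_x, h.n_eq]
  have := for_induction (V := V) (i := 38) (b := var 0) (e := e₁) (p := traceStepS)
    (fun r e' => TraceInv (e.rel n) s t b J (e.wt n) m x (e.arr 3) r e') (by rw [hb]; exact hs.n_le)
    (fun j e' w h => by simpa [TraceInv, set_x] using h) ?_ ?_
  · rw [hb] at this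
    obtain ⟨q, c, h26, h27, hq, hw, hR, hc, harr⟩ := this
    -- After n steps without arriving at t there would be a route with n + 1 vertices, but routes
    -- repeat no vertex.
    have hct : c = t := by
      refine hc.resolve_right fun hl => ?_
      have h1 := (hq.nodup hlev).length_le_card
      rw [Fintype.card_fin] at h1
      omega
    subst hct
    refine ⟨q, hq, fun j hj => ?_, harr⟩
    have h1 := Reaches.digit_eq_zero hlev hs.b_pos h27 (by rwa [Fintype.card_fin]) j hj
    have h2 := hw j hj
    omega
  · refine ⟨[s], s, ?_, ?_, isRoute_singleton s, fun j _ => ?_, ?_, .inr rfl, fun i => ?_⟩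
    · simp [he₁, set_x]
    · simpa [he₁, set_x] using hx
    · simp [he₁]
    · have h1 := htab s x hx
      by_contra hne
      rw [if_neg (by simpa [he₁] using hne)] at h1
      exact hsx.ne' h1
    · simp [he₁, arcSet, arcList_singleton]
  · intro r _ e' _ hkv hka _ hI
    have hx' : ∀ i, i ≠ 38 → traceStepS.keepsVar i = true → i ≠ 26 → i ≠ 27 → e'.x i = e.x i := by
      intro i h1 h2 h3 h4
      rw [hkv i h1 h2]
      simp [he₁, set_x, h3, h4]
    have hrel : e.rel n = e'.rel n := by unfold Env.rel; rw [hka 6 rfl]; rfl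
    have hwt : e.wt n = e'.wt n := by unfold Env.wt; rw [hka 5 rfl]; rfl
    have h7 : e.arr 7 = e'.arr 7 := by rw [hka 7 rfl]; rfl
    rw [hrel, hwt] at hI htab ⊢
    rw [hrel] at hlev
    rw [h7] at htab
    exact run_traceStepS hs (h.congr (hx' 0 (by decide) rfl (by decide) (by decide))
      (hx' 1 (by decide) rfl (by decide) (by decide))
      (hx' 10 (by decide) rfl (by decide) (by decide))
      (hx' 11 (by decide) rfl (by decide) (by decide)))
      ((hx' 12 (by decide) rfl (by decide) (by decide)).trans hB)
      ((hx' 8 (by decide) rfl (by decide) (by decide)).trans hm) hmV hlev htab hI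

/-! ### Weights -/

theorem sum_range_mul_self {M : Type*} [AddCommMonoid M] (n : ℕ) (f : ℕ → ℕ → M) :
    ∑ a ∈ Finset.range (n * n), f (a / n) (a % n) = ∑ p : Fin n × Fin n, f p.1 p.2 := by
  rw [Finset.sum_range, ← finProdFinEquiv.sum_comp]
  apply Finset.sum_congr rfl
  rintro ⟨u, v⟩ _
  have h : (finProdFinEquiv (u, v) : ℕ) = u * n + v := by
    rw [finProdFinEquiv_apply_val]
    ring
  rw [h, pack_div _ v.2, pack_mod _ v.2]

/-- The size of a layer. -/
def sqE : Expr := var 0 * var 0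

theorem eval_sqE {V n : ℕ} {e : Env} (hn : e.x 0 = n) (hV : n ≤ V) : sqE.eval V e = n * n := by
  rw [sqE, eval_mul] <;> simp [hn, hV]

/-- The sizes of the numbers that occur in the computation of the weights. -/
structure WeightSize (V n m J : ℕ) : Prop where
  n_pos : 0 < n
  n_le : n ≤ V
  sq_le : n * n ≤ V
  m_le : m ≤ V
  J_le : J ≤ V
  Jsq_le : J * (n * n) ≤ V

/-- Assignment to the layers of an array; the layer is the variable `31`, and the arc is the
variable `32`. -/
def layersS (a : Fin 16) (c : Expr) : Stmt :=
  .fill a 36 (var 10 * sqE) (letE 31 (var 36 / sqE) (letE 32 ((var 36).mod sqE) c))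

theorem layersS_arr {V n m J j i : ℕ} {a : Fin 16} {c : Expr} {e : Env} (hs : WeightSize V n m J)
    (hn : e.x 0 = n) (hJ : e.x 10 = J) (hc : c.noRead a = true) (hj : j < J) (hi : i < n * n) :
    ((layersS a c).run V e).arr a (j * (n * n) + i) =
      c.eval V (((e.set 36 (j * (n * n) + i)).set 31 j).set 32 i) := by
  have hlt : j * (n * n) + i < J * (n * n) := pack_lt hj hi
  have hn0 := hs.sq_le
  have hJs := hs.Jsq_le
  have hnn : 0 < n * n := Nat.mul_pos hs.n_pos hs.n_pos
  have hlen : (var 10 * sqE).eval V e = J * (n * n) := by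
    rw [eval_mul, eval_sqE hn hs.n_le] <;> simp [hJ, hs.J_le]
  rw [layersS, fill_arr (by simpa [Expr.noRead, hc] using ⟨rfl, rfl⟩) (by rw [hlen]; exact hJs)
    (by rw [hlen]; exact hlt)]
  have hjV := hs.J_le
  have hd : (var 36 / sqE).eval V (e.set 36 (j * (n * n) + i)) = j := by
    have hsq := eval_sqE (V := V) (e := e.set 36 (j * (n * n) + i)) (n := n) (by simpa [set_x] using hn)
      hs.n_le
    rw [eval_div] <;> simp only [hsq, eval_var, set_x_self, pack_div _ hi] <;> omega
  rw [eval_letE, hd, eval_letE]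
  have hm : ((var 36).mod sqE).eval V ((e.set 36 (j * (n * n) + i)).set 31 j) = i := by
    have hsq := eval_sqE (V := V) (e := (e.set 36 (j * (n * n) + i)).set 31 j) (n := n)
      (by simpa [set_x] using hn) hs.n_le
    have h36 : (var 36).eval V ((e.set 36 (j * (n * n) + i)).set 31 j) = j * (n * n) + i := by
      simp [set_x]
    rw [eval_mod] <;> simp only [hsq, h36, pack_div _ hi, pack_mod _ hi] <;> omega
  rw [hm]

/-- The values of the arcs: the first `m` layers are constant, and the other layers are given by the
array `9`. -/
def valueE : Expr := .ite (var 31) (var 8) 1 (1 - rd 9 (var 32 * var 4 + (var 31 - var 8)))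

theorem run_valueE {V n m J k j i : ℕ} {e : Env} (hs : WeightSize V n m J) (hn : e.x 0 = n)
    (hJ : e.x 10 = J) (hm : e.x 8 = m) (hk : e.x 4 = k) (hj : j < J) (hi : i < n * n) :
    ((layersS 4 valueE).run V e).arr 4 (j * (n * n) + i) =
      if j < m then 1 else 1 - e.arr 9 (i * k + (j - m)) := by
  have hV := hs.sq_le
  rw [layersS_arr hs hn hJ rfl hj hi, valueE, eval_ite, eval_sub, eval_rd, eval_add, eval_mul]
  · simp [set_x, hm, hk]
  · simp
    omega

/-- The weight of the arc `32` in the layer `31`. -/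
def weightE : Expr := letE 33 (.ite (var 31) (var 8) (var 31) (var 29))
  (.ite 0 (rd 3 (var 33 * sqE + var 32)) 0 (rd 4 (var 36) +
    .sum 41 sqE (.ite 0 (rd 3 (var 33 * sqE + var 41))
      (.ite (rd 2 (var 32 / var 0)) (rd 2 ((var 41).mod (var 0)))
        (.ite (rd 2 ((var 32).mod (var 0))) (rd 2 ((var 41).mod (var 0))) 0
          (rd 4 (var 31 * sqE + var 41))) 0) 0)))

theorem pack_assoc (j n u v : ℕ) : (j * n + u) * n + v = j * (n * n) + (u * n + v) := by ring

/-- The arcs that are marked in a layer of the array `3`. -/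
def Env.marked (e : Env) (n c : ℕ) : Finset (Fin n × Fin n) :=
  Finset.univ.filter fun f => 0 < e.arr 3 ((c * n + f.1) * n + f.2)

theorem mem_marked {n c : ℕ} {e : Env} {f : Fin n × Fin n} :
    f ∈ e.marked n c ↔ 0 < e.arr 3 ((c * n + f.1) * n + f.2) := by
  simp [Env.marked]

/-- A layer j < m refers to the centre j, and all the other layers refer to the centre in the
variable 29. The sum in the expression runs over all pairs of vertices, of which only marked arcs
with their heads in the right levels contribute. -/
theorem run_weightE {V n m J c j : ℕ} {u v : Fin n} {e : Env} (hs : WeightSize V n m J)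
    (hn : e.x 0 = n) (hJ : e.x 10 = J) (hm : e.x 8 = m) (hc : e.x 29 = c)
    (hcV' : (if j < m then j else c) ≤ V) (hj : j < J) : ((layersS 5 weightE).run V e).wt n j u v =
      diffWeight (fun u : Fin n => e.arr 2 u) (e.marked n (if j < m then j else c))
        (fun f => e.arr 4 ((j * n + f.1) * n + f.2)) (u, v) := by
  have hV := hs.sq_le
  have hnV := hs.n_le
  have hi : (u * n + v : ℕ) < n * n := pack_lt u.2 v.2
  rw [Env.wt, pack_assoc, layersS_arr hs hn hJ rfl hj hi, weightE, eval_letE]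
  set e₁ := ((e.set 36 (j * (n * n) + (u * n + v))).set 31 j).set 32 (u * n + v) with he₁
  have h33 : (Expr.ite (var 31) (var 8) (var 31) (var 29)).eval V e₁ = if j < m then j else c := by
    simp [he₁, set_x, hm, hc]
  rw [h33]
  set c' := if j < m then j else c with hc'
  have hjV := hs.J_le
  set e₂ := e₁.set 33 c' with he₂
  have hsq : sqE.eval V e₂ = n * n := eval_sqE (by simp [he₂, he₁, set_x, hn]) hnV
  have hidx : ∀ i, (var 33 * sqE + var 41).eval V (e₂.set 41 i) = c' * (n * n) + i := by
    intro i
    rw [eval_add, eval_mul, eval_sqE (n := n) (by simp [he₂, he₁, set_x, hn]) hnV] <;>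
      simp [he₂, set_x, hcV']
  have hidx' : ∀ i, (var 31 * sqE + var 41).eval V (e₂.set 41 i) = j * (n * n) + i := by
    intro i
    rw [eval_add, eval_mul, eval_sqE (n := n) (by simp [he₂, he₁, set_x, hn]) hnV] <;>
      simp [he₂, he₁, set_x]
    omega
  have hidx₀ : (var 33 * sqE + var 32).eval V e₂ = c' * (n * n) + (u * n + v) := by
    rw [eval_add, eval_mul, hsq] <;> simp [he₂, he₁, set_x, hcV']
  have hdiv : ∀ i, (var 32 / var 0).eval V (e₂.set 41 i) = u := by
    intro i
    rw [eval_div] <;> simp [he₂, he₁, set_x, hn, pack_div _ v.2, hs.n_pos]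
    omega
  have hmod : ∀ i, ((var 32).mod (var 0)).eval V (e₂.set 41 i) = v := by
    intro i
    rw [eval_mod] <;> simp [he₂, he₁, set_x, hn, pack_div _ v.2, hs.n_pos, Nat.mod_eq_of_lt v.2]
    omega
  have hmod' : ∀ i, i < n * n → ((var 41).mod (var 0)).eval V (e₂.set 41 i) = i % n := by
    intro i hi
    have := Nat.div_le_self i n
    rw [eval_mod] <;> simp [he₂, he₁, set_x, hn, hs.n_pos]
    omega
  have h36 : (rd 4 (var 36)).eval V e₂ = e.arr 4 (j * (n * n) + (u * n + v)) := by
    simp [he₂, he₁, set_x]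
  have harr : e₂.arr = e.arr := rfl
  have hsum : (Expr.sum 41 sqE (.ite 0 (rd 3 (var 33 * sqE + var 41))
      (.ite (rd 2 (var 32 / var 0)) (rd 2 ((var 41).mod (var 0)))
        (.ite (rd 2 ((var 32).mod (var 0))) (rd 2 ((var 41).mod (var 0))) 0
          (rd 4 (var 31 * sqE + var 41))) 0) 0)).eval V e₂ =
      ∑ i ∈ Finset.range (n * n), if 0 < e.arr 3 ((c' * n + i / n) * n + i % n) ∧
        e.arr 2 u < e.arr 2 (i % n) ∧ e.arr 2 (i % n) ≤ e.arr 2 v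
        then e.arr 4 ((j * n + i / n) * n + i % n) else 0 := by
    rw [eval_sum _ (by rw [hsq]; exact hV), hsq]
    apply Finset.sum_congr rfl
    intro i hi
    have hi := Finset.mem_range.1 hi
    simp only [eval_ite, eval_rd, hidx, hidx', hdiv, hmod, hmod' i hi, eval_zero, set_arr, harr]
    have h1 : i / n * n + i % n = i := Nat.div_add_mod' i n
    rw [pack_assoc, pack_assoc, h1]
    grind
  rw [eval_ite, eval_add, hsum, h36, eval_rd, hidx₀, diffWeight, Finset.sum_filter]
  rw [sum_range_mul_self n (fun x y => if 0 < e.arr 3 ((c' * n + x) * n + y) ∧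
        e.arr 2 u < e.arr 2 y ∧ e.arr 2 y ≤ e.arr 2 v then e.arr 4 ((j * n + x) * n + y) else 0)]
  have hmem : (u, v) ∈ e.marked n c' ↔ 0 < e.arr 3 (c' * (n * n) + (u * n + v)) := by
    simp [Env.marked, pack_assoc]
  simp only [eval_zero, hmem, harr, ← pack_assoc]
  congr 2
  rw [Env.marked, Finset.sum_filter]
  apply Finset.sum_congr rfl
  intro f _
  split_ifs <;> first | rfl | tauto

/-! ### Queries for paths with prescribed weights -/

/-- The sizes of the numbers that occur in the algorithm, except for the colourings. -/
structure Sizes (V n k d : ℕ) : Prop where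
  n_pos : 0 < n
  k_pos : 0 < k
  d_pos : 0 < d
  sq_le : 2 * k * (n * n) ≤ V
  pow_le : n * (3 ^ k * d + 1) ^ (2 * k) ≤ V

theorem Sizes.weightSize {V n k d m J : ℕ} (h : Sizes V n k d) (hm : m ≤ 2 * k) (hJ : J ≤ 2 * k) :
    WeightSize V n m J := by
  have h1 := h.n_pos
  have h2 := h.k_pos
  have h3 := h.sq_le
  have h4 : n ≤ n * n := Nat.le_mul_self n
  have h5 : 2 * k ≤ 2 * k * (n * n) := Nat.le_mul_of_pos_right _ (by positivity)
  have h6 : n * n ≤ 2 * k * (n * n) := Nat.le_mul_of_pos_left _ (by omega)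
  have h7 : J * (n * n) ≤ 2 * k * (n * n) := Nat.mul_le_mul_right _ hJ
  exact ⟨h1, by omega, by omega, by omega, by omega, by omega⟩

theorem Sizes.dpSize {V n k d b J : ℕ} (h : Sizes V n k d) (hb0 : 0 < b) (hb : b ≤ 3 ^ k * d + 1)
    (hJ : J ≤ 2 * k) : DpSize V n b J := by
  have h0 := h.weightSize hJ hJ
  have h1 := h.n_pos
  have h2 := h.k_pos
  have h3 := h.pow_le
  have h4 : n ≤ n * n := Nat.le_mul_self n
  have h5 : J * n ≤ J * (n * n) := Nat.mul_le_mul_left _ h4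
  have h6 : n * b ^ J ≤ n * (3 ^ k * d + 1) ^ (2 * k) :=
    Nat.mul_le_mul_left _ ((Nat.pow_le_pow_left hb J).trans (Nat.pow_le_pow_right (by omega) hJ))
  have h7 : 3 ^ k * d + 1 ≤ n * (3 ^ k * d + 1) ^ (2 * k) :=
    (Nat.le_self_pow (by omega) _).trans (Nat.le_mul_of_pos_left _ h1)
  exact ⟨hb0, by omega, h0.J_le, h5.trans h0.Jsq_le, h0.n_le, h6.trans h3⟩

/-- The array `1` holds the relation `R`, and the array `2` the levels. -/
structure Net {n : ℕ} (R : Fin n → Fin n → Prop) (lev : Fin n → ℕ) (e : Env) : Prop where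
  rel : ∀ u v : Fin n, 0 < e.arr 1 (u * n + v) ↔ R u v
  lev_eq : ∀ u : Fin n, e.arr 2 u = lev u
  lt : ∀ u v, R u v → lev u < lev v

theorem Net.congr {n : ℕ} {R : Fin n → Fin n → Prop} {lev : Fin n → ℕ} {e e' : Env}
    (h : Net R lev e) (h1 : e'.arr 1 = e.arr 1) (h2 : e'.arr 2 = e.arr 2) : Net R lev e' :=
  ⟨by rw [h1]; exact h.rel, by rw [h2]; exact h.lev_eq, h.lt⟩

/-- The first `m` layers of the array `3` hold the arc sets `A` of routes. -/
structure Centers {n : ℕ} (R : Fin n → Fin n → Prop) (s t : Fin n) (m : ℕ)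
    (A : ℕ → Finset (Fin n × Fin n)) (e : Env) : Prop where
  route : ∀ c < m, ∃ q, IsRoute R s t q ∧ A c = arcSet q
  marked : ∀ c < m, e.marked n c = A c

theorem Centers.congr {n : ℕ} {R : Fin n → Fin n → Prop} {s t : Fin n} {m : ℕ}
    {A : ℕ → Finset (Fin n × Fin n)} {e e' : Env} (h : Centers R s t m A e)
    (h3 : e'.arr 3 = e.arr 3) : Centers R s t m A e' :=
  ⟨h.route, fun c hc => by rw [← h.marked c hc, Env.marked, Env.marked, h3]⟩

/-- The scalar variables of the algorithm. -/
structure Vars (n s t k d : ℕ) (e : Env) : Prop where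
  n_eq : e.x 0 = n
  t_eq : e.x 1 = t
  d_eq : e.x 2 = d
  s_eq : e.x 3 = s
  k_eq : e.x 4 = k

theorem Vars.congr {n s t k d : ℕ} {e e' : Env} (h : Vars n s t k d e) (h0 : e'.x 0 = e.x 0)
    (h1 : e'.x 1 = e.x 1) (h2 : e'.x 2 = e.x 2) (h3 : e'.x 3 = e.x 3) (h4 : e'.x 4 = e.x 4) :
    Vars n s t k d e' :=
  ⟨h0.trans h.n_eq, h1.trans h.t_eq, h2.trans h.d_eq, h3.trans h.s_eq, h4.trans h.k_eq⟩

/-- The preparation of the dynamic program, where the arcs are those with `0 < c`. -/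
def prepareS (c : Expr) : Stmt :=
  .seq (layersS 4 valueE) (.seq (layersS 5 weightE) (.fill 6 36 sqE c))

theorem prepareS_x {V : ℕ} (c : Expr) (e : Env) (i : ℕ) : ((prepareS c).run V e).x i = e.x i := by
  apply run_x
  simp [prepareS, layersS, Stmt.fill, Stmt.keepsVar]

theorem prepareS_arr {V : ℕ} (c : Expr) (e : Env) {a : Fin 16} (h4 : 4 ≠ a) (h5 : 5 ≠ a)
    (h6 : 6 ≠ a) : ((prepareS c).run V e).arr a = e.arr a := by
  apply run_arr
  simp [prepareS, layersS, Stmt.fill, Stmt.keepsArr, h4, h5, h6]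

section Query

variable {V n m J k c : ℕ} {s t : Fin n} {R : Fin n → Fin n → Prop} {lev : Fin n → ℕ}
  {A : ℕ → Finset (Fin n × Fin n)} {e : Env} {al : Expr}

/-- The values of the arcs in the layers. -/
def arcValue (e : Env) (n m k j : ℕ) (f : Fin n × Fin n) : ℕ :=
  if j < m then 1 else 1 - e.arr 9 ((f.1 * n + f.2) * k + (j - m))

/-- By `sum_diffWeight` the computed weights of the arcs of a route add up to the total value of its
symmetric difference to the centre. With all values 1 this is the distance to the centre; with the
complement of the colour bits of j it counts the arcs of colour 0 for j. -/
theorem listWeight_prepareS (hs : WeightSize V n m J) (hn : e.x 0 = n) (hJ : e.x 10 = J)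
    (hm : e.x 8 = m) (hk : e.x 4 = k) (hc : e.x 29 = c) (hnet : Net R lev e)
    (hcen : Centers R s t m A e) {j : ℕ} (hj : j < J) (hjm : (if j < m then j else c) < m)
    {p : List (Fin n)} (hp : IsRoute R s t p) :
    listWeight (((prepareS al).run V e).wt n j) p =
      ∑ f ∈ symmDiff (arcSet p) (A (if j < m then j else c)), arcValue e n m k j f := by
  obtain ⟨q, hq, hqA⟩ := hcen.route _ hjm
  rw [listWeight_eq_sum _ (hp.nodup hnet.lt), hqA, ← sum_diffWeight hnet.lt hp hq, ← hqA]
  apply Finset.sum_congr rfl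
  rintro ⟨u, v⟩ _
  set e₁ := (layersS 4 valueE).run V e with he₁
  have h1 : ((prepareS al).run V e).wt n j u v = ((layersS 5 weightE).run V e₁).wt n j u v := by
    rw [prepareS, Stmt.run, Stmt.run, Env.wt, fill_arr_of_ne (by decide)]
    rfl
  have hx : ∀ i, e₁.x i = e.x i := fun i => fill_x _ _
  have harr : ∀ a, 4 ≠ a → e₁.arr a = e.arr a := fun a ha => fill_arr_of_ne ha e
  rw [h1, run_weightE hs ((hx 0).trans hn) ((hx 10).trans hJ) ((hx 8).trans hm)
    ((hx 29).trans hc) (hjm.le.trans hs.m_le) hj]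
  have h2 : (fun u : Fin n => e₁.arr 2 u) = lev := by
    funext u
    rw [harr 2 (by decide), hnet.lev_eq]
  have h3 : e₁.marked n (if j < m then j else c) = A (if j < m then j else c) := by
    rw [← hcen.marked _ hjm, Env.marked, Env.marked, harr 3 (by decide)]
  have h4 : (fun f : Fin n × Fin n => e₁.arr 4 ((j * n + f.1) * n + f.2)) = arcValue e n m k j := by
    funext f
    rw [pack_assoc, he₁, run_valueE hs hn hJ hm hk hj (pack_lt f.1.2 f.2.2)]
    rfl
  rw [h2, h3, h4]

theorem rel_prepareS (hs : WeightSize V n m J) (hn : e.x 0 = n) (hal : al.noRead 6 = true)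
    (u v : Fin n) : ((prepareS al).run V e).rel n u v ↔
      0 < al.eval V ((((layersS 5 weightE).run V ((layersS 4 valueE).run V e))).set 36 (u * n + v)) := by
  have hx : ∀ i, ((layersS 5 weightE).run V ((layersS 4 valueE).run V e)).x i = e.x i :=
    fun i => (fill_x _ _).trans (fill_x _ _)
  have h1 := eval_sqE (V := V) (e := (layersS 5 weightE).run V ((layersS 4 valueE).run V e))
    ((hx 0).trans hn) hs.n_le
  rw [prepareS, Stmt.run, Stmt.run, Env.rel, fill_arr hal (by rw [h1]; exact hs.sq_le)
    (by rw [h1]; exact pack_lt u.2 v.2)]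

end Query

/-- The packing of the numbers given by the expression `c`. -/
def packE (c : Expr) : Expr := .sum 41 (var 10) (c * .pow (var 11) (var 41))

theorem eval_packE {V J b : ℕ} {c : Expr} {e : Env} (f : ℕ → ℕ) (hJ : e.x 10 = J) (hJV : J ≤ V)
    (hb : e.x 11 = b) (hbV : b ≤ V) (hf : ∀ j < J, f j ≤ V)
    (hc : ∀ j < J, c.eval V (e.set 41 j) = f j) :
    (packE c).eval V e = ∑ j ∈ Finset.range J, f j * b ^ j := by
  rw [packE, eval_sum _ (by simpa [hJ] using hJV)]
  simp only [eval_var, hJ]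
  apply Finset.sum_congr rfl
  intro j hj
  have hj := Finset.mem_range.1 hj
  rw [eval_mul (by rw [hc j hj]; exact hf j hj), hc j hj, eval_pow] <;> simp [set_x, hb, hbV]
  omega

/-! ### The greedy choice of the centers -/

/-- A step of the greedy choice of the centers. -/
def greedyStepS : Stmt :=
  .seq (.set 10 (var 8))
  (.seq (.set 9 (.pow 3 (var 4 - 1 - var 8) * var 2))
  (.seq (.set 11 (var 9 + 1))
  (.seq (.set 13 (packE (var 9)))
  (.seq (prepareS (rd 1 (var 36)))
  (.seq dpS
  (.ite 0 (rd 7 (var 3 * var 12 + var 13)) (.seq traceS (.set 8 (var 8 + 1))) .skip))))))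

theorem setDist_eq_sum {V : Type*} [DecidableEq V] (A B : Finset (V × V)) :
    setDist A B = ∑ _f ∈ symmDiff A B, 1 := by
  simp [setDist]

open Classical in
theorem Centers.extend {n m : ℕ} {s t : Fin n} {R : Fin n → Fin n → Prop}
    {A : ℕ → Finset (Fin n × Fin n)} {e e' : Env} (hcen : Centers R s t m A e)
    (hzero : ∀ i, m * (n * n) ≤ i → e.arr 3 i = 0) {q : List (Fin n)} (hq : IsRoute R s t q)
    (harr : ∀ i, e'.arr 3 i =
      if ∃ f ∈ arcSet q, i = (m * n + f.1) * n + f.2 then 1 else e.arr 3 i) :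
    (∀ i, (m + 1) * (n * n) ≤ i → e'.arr 3 i = 0) ∧
      Centers R s t (m + 1) (fun c => if c < m then A c else arcSet q) e' := by
  refine ⟨fun i hi => ?_, fun c hc => ?_, fun c hc => ?_⟩
  · rw [harr, if_neg, hzero i (by nlinarith)]
    rintro ⟨f, _, rfl⟩
    rw [pack_assoc] at hi
    have := pack_lt f.1.2 f.2.2
    rw [Nat.succ_mul] at hi
    omega
  · by_cases hcm : c < m
    · simpa [hcm] using hcen.route c hcm
    · exact ⟨q, hq, by simp [hcm]⟩
  · ext f
    have hlf := pack_lt f.1.2 f.2.2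
    have hinj : ∀ g : Fin n × Fin n, (c * n + f.1) * n + f.2 = (m * n + g.1) * n + g.2 ↔
        c = m ∧ f = g := by
      intro g
      rw [pack_assoc, pack_assoc]
      constructor
      · intro h
        obtain ⟨h1, h2⟩ := pack_inj hlf (pack_lt g.1.2 g.2.2) h
        obtain ⟨h3, h4⟩ := pack_inj f.2.2 g.2.2 h2
        exact ⟨h1, Prod.ext (Fin.ext h3) (Fin.ext h4)⟩
      · rintro ⟨rfl, rfl⟩
        rfl
    rw [mem_marked, harr]
    simp only [hinj]
    by_cases hcm : c < m
    · rw [if_neg (by rintro ⟨g, _, h, _⟩; omega), ← mem_marked, hcen.marked c hcm, if_pos hcm]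
    · obtain rfl : c = m := by omega
      have hz : e.arr 3 ((c * n + f.1) * n + f.2) = 0 := hzero _ (by rw [pack_assoc]; omega)
      simp only [hz, true_and, exists_eq_right', lt_irrefl, if_false]
      split_ifs with hf <;> simp [hf]

/-- One query with the same demand τ for each of the m centres asks for a route at distance at least
τ from all of them. A positive answer is traced and becomes the next centre; a negative one says
that every route is within τ of some centre. -/
theorem run_greedyStepS {V n k d m : ℕ} {s t : Fin n} {R : Fin n → Fin n → Prop} {lev : Fin n → ℕ}
    {A : ℕ → Finset (Fin n × Fin n)} {e : Env} (hs : Sizes V n k d) (hv : Vars n s t k d e)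
    (hm : e.x 8 = m) (hmk : m < k) (hnet : Net R lev e) (hcen : Centers R s t m A e)
    (hzero : ∀ i, m * (n * n) ≤ i → e.arr 3 i = 0) :
    ((greedyStepS.run V e).x 8 = m + 1 ∧ (∀ i, (m + 1) * (n * n) ≤ i →
      (greedyStepS.run V e).arr 3 i = 0) ∧ ∃ A' : ℕ → Finset (Fin n × Fin n), (∀ c < m, A' c = A c) ∧
      Centers R s t (m + 1) A' (greedyStepS.run V e) ∧
      ∀ c < m, 3 ^ (k - 1 - m) * d ≤ setDist (A' m) (A' c)) ∨
    ((greedyStepS.run V e).x 8 = m ∧ (greedyStepS.run V e).arr 3 = e.arr 3 ∧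
      ∀ p, IsRoute R s t p → ∃ c < m, setDist (arcSet p) (A c) < 3 ^ (k - 1 - m) * d) := by
  set τ := 3 ^ (k - 1 - m) * d with hτ
  have hpow : 3 ^ (k - 1 - m) ≤ 3 ^ k := Nat.pow_le_pow_right (by omega) (by omega)
  have hτ1 : τ ≤ 3 ^ k * d := Nat.mul_le_mul_right _ hpow
  have hds : DpSize V n (τ + 1) m := hs.dpSize (by omega) (by omega) (by omega)
  have hws : WeightSize V n m m := hs.weightSize (by omega) (by omega)
  have hkV : k ≤ V := (hs.weightSize (m := k) (J := k) (by omega) (by omega)).m_le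
  have hmV := hws.m_le
  have h3k : 3 ^ k ≤ 3 ^ k * d := Nat.le_mul_of_pos_right _ hs.d_pos
  have hbV : 3 ^ k * d + 1 ≤ V := (hs.dpSize (b := 3 ^ k * d + 1) (J := 0) (by omega) le_rfl
    (by omega)).b_le
  have h3V : 3 ≤ 3 ^ k := Nat.le_self_pow hs.k_pos.ne' 3
  have hτV := hds.b_le
  set e₁ := e.set 10 m with he₁
  set e₂ := e₁.set 9 τ with he₂
  set e₃ := e₂.set 11 (τ + 1) with he₃
  -- All digits equal τ, the largest digit in the base τ + 1.
  set x₀ := ∑ j ∈ Finset.range m, τ * (τ + 1) ^ j with hx₀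
  set e₄ := e₃.set 13 x₀ with he₄
  set e₅ := (prepareS (rd 1 (var 36))).run V e₄ with he₅
  set e₆ := dpS.run V e₅ with he₆
  have hrun : greedyStepS.run V e = (Stmt.ite 0 (rd 7 (var 3 * var 12 + var 13))
      (.seq traceS (.set 8 (var 8 + 1))) .skip).run V e₆ := by
    have h1 : (Expr.pow 3 (var 4 - 1 - var 8) * var 2).eval V e₁ = τ := by
      have : (Expr.pow 3 (var 4 - 1 - var 8)).eval V e₁ = 3 ^ (k - 1 - m) := by
        rw [eval_pow] <;> simp [he₁, set_x, hv.k_eq, hm] <;> omega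
      rw [eval_mul, this]
      · simp [he₁, set_x, hv.d_eq, hτ]
      · rw [this]
        omega
    have h2 : (packE (var 9)).eval V e₃ = x₀ := by
      apply eval_packE (fun _ => τ) _ hmV _ hτV (fun _ _ => by omega) (fun _ _ => _)
      all_goals simp [he₃, he₂, he₁, set_x]
    rw [greedyStepS, Stmt.run, Stmt.run, eval_var, hm, ← he₁, Stmt.run, Stmt.run, h1, ← he₂,
      Stmt.run, Stmt.run]
    have h3 : (var 9 + 1).eval V e₂ = τ + 1 := by simp [he₂]
    rw [h3, ← he₃, Stmt.run, Stmt.run, h2, ← he₄, Stmt.run, ← he₅, Stmt.run, ← he₆]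
  have hx₄ : ∀ i, i ≠ 9 → i ≠ 10 → i ≠ 11 → i ≠ 13 → e₄.x i = e.x i := by
    intro i h1 h2 h3 h4
    simp [he₄, he₃, he₂, he₁, set_x, h1, h2, h3, h4]
  have h10 : e₄.x 10 = m := by simp [he₄, he₃, he₂, he₁, set_x]
  have h11 : e₄.x 11 = τ + 1 := by simp [he₄, he₃, he₂, he₁, set_x]
  have h13 : e₄.x 13 = x₀ := by simp [he₄]
  have hx₅ : ∀ i, e₅.x i = e₄.x i := prepareS_x _ _
  have hdv : DpVars n t (τ + 1) m e₅ :=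
    ⟨(hx₅ 0).trans ((hx₄ 0 (by decide) (by decide) (by decide) (by decide)).trans hv.n_eq),
      (hx₅ 1).trans ((hx₄ 1 (by decide) (by decide) (by decide) (by decide)).trans hv.t_eq),
      (hx₅ 10).trans h10, (hx₅ 11).trans h11⟩
  obtain ⟨hB, htab⟩ := run_dpS hds hdv
  rw [← he₆] at hB htab
  have h5 : e₆.arr 5 = e₅.arr 5 := run_arr rfl _
  have h6 : e₆.arr 6 = e₅.arr 6 := run_arr rfl _
  have hwt : e₅.wt n = e₆.wt n := by unfold Env.wt; rw [h5]
  have hrel : e₅.rel n = e₆.rel n := by unfold Env.rel; rw [h6]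
  rw [hwt, hrel] at htab
  have hn₄ : e₄.x 0 = n := (hx₄ 0 (by decide) (by decide) (by decide) (by decide)).trans hv.n_eq
  have hR : e₆.rel n = R := by
    funext u v
    rw [← hrel, he₅]
    apply propext
    rw [rel_prepareS hws hn₄ rfl, ← hnet.rel]
    simp only [eval_rd, eval_var, set_x_self, set_arr]
    rw [run_arr rfl, run_arr rfl]
    rfl
  have hW : ∀ j < m, ∀ p, IsRoute R s t p →
      listWeight (e₆.wt n j) p = setDist (arcSet p) (A j) := by
    intro j hj p hp
    have h1 := listWeight_prepareS (al := rd 1 (var 36)) (c := e₄.x 29) (e := e₄) (A := A) hws hn₄ h10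
      ((hx₄ 8 (by decide) (by decide) (by decide) (by decide)).trans hm)
      ((hx₄ 4 (by decide) (by decide) (by decide) (by decide)).trans hv.k_eq) rfl
      (hnet.congr rfl rfl) (hcen.congr rfl) hj (by rwa [if_pos hj]) hp
    rw [← he₅, hwt] at h1
    rw [h1, setDist_eq_sum, if_pos hj]
    exact Finset.sum_congr rfl fun f _ => by simp [arcValue, hj]
  have hx₀lt : x₀ < (τ + 1) ^ m := sum_digits_lt fun _ _ => by omega
  have hdig : ∀ j < m, digit (τ + 1) j x₀ = τ := fun j hj =>
    digit_sum (f := fun _ => τ) (fun _ _ => by omega) hj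
  have hx₆ : ∀ i, i ≠ 9 → i ≠ 10 → i ≠ 11 → i ≠ 13 → dpS.keepsVar i = true → e₆.x i = e.x i := by
    intro i h1 h2 h3 h4 h5
    rw [he₆, run_x h5, hx₅, hx₄ i h1 h2 h3 h4]
  have h13₆ : e₆.x 13 = x₀ := by rw [he₆, run_x rfl, hx₅, h13]
  have h3₆ : e₆.arr 3 = e.arr 3 := by
    rw [he₆, run_arr rfl, he₅, prepareS_arr _ _ (by decide) (by decide) (by decide)]
    rfl
  have hs3 := (hx₆ 3 (by decide) (by decide) (by decide) (by decide) rfl).trans hv.s_eq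
  have hcond : (rd 7 (var 3 * var 12 + var 13)).eval V e₆ = e₆.arr 7 (s * (τ + 1) ^ m + x₀) := by
    have := hws.n_le
    have := s.2
    rw [eval_rd, eval_add, eval_mul] <;> simp [hs3, hB, h13₆]
    omega
  have hm₆ := (hx₆ 8 (by decide) (by decide) (by decide) (by decide) rfl).trans hm
  have hdv₆ : DpVars n t (τ + 1) m e₆ := by
    rw [he₆]
    exact hdv.congr (run_x rfl _) (run_x rfl _) (run_x rfl _) (run_x rfl _)
  clear_value e₆
  by_cases hpos : 0 < e₆.arr 7 (s * (τ + 1) ^ m + x₀)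
  · left
    rw [hrun, run_ite_pos (a := 0) (by rw [hcond]; exact hpos), Stmt.run, Stmt.run]
    have hmn : m * n + n ≤ V := by
      have h1 : (m + 1) * n ≤ 2 * k * (n * n) := Nat.mul_le_mul (by omega) (Nat.le_mul_self n)
      have h2 := hs.sq_le
      rw [Nat.succ_mul] at h1
      omega
    obtain ⟨q, hq, hqw, harr⟩ := run_traceS (V := V) (s := s) (lev := lev) hds
      hdv₆ hB hm₆ hs3 h13₆ hx₀lt hmn
      (by rw [hR]; exact hnet.lt) htab hpos
    rw [hR] at hq
    have hc8 : (traceS.run V e₆).x 8 = m := (run_x rfl _).trans hm₆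
    rw [h3₆] at harr
    obtain ⟨hz, hce⟩ := hcen.extend (e' := (traceS.run V e₆).set 8 (m + 1)) hzero hq harr
    have h8 : (var 8 + 1).eval V (traceS.run V e₆) = m + 1 := by simp [hc8]
    rw [h8]
    refine ⟨set_x_self _ _, hz, _, fun c hc => if_pos hc, hce, fun c hc => ?_⟩
    · rw [if_neg (lt_irrefl m), if_pos hc, ← hW c hc q hq, ← hdig c hc]
      exact hqw c hc
  · right
    rw [hrun, run_ite_neg (a := 0) (by rw [hcond]; exact hpos), Stmt.run]
    refine ⟨hm₆, h3₆, fun p hp => ?_⟩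
    by_contra! hcon
    apply hpos
    rw [htab s x₀ hx₀lt, if_pos]
    · exact one_pos
    have h1 := reaches_iff_of_acyclic (R := e₆.rel n) (lev := lev) (t := t) (b := τ + 1) (J := m)
      (W := e₆.wt n) (by rw [hR]; exact hnet.lt) (by omega) (v := s) hx₀lt
    rw [Fintype.card_fin] at h1
    rw [h1, hR]
    exact ⟨p, hp, fun j hj => by rw [hdig j hj, hW j hj p hp]; exact hcon j hj⟩

/-- The greedy choice of the centers; their number is stored in the variable `8`. -/
def greedyS : Stmt := .seq (.set 8 0) (.loop 24 (var 4) greedyStepS)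

/-- Every route is close to one of the centers. -/
def Stuck {n : ℕ} (R : Fin n → Fin n → Prop) (s t : Fin n) (k d m : ℕ)
    (A : ℕ → Finset (Fin n × Fin n)) : Prop :=
  ∀ p, IsRoute R s t p → ∃ c < m, setDist (arcSet p) (A c) < 3 ^ (k - 1 - m) * d

theorem run_greedyS {V n k d : ℕ} {s t : Fin n} {R : Fin n → Fin n → Prop} {lev : Fin n → ℕ}
    {e : Env} (hs : Sizes V n k d) (hv : Vars n s t k d e) (hnet : Net R lev e)
    (hzero : ∀ i, e.arr 3 i = 0) :
    ∃ m ≤ k, ∃ A : ℕ → Finset (Fin n × Fin n), (greedyS.run V e).x 8 = m ∧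
      Centers R s t m A (greedyS.run V e) ∧
      (∀ c < m, ∀ c' < c, 3 ^ (k - 1 - c) * d ≤ setDist (A c) (A c')) ∧
      (m = k ∨ Stuck R s t k d m A) := by
  have hkV : k ≤ V := (hs.weightSize (m := k) (J := k) (by omega) (by omega)).m_le
  have hb : (var 4).eval V (e.set 8 0) = k := by simp [set_x, hv.k_eq]
  have main := for_induction (V := V) (i := 24) (b := var 4) (e := e.set 8 0) (p := greedyStepS)
    (fun r e' => ∃ m ≤ r, ∃ A : ℕ → Finset (Fin n × Fin n), e'.x 8 = m ∧
      Centers R s t m A e' ∧ (∀ i, m * (n * n) ≤ i → e'.arr 3 i = 0) ∧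
      (∀ c < m, ∀ c' < c, 3 ^ (k - 1 - c) * d ≤ setDist (A c) (A c')) ∧
      (m = r ∨ Stuck R s t k d m A)) (by rw [hb]; exact hkV) ?_ ?_ ?_
  · rw [hb] at main
    obtain ⟨m, hm, A, h1, h2, _, h3, h4⟩ := main
    exact ⟨m, hm, A, h1, h2, h3, h4⟩
  · rintro j e' w ⟨m, hm, A, h1, h2, h3, h4⟩
    exact ⟨m, hm, A, by simpa [set_x] using h1, h2.congr rfl, h3, h4⟩
  · exact ⟨0, le_rfl, fun _ => ∅, set_x_self _ _, ⟨by simp, by simp⟩, fun i _ => hzero i, by simp,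
      .inl rfl⟩
  · rw [hb]
    rintro r hr e' _ hkv hka _ ⟨m, hm, A, h1, h2, h3, h4, h5⟩
    have hx : ∀ i, i ≠ 24 → i ≠ 8 → greedyStepS.keepsVar i = true → e'.x i = e.x i := by
      intro i hi hi8 hik
      rw [hkv i hi hik]
      simp [set_x, hi8]
    have hv' : Vars n s t k d e' := hv.congr (hx 0 (by decide) (by decide) rfl)
      (hx 1 (by decide) (by decide) rfl) (hx 2 (by decide) (by decide) rfl)
      (hx 3 (by decide) (by decide) rfl) (hx 4 (by decide) (by decide) rfl)
    have hnet' : Net R lev e' := hnet.congr ((hka 1 rfl).trans rfl) ((hka 2 rfl).trans rfl)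
    rcases run_greedyStepS hs hv' h1 (by omega) hnet' h2 h3 with
      ⟨h8, hz, A', hA', hcen, hd⟩ | ⟨h8, h3', hst⟩
    · rcases h5 with rfl | h5
      · refine ⟨m + 1, le_rfl, A', h8, hcen, hz, fun c hc c' hc' => ?_, .inl rfl⟩
        by_cases hcm : c = m
        · subst hcm
          exact hd c' hc'
        · rw [hA' c (by omega), hA' c' (by omega)]
          exact h4 c (by omega) c' hc'
      -- Once stuck, the number of centres and hence the threshold stay the same, so a later success
      -- would contradict `Stuck`.
      · obtain ⟨q, hq, hqA⟩ := hcen.route m (by omega)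
        obtain ⟨c, hc, hlt⟩ := h5 q hq
        have := hd c hc
        rw [hqA, hA' c hc] at this
        omega
    · refine ⟨m, by omega, A, h8, h2.congr h3', fun i hi => ?_, h4, .inr hst⟩
      rw [h3', h3 i hi]

/-! ### The test of a colouring -/

/-- The `i`-th path can be chosen, for the centers `A`, the assignment `c` of centers, the numbers `a`
of arcs that are not shared, and the colouring `χ`. -/
def GoodAt {n : ℕ} (R : Fin n → Fin n → Prop) (s t : Fin n) (A : ℕ → Finset (Fin n × Fin n))
    (k m d τ : ℕ) (c : ℕ → ℕ) (a : ℕ → ℕ → ℕ) (χ : Fin n × Fin n → ℕ → ℕ) (i : ℕ) : Prop :=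
  c i < m ∧ (∀ j < i, c j = c i → d ≤ a i j + a j i) ∧ ∃ p, IsRoute R s t p ∧
    (∀ f ∈ symmDiff (arcSet p) (A (c i)), χ f i ≠ 0) ∧
    (∀ j < m, j ≠ c i → τ ≤ setDist (arcSet p) (A j)) ∧
    ∀ j < k, a i j ≤ ((symmDiff (arcSet p) (A (c i))).filter fun f => χ f j = 0).card

/-- The required weights of the path with the number `24`. -/
def demandE : Expr := .ite (var 41) (var 8) (ifEq (var 41) (var 29) 0 (var 9))
  (digitE (var 11) (var 24 * var 4 + (var 41 - var 8)) (var 23))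

/-- The arcs that can be used by the path with the number `24`. -/
def allowedE : Expr := .ite 0 (rd 5 ((var 8 + var 24) * sqE + var 36)) 0 (rd 1 (var 36))

/-- The number of the conflicts between the path with the number `24` and the previous paths. -/
def conflictE : Expr := .sum 42 (var 24) (ifEq (digitE (var 4) (var 42) (var 22)) (var 29)
  (.ite (digitE (var 11) (var 24 * var 4 + var 42) (var 23) +
    digitE (var 11) (var 42 * var 4 + var 24) (var 23)) (var 2) 1 0) 0)

/-- The test for the path with the number `24`; a failure is recorded in the variable `25`. -/
def checkStepS : Stmt :=
  .seq (.set 29 (digitE (var 4) (var 24) (var 22)))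
  (.ite (var 29) (var 8)
    (.seq (.set 13 (packE demandE))
    (.seq (prepareS allowedE)
    (.seq dpS
    (.ite 0 (rd 7 (var 3 * var 12 + var 13)) (.ite 0 conflictE (.set 25 0) .skip) (.set 25 0)))))
    (.set 25 0))

/-- The colour of the arc `f` in the array `9`. -/
def Env.colour (e : Env) (n k : ℕ) (f : Fin n × Fin n) (j : ℕ) : ℕ :=
  e.arr 9 ((f.1 * n + f.2) * k + j)

/-- The variables of the test. -/
structure CheckVars (V k m τ C D : ℕ) (e : Env) : Prop where
  m_eq : e.x 8 = m
  τ_eq : e.x 9 = τ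
  J_eq : e.x 10 = m + k
  b_eq : e.x 11 = τ + 1
  C_eq : e.x 22 = C
  D_eq : e.x 23 = D
  C_le : C ≤ V
  D_le : D ≤ V

theorem CheckVars.congr {V k m τ C D : ℕ} {e e' : Env} (h : CheckVars V k m τ C D e)
    (h8 : e'.x 8 = e.x 8) (h9 : e'.x 9 = e.x 9) (h10 : e'.x 10 = e.x 10) (h11 : e'.x 11 = e.x 11)
    (h22 : e'.x 22 = e.x 22) (h23 : e'.x 23 = e.x 23) : CheckVars V k m τ C D e' :=
  ⟨h8.trans h.m_eq, h9.trans h.τ_eq, h10.trans h.J_eq, h11.trans h.b_eq, h22.trans h.C_eq,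
    h23.trans h.D_eq, h.C_le, h.D_le⟩

theorem Sizes.mul_self_le {V n k d : ℕ} (h : Sizes V n k d) : k * k ≤ V := by
  have h1 : k < 3 ^ k := Nat.lt_pow_self (by omega)
  have h2 : 3 ^ k ≤ 3 ^ k * d := Nat.le_mul_of_pos_right _ h.d_pos
  have h3 : k * k ≤ (3 ^ k * d + 1) ^ 2 := by
    rw [sq]
    exact Nat.mul_le_mul (by omega) (by omega)
  have h4 : (3 ^ k * d + 1) ^ 2 ≤ (3 ^ k * d + 1) ^ (2 * k) :=
    Nat.pow_le_pow_right (by omega) (by have := h.k_pos; omega)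
  exact h3.trans (h4.trans ((Nat.le_mul_of_pos_left _ h.n_pos).trans h.pow_le))

/-- The packed vector of the demands. -/
def demand (k m τ D : ℕ) (c i : ℕ) (j : ℕ) : ℕ :=
  if j < m then if j = c then 0 else τ else digit (τ + 1) (i * k + (j - m)) D

theorem demand_lt (k m τ D c i j : ℕ) : demand k m τ D c i j < τ + 1 := by
  unfold demand
  split_ifs
  · omega
  · omega
  · exact digit_lt (by omega) _ _

section Check

variable {V n k d m τ C D i : ℕ} {s t : Fin n} {R : Fin n → Fin n → Prop} {lev : Fin n → ℕ}
  {A : ℕ → Finset (Fin n × Fin n)} {e : Env}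

theorem eval_demandE (hs : Sizes V n k d) (hv : Vars n s t k d e) (hc : CheckVars V k m τ C D e)
    (hτ : τ ≤ 3 ^ k * d) (hm : m ≤ k) (h24 : e.x 24 = i) (hi : i < k) :
    (packE demandE).eval V e =
      ∑ j ∈ Finset.range (m + k), demand k m τ D (e.x 29) i j * (τ + 1) ^ j := by
  have hds : DpSize V n (τ + 1) (m + k) := hs.dpSize (by omega) (by omega) (by omega)
  have hkk := hs.mul_self_le
  have hbV := hds.b_le
  have hk : k ≤ V := (Nat.le_mul_self k).trans hkk
  apply eval_packE (demand k m τ D (e.x 29) i) hc.J_eq hds.J_le hc.b_eq hbV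
  · intro j _
    have := demand_lt k m τ D (e.x 29) i j
    omega
  · intro j hj
    have hpos : (var 24 * var 4 + (var 41 - var 8)).eval V (e.set 41 j) = i * k + (j - m) := by
      rw [eval_add, eval_mul] <;> simp [set_x, h24, hv.k_eq, hc.m_eq]
      omega
    rw [demandE, eval_ite, eval_ifEq]
    by_cases hjm : j < m
    · simp [set_x, hc.m_eq, hc.τ_eq, hjm, demand]
    · have hlt : i * k + (j - m) < k * k := pack_lt hi (by omega)
      have h1 : (var 11).eval V (e.set 41 j) = τ + 1 := by simp [set_x, hc.b_eq]
      have h2 : (var 23).eval V (e.set 41 j) = D := by simp [set_x, hc.D_eq]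
      rw [eval_digitE, hpos, h1, h2]
      · simp [set_x, hc.m_eq, hjm, demand]
      · rw [h1]; omega
      · rw [h1]; exact hbV
      · rw [hpos]; omega
      · rw [h2]; exact hc.D_le

/-- A pair of paths is tested when the one with the larger index is processed, so only j < i occurs.
-/
theorem eval_conflictE (hs : Sizes V n k d) (hv : Vars n s t k d e) (hc : CheckVars V k m τ C D e)
    (hτ : τ ≤ 3 ^ k * d) (h24 : e.x 24 = i) (hi : i < k) :
    0 < conflictE.eval V e ↔ ¬ ∀ j < i, digit k j C = e.x 29 →
      d ≤ digit (τ + 1) (i * k + j) D + digit (τ + 1) (j * k + i) D := by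
  have hds : DpSize V n (τ + 1) k := hs.dpSize (by omega) (by omega) (by omega)
  have hkk := hs.mul_self_le
  have hbV := hds.b_le
  have hk : k ≤ V := (Nat.le_mul_self k).trans hkk
  have hC := hc.C_le
  have hD := hc.D_le
  rw [conflictE, eval_sum _ (by simp [h24]; omega)]
  simp only [eval_var, h24]
  rw [Finset.sum_pos_iff, not_forall]
  refine exists_congr fun j => ?_
  rw [Finset.mem_range]
  by_cases hj : j < i
  swap
  · simp [hj]
  simp only [hj, true_and, forall_true_left]
  have h1 : (digitE (var 4) (var 42) (var 22)).eval V (e.set 42 j) = digit k j C := by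
    rw [eval_digitE] <;> simp [set_x, hv.k_eq, hc.C_eq] <;> omega
  have hpos : ∀ u w, u < k → w < k → u * k + w ≤ V := fun u w hu hw => (pack_lt hu hw).le.trans hkk
  have hp1 : (var 24 * var 4 + var 42).eval V (e.set 42 j) = i * k + j := by
    rw [eval_add, eval_mul] <;> simp [set_x, h24, hv.k_eq]
    omega
  have hp2 : (var 42 * var 4 + var 24).eval V (e.set 42 j) = j * k + i := by
    rw [eval_add, eval_mul] <;> simp [set_x, h24, hv.k_eq]
    omega
  have h2 : (digitE (var 11) (var 24 * var 4 + var 42) (var 23)).eval V (e.set 42 j) =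
      digit (τ + 1) (i * k + j) D := by
    rw [eval_digitE, hp1]
    · simp [set_x, hc.b_eq, hc.D_eq]
    · simp [set_x, hc.b_eq]
    · simpa [set_x, hc.b_eq] using hbV
    · rw [hp1]; exact hpos _ _ hi (by omega)
    · simpa [set_x, hc.D_eq] using hD
  have h3 : (digitE (var 11) (var 42 * var 4 + var 24) (var 23)).eval V (e.set 42 j) =
      digit (τ + 1) (j * k + i) D := by
    rw [eval_digitE, hp2]
    · simp [set_x, hc.b_eq, hc.D_eq]
    · simp [set_x, hc.b_eq]
    · simpa [set_x, hc.b_eq] using hbV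
    · rw [hp2]; exact hpos _ _ (by omega) hi
    · simpa [set_x, hc.D_eq] using hD
  rw [eval_ifEq, h1, eval_ite, eval_add, h2, h3]
  have h29 : (var 29).eval V (e.set 42 j) = e.x 29 := by simp [set_x]
  have hd : (var 2).eval V (e.set 42 j) = d := by simp [set_x, hv.d_eq]
  rw [h29, hd]
  simp only [eval_zero, eval_one]
  split_ifs with h4 h5 <;> simp [h4] <;> omega

/-- The query has m + k demands. The first m ask for distance at least τ from every centre other
than that of path i, whose own demand is 0; the last k ask for a(i,j) arcs of colour 0 for j. That
no arc of the symmetric difference has colour 0 for i is an upper bound and cannot be a demand.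
Instead, arcs of positive weight in the layer m + i are forbidden: the weights are natural numbers,
so the total is 0 if and only if each weight is 0. -/
theorem run_checkStepS (hs : Sizes V n k d) (hv : Vars n s t k d e) (hc : CheckVars V k m τ C D e)
    (hτ : τ ≤ 3 ^ k * d) (hm : m ≤ k) (hnet : Net R lev e) (hcen : Centers R s t m A e)
    (h24 : e.x 24 = i) (hi : i < k) :
    0 < (checkStepS.run V e).x 25 ↔ 0 < e.x 25 ∧ GoodAt R s t A k m d τ (fun i => digit k i C)
      (fun i j => digit (τ + 1) (i * k + j) D) (e.colour n k) i := by
  have hds : DpSize V n (τ + 1) (m + k) := hs.dpSize (by omega) (by omega) (by omega)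
  have hws : WeightSize V n m (m + k) := hs.weightSize (by omega) (by omega)
  have hkk := hs.mul_self_le
  have hk : k ≤ V := (Nat.le_mul_self k).trans hkk
  have hC := hc.C_le
  set c := digit k i C with hcdef
  have h1 : (digitE (var 4) (var 24) (var 22)).eval V e = c := by
    rw [eval_digitE] <;> simp [hv.k_eq, hc.C_eq, h24] <;> omega
  rw [checkStepS, Stmt.run, Stmt.run, h1]
  set e₁ := e.set 29 c with he₁
  have hx₁ : ∀ i, i ≠ 29 → e₁.x i = e.x i := fun i hi => by simp [he₁, set_x, hi]
  have hv₁ : Vars n s t k d e₁ := hv.congr (hx₁ _ (by decide)) (hx₁ _ (by decide))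
    (hx₁ _ (by decide)) (hx₁ _ (by decide)) (hx₁ _ (by decide))
  have hc₁ : CheckVars V k m τ C D e₁ := hc.congr (hx₁ _ (by decide)) (hx₁ _ (by decide))
    (hx₁ _ (by decide)) (hx₁ _ (by decide)) (hx₁ _ (by decide)) (hx₁ _ (by decide))
  have h29 : e₁.x 29 = c := set_x_self _ _
  have h24₁ : e₁.x 24 = i := (hx₁ _ (by decide)).trans h24
  by_cases hcm : c < m
  swap
  · rw [run_ite_neg (by simpa [h29, hc₁.m_eq] using hcm), Stmt.run]
    simp [GoodAt, ← hcdef, hcm]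
  rw [run_ite_pos (by simpa [h29, hc₁.m_eq] using hcm), Stmt.run, Stmt.run,
    eval_demandE hs hv₁ hc₁ hτ hm h24₁ hi, h29]
  set x₀ := ∑ j ∈ Finset.range (m + k), demand k m τ D c i j * (τ + 1) ^ j with hx₀
  set e₂ := e₁.set 13 x₀ with he₂
  have hx₂ : ∀ i, i ≠ 13 → e₂.x i = e₁.x i := fun i hi => by simp [he₂, set_x, hi]
  rw [Stmt.run]
  set e₃ := (prepareS allowedE).run V e₂ with he₃
  have hx₃ : ∀ i, i ≠ 13 → e₃.x i = e₁.x i := fun i hi => (prepareS_x _ _ _).trans (hx₂ i hi)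
  have hdv : DpVars n t (τ + 1) (m + k) e₃ :=
    ⟨(hx₃ 0 (by decide)).trans hv₁.n_eq, (hx₃ 1 (by decide)).trans hv₁.t_eq,
      (hx₃ 10 (by decide)).trans hc₁.J_eq, (hx₃ 11 (by decide)).trans hc₁.b_eq⟩
  obtain ⟨hB, htab⟩ := run_dpS hds hdv
  rw [Stmt.run]
  set e₄ := dpS.run V e₃ with he₄
  have hx₄ : ∀ i, i ≠ 13 → dpS.keepsVar i = true → e₄.x i = e₁.x i := fun i h h' =>
    (run_x h' _).trans (hx₃ i h)
  have h13 : e₄.x 13 = x₀ := (run_x rfl _).trans ((prepareS_x _ _ _).trans (set_x_self _ _))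
  have hx₀lt : x₀ < (τ + 1) ^ (m + k) := sum_digits_lt fun _ _ => demand_lt _ _ _ _ _ _ _
  have hdig : ∀ j < m + k, digit (τ + 1) j x₀ = demand k m τ D c i j := fun j hj =>
    digit_sum (f := demand k m τ D c i) (fun _ _ => demand_lt _ _ _ _ _ _ _) hj
  have hv₄ : Vars n s t k d e₄ := hv₁.congr (hx₄ _ (by decide) rfl) (hx₄ _ (by decide) rfl)
    (hx₄ _ (by decide) rfl) (hx₄ _ (by decide) rfl) (hx₄ _ (by decide) rfl)
  have hc₄ : CheckVars V k m τ C D e₄ := hc₁.congr (hx₄ _ (by decide) rfl) (hx₄ _ (by decide) rfl)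
    (hx₄ _ (by decide) rfl) (hx₄ _ (by decide) rfl) (hx₄ _ (by decide) rfl) (hx₄ _ (by decide) rfl)
  have h24₄ : e₄.x 24 = i := (hx₄ _ (by decide) rfl).trans h24₁
  have h29₄ : e₄.x 29 = c := (hx₄ _ (by decide) rfl).trans h29
  have h25₄ : e₄.x 25 = e.x 25 := (hx₄ _ (by decide) rfl).trans (hx₁ _ (by decide))
  clear_value e₄
  have hcond : (rd 7 (var 3 * var 12 + var 13)).eval V e₄ =
      e₄.arr 7 (s * (τ + 1) ^ (m + k) + x₀) := by
    have := hws.n_le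
    have := s.2
    rw [eval_rd, eval_add, eval_mul] <;> simp [hv₄.s_eq, hB, h13]
    omega
  have hW : ∀ j < m + k, (if j < m then j else c) < m → ∀ p, IsRoute R s t p →
      listWeight (e₃.wt n j) p = ∑ f ∈ symmDiff (arcSet p) (A (if j < m then j else c)),
        arcValue e n m k j f := by
    intro j hj hjm p hp
    have h1 := listWeight_prepareS (al := allowedE) (c := c) (e := e₂) (A := A) hws
      ((hx₂ 0 (by decide)).trans hv₁.n_eq) ((hx₂ 10 (by decide)).trans hc₁.J_eq)
      ((hx₂ 8 (by decide)).trans hc₁.m_eq) ((hx₂ 4 (by decide)).trans hv₁.k_eq)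
      ((hx₂ 29 (by decide)).trans h29)
      (hnet.congr rfl rfl) (hcen.congr rfl) hj hjm hp
    exact h1
  have hW1 : ∀ j < m, ∀ p, IsRoute R s t p →
      listWeight (e₃.wt n j) p = setDist (arcSet p) (A j) := by
    intro j hj p hp
    rw [hW j (by omega) (by rwa [if_pos hj]) p hp, if_pos hj, setDist_eq_sum]
    exact Finset.sum_congr rfl fun f _ => by simp [arcValue, hj]
  have hW2 : ∀ j < k, ∀ p, IsRoute R s t p → listWeight (e₃.wt n (m + j)) p =
      ((symmDiff (arcSet p) (A c)).filter fun f => e.colour n k f j = 0).card := by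
    intro j hj p hp
    have hif : (if m + j < m then m + j else c) = c := if_neg (by omega)
    rw [hW _ (by omega) (by rwa [hif]) p hp, hif, Finset.card_filter]
    refine Finset.sum_congr rfl fun f _ => ?_
    have hval : arcValue e n m k (m + j) f = 1 - e.colour n k f j := by simp [arcValue, Env.colour]
    rw [hval]
    by_cases h0 : e.colour n k f j = 0
    · simp [h0]
    · rw [if_neg h0]
      omega
  have hrel : ∀ u v, e₃.rel n u v ↔ R u v ∧ e₃.wt n (m + i) u v = 0 := by
    intro u v
    rw [he₃, rel_prepareS hws ((hx₂ 0 (by decide)).trans hv₁.n_eq) rfl, ← hnet.rel, Env.wt]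
    set e₅ := (layersS 5 weightE).run V ((layersS 4 valueE).run V e₂) with he₅
    have hx₅ : ∀ i, e₅.x i = e₂.x i := fun i => (fill_x _ _).trans (fill_x _ _)
    have h5 : ((prepareS allowedE).run V e₂).arr 5 = e₅.arr 5 := by
      rw [prepareS, Stmt.run, Stmt.run, fill_arr_of_ne (by decide)]
    have h15 : e₅.arr 1 = e.arr 1 := (run_arr rfl _).trans (run_arr rfl _)
    have hidx : ((var 8 + var 24) * sqE + var 36).eval V (e₅.set 36 (u * n + v)) =
        ((m + i) * n + u) * n + v := by
      have hJ := hds.J_le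
      have h8 : e₅.x 8 = m := by rw [hx₅, hx₂ 8 (by decide), hc₁.m_eq]
      have h24₅ : e₅.x 24 = i := by rw [hx₅, hx₂ 24 (by decide), h24₁]
      have h0 : e₅.x 0 = n := by rw [hx₅, hx₂ 0 (by decide), hv₁.n_eq]
      have hsum : (var 8 + var 24).eval V (e₅.set 36 (u * n + v)) = m + i := by
        simp [set_x, h8, h24₅]
      rw [eval_add, eval_mul (by rw [hsum]; omega), hsum,
        eval_sqE (n := n) (by simp [set_x, h0]) hws.n_le, pack_assoc]
      simp
    rw [h5, allowedE]
    by_cases h0 : 0 < e₅.arr 5 (((m + i) * n + u) * n + v)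
    · rw [eval_ite_pos (by rw [eval_rd, hidx]; exact h0)]
      simp [h0.ne']
    · rw [eval_ite_neg (by rw [eval_rd, hidx]; exact h0)]
      simp only [set_arr, eval_rd, eval_var, set_x_self, h15]
      omega
  have hroute : ∀ p, IsRoute (e₃.rel n) s t p ↔ IsRoute R s t p ∧
      ∀ f ∈ symmDiff (arcSet p) (A c), e.colour n k f i ≠ 0 := by
    intro p
    have hz : ∀ p, IsRoute R s t p → (listWeight (e₃.wt n (m + i)) p = 0 ↔
        ∀ f ∈ symmDiff (arcSet p) (A c), e.colour n k f i ≠ 0) := by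
      intro p hp
      rw [hW2 i hi p hp, Finset.card_eq_zero, Finset.filter_eq_empty_iff]
    constructor
    · intro hp
      have hp' : IsRoute R s t p := hp.mono fun u v h => ((hrel u v).1 h).1
      refine ⟨hp', (hz p hp').1 ?_⟩
      rw [listWeight]
      apply List.sum_eq_zero
      intro x hx
      obtain ⟨f, hf, rfl⟩ := List.mem_map.1 hx
      exact ((hrel _ _).1 (hp.rel_of_mem hf)).2
    · rintro ⟨hp, hcol⟩
      refine hp.of_forall_mem fun f hf => (hrel _ _).2 ⟨hp.rel_of_mem hf, ?_⟩
      have h0 := (hz p hp).2 hcol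
      rw [listWeight, List.sum_eq_zero_iff] at h0
      exact h0 _ (List.mem_map.2 ⟨f, hf, rfl⟩)
  have hquery : 0 < e₄.arr 7 (s * (τ + 1) ^ (m + k) + x₀) ↔ ∃ p, IsRoute R s t p ∧
      (∀ f ∈ symmDiff (arcSet p) (A c), e.colour n k f i ≠ 0) ∧
      (∀ j < m, j ≠ c → τ ≤ setDist (arcSet p) (A j)) ∧
      ∀ j < k, digit (τ + 1) (i * k + j) D ≤
        ((symmDiff (arcSet p) (A c)).filter fun f => e.colour n k f j = 0).card := by
    have h1 := reaches_iff_of_acyclic (R := e₃.rel n) (lev := lev) (t := t) (b := τ + 1)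
      (J := m + k) (W := e₃.wt n) (fun u v h => hnet.lt u v ((hrel u v).1 h).1) (by omega) (v := s)
      hx₀lt
    rw [Fintype.card_fin] at h1
    have h2 : 0 < e₄.arr 7 (s * (τ + 1) ^ (m + k) + x₀) ↔
        Reaches (e₃.rel n) t (τ + 1) (m + k) (e₃.wt n) n s x₀ := by
      rw [htab s x₀ hx₀lt]
      split_ifs with h <;> simp [h]
    rw [h2, h1]
    refine exists_congr fun p => ?_
    rw [hroute, and_assoc]
    refine and_congr_right fun hp => and_congr_right fun _ => ?_
    constructor
    · intro h
      refine ⟨fun j hj hjc => ?_, fun j hj => ?_⟩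
      · have := h j (by omega)
        rw [hdig j (by omega), hW1 j hj p hp] at this
        simpa [demand, hj, hjc] using this
      · have := h (m + j) (by omega)
        rw [hdig _ (by omega), hW2 j hj p hp] at this
        simpa [demand] using this
    · rintro ⟨h3, h4⟩ j hj
      rw [hdig j hj]
      by_cases hjm : j < m
      · rw [hW1 j hjm p hp]
        by_cases hjc : j = c
        · simp [demand, hjc, hcm]
        · simpa [demand, hjm, hjc] using h3 j hjm hjc
      · obtain ⟨j', rfl⟩ := Nat.exists_eq_add_of_le (not_lt.1 hjm)
        rw [hW2 j' (by omega) p hp]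
        simpa [demand] using h4 j' (by omega)
  have hconf := eval_conflictE hs hv₄ hc₄ hτ h24₄ hi
  rw [h29₄] at hconf
  by_cases hpos : 0 < e₄.arr 7 (s * (τ + 1) ^ (m + k) + x₀)
  · rw [run_ite_pos (a := 0) (by rw [hcond]; exact hpos)]
    rw [hquery] at hpos
    by_cases hcon : 0 < conflictE.eval V e₄
    · rw [run_ite_pos (a := 0) hcon, Stmt.run, set_x_self, eval_zero]
      rw [hconf] at hcon
      simp only [lt_irrefl, false_iff, not_and, GoodAt]
      exact fun _ _ h => absurd h hcon
    · rw [run_ite_neg (a := 0) hcon, Stmt.run, h25₄]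
      rw [hconf, not_not] at hcon
      exact (and_iff_left ⟨hcm, hcon, hpos⟩).symm
  · rw [run_ite_neg (a := 0) (by rw [hcond]; exact hpos), Stmt.run, set_x_self, eval_zero]
    rw [hquery] at hpos
    simp only [lt_irrefl, false_iff, not_and, GoodAt]
    exact fun _ _ _ => hpos

/-- The test of a colouring; a success is recorded in the variable `7`. -/
def checkS : Stmt :=
  .seq (.set 25 1) (.seq (.loop 24 (var 4) checkStepS) (.ite 0 (var 25) (.set 7 1) .skip))

theorem run_checkS (hs : Sizes V n k d) (hv : Vars n s t k d e) (hc : CheckVars V k m τ C D e)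
    (hτ : τ ≤ 3 ^ k * d) (hm : m ≤ k) (hnet : Net R lev e) (hcen : Centers R s t m A e) :
    (checkS.run V e).x 7 = 1 ↔ e.x 7 = 1 ∨ ∀ i < k, GoodAt R s t A k m d τ (fun i => digit k i C)
      (fun i j => digit (τ + 1) (i * k + j) D) (e.colour n k) i := by
  have hk : k ≤ V := (Nat.le_mul_self k).trans hs.mul_self_le
  have hb : (var 4).eval V (e.set 25 1) = k := by simp [set_x, hv.k_eq]
  rw [checkS, Stmt.run, Stmt.run, Stmt.run, eval_one]
  set e₁ := e.set 25 1 with he₁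
  have main := for_induction (V := V) (i := 24) (b := var 4) (e := e₁) (p := checkStepS)
    (fun r e' => 0 < e'.x 25 ↔ ∀ i < r, GoodAt R s t A k m d τ (fun i => digit k i C)
      (fun i j => digit (τ + 1) (i * k + j) D) (e.colour n k) i) (by rw [hb]; exact hk)
    (fun j e' w h => by simpa [set_x] using h) (by simp [he₁]) ?_
  · rw [hb] at main
    set e₂ := (Stmt.loop 24 (var 4) checkStepS).run V e₁ with he₂
    have h7 : e₂.x 7 = e.x 7 := (run_x rfl _).trans (by simp [he₁, set_x])
    by_cases hpos : 0 < e₂.x 25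
    · rw [run_ite_pos (a := 0) (by simpa using hpos), Stmt.run]
      rw [main] at hpos
      simp only [set_x_self, eval_one, true_iff]
      exact .inr hpos
    · rw [run_ite_neg (a := 0) (by simpa using hpos), Stmt.run, h7]
      rw [main] at hpos
      exact (or_iff_left hpos).symm
  · rw [hb]
    intro r hr e' h24 hkv hka _ hI
    have hx : ∀ i, i ≠ 25 → i ≠ 24 → checkStepS.keepsVar i = true → e'.x i = e.x i := by
      intro i h1 h2 h3
      rw [hkv i h2 h3]
      simp [he₁, set_x, h1]
    have hv' : Vars n s t k d e' := hv.congr (hx _ (by decide) (by decide) rfl)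
      (hx _ (by decide) (by decide) rfl) (hx _ (by decide) (by decide) rfl)
      (hx _ (by decide) (by decide) rfl) (hx _ (by decide) (by decide) rfl)
    have hc' : CheckVars V k m τ C D e' := hc.congr (hx _ (by decide) (by decide) rfl)
      (hx _ (by decide) (by decide) rfl) (hx _ (by decide) (by decide) rfl)
      (hx _ (by decide) (by decide) rfl) (hx _ (by decide) (by decide) rfl)
      (hx _ (by decide) (by decide) rfl)
    have hcol : e'.colour n k = e.colour n k := by
      unfold Env.colour
      rw [hka 9 rfl]
      rfl
    rw [run_checkStepS hs hv' hc' hτ hm (hnet.congr (hka 1 rfl) (hka 2 rfl))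
      (hcen.congr (hka 3 rfl)) h24 hr, hI, hcol, Nat.forall_lt_succ_right]

end Check

/-! ### Correctness of the test for a suitable colouring -/

/-- There are `k` routes at pairwise distance at least `d`. -/
def HasFarRoutes {n : ℕ} (R : Fin n → Fin n → Prop) (s t : Fin n) (k d : ℕ) : Prop :=
  ∃ P : ℕ → List (Fin n), (∀ i < k, IsRoute R s t (P i)) ∧
    ∀ i < k, ∀ j < k, i < j → d ≤ setDist (arcSet (P i)) (arcSet (P j))

section Test

variable {n k m d τ : ℕ} {s t : Fin n} {R : Fin n → Fin n → Prop}
  {A : ℕ → Finset (Fin n × Fin n)}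

theorem GoodAt.congr {c c' : ℕ → ℕ} {a a' : ℕ → ℕ → ℕ} {χ χ' : Fin n × Fin n → ℕ → ℕ} {i : ℕ}
    (hi : i < k) (hc : ∀ j < k, c j = c' j) (ha : ∀ i < k, ∀ j < k, a i j = a' i j)
    (hχ : ∀ f, ∀ j < k, χ f j = χ' f j) (h : GoodAt R s t A k m d τ c a χ i) :
    GoodAt R s t A k m d τ c' a' χ' i := by
  obtain ⟨h1, h2, p, h3, h4, h5, h6⟩ := h
  rw [hc i hi] at h1 h4 h5 h6
  refine ⟨h1, fun j hj hjc => ?_, p, h3, fun f hf => ?_, h5, fun j hj => ?_⟩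
  · rw [← ha i hi j (by omega), ← ha j (by omega) i hi]
    exact h2 j hj (by rw [hc j (by omega), hc i hi, hjc])
  · rw [← hχ f i hi]
    exact h4 f hf
  · rw [← ha i hi j hj]
    refine (h6 j hj).trans (Finset.card_le_card fun f hf => ?_)
    rw [Finset.mem_filter] at hf ⊢
    rwa [← hχ f j hj]

/-- Soundness for arbitrary colourings. The tests of different paths share no choice of routes, so
the routes can be picked one by one. -/
theorem hasFarRoutes_of_goodAt (hdτ : d ≤ τ)
    (hA : ∀ b < m, ∀ b' < m, b ≠ b' → 3 * τ ≤ setDist (A b) (A b'))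
    (hst : ∀ p, IsRoute R s t p → ∃ c < m, setDist (arcSet p) (A c) < τ)
    {c : ℕ → ℕ} {a : ℕ → ℕ → ℕ} {χ : Fin n × Fin n → ℕ → ℕ}
    (h : ∀ i < k, GoodAt R s t A k m d τ c a χ i) : HasFarRoutes R s t k d := by
  choose! hc hpair P hP hχ hfar ha using h
  refine ⟨P, hP, fun i hi j hj hij => ?_⟩
  refine le_setDist_of_colouring (P := fun i => arcSet (P i)) hdτ hA (fun i hi => hst _ (hP i hi))
    hc hfar hχ ha (fun i hi j hj hij hcc => ?_) hi hj hij
  rw [add_comm]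
  exact hpair j hj i hij hcc

/-- Completeness: all colourings that agree with g on the small set U pass the test with the same c
and a, so it suffices that the seeds realise every pattern on small sets. -/
theorem exists_goodAt (hA : ∀ b < m, ∀ b' < m, b ≠ b' → 3 * τ ≤ setDist (A b) (A b'))
    (hst : ∀ p, IsRoute R s t p → ∃ c < m, setDist (arcSet p) (A c) < τ)
    (h : HasFarRoutes R s t k d) :
    ∃ (c : ℕ → ℕ) (a : ℕ → ℕ → ℕ) (U : Finset (Fin n × Fin n)) (g : Fin n × Fin n → ℕ → ℕ),
      (∀ i < k, c i < m) ∧ (∀ i j, a i j ≤ d) ∧ U.card ≤ k * τ ∧ (∀ e i, g e i < 2) ∧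
      ∀ χ : Fin n × Fin n → ℕ → ℕ, (∀ e ∈ U, ∀ i < k, χ e i = g e i) →
        ∀ i < k, GoodAt R s t A k m d τ c a χ i := by
  obtain ⟨P, hP, hfar⟩ := h
  obtain ⟨c, a, U, g, h1, h2, h3, h4, h5, h6, h7⟩ := exists_small_of_le_setDist
    (P := fun i => arcSet (P i)) hA (fun i hi => hst _ (hP i hi)) hfar
  refine ⟨c, a, U, g, h1, h2, h3, h4, fun χ hχ i hi => ?_⟩
  obtain ⟨h8, h9⟩ := h7 χ hχ
  refine ⟨h1 i hi, fun j hj hjc => ?_, P i, hP i hi, h8 i hi, h6 i hi, h9 i hi⟩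
  rw [add_comm]
  exact h5 j (by omega) i hi hj hjc

/-- A colouring given by the numbers `v`. -/
def colourOf (v : ℕ → ℕ) (x : ℕ) : ℕ := colour (v 0) (v 1) (v 2) (v 3) (v 4) (v 5) (v 6) x

/-- The bounds for the numbers that describe a colouring of at most `E` elements. -/
structure SeedSize (Q n k d : ℕ) (E : ℕ) : Prop where
  E_pos : 0 < E
  le_E : 3 ^ k * d * (k * k) ≤ E
  index_lt : 2 * (n * n * k) < Q
  table_lt : 2 * (2 * E ^ 2 + 1) < Q
  level_le : ∀ L, 2 ^ L ≤ 2 * E → (2 * (2 * E ^ 2 + 1)) ^ (L + 1) ≤ Q ∧ 2 ^ 2 ^ (L + 3) ≤ Q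
  center_le : k ^ k ≤ Q
  demand_le : (3 ^ k * d + 1) ^ (k * k) ≤ Q

/-- The numbers `v` describe a colouring in a form that can be evaluated. -/
structure SeedValid (Q : ℕ) (v : ℕ → ℕ) : Prop where
  lt : ∀ r < 9, v r < Q
  pos₀ : 0 < v 0
  lt₀ : v 1 < v 0
  pos₁ : 0 < v 2
  pos₂ : 0 < v 3
  level : 2 ^ (v 6 + 3) ≤ Q

/-- The pairs of an arc uv and an index i are coded as (un + v)k + i. The relevant codes number at
most kτk ≤ E, so `exists_colour_eq` describes a suitable colouring by seven numbers; two more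
numbers pack the centres c(i) and the matrix a(i,j). -/
theorem exists_seed {Q E : ℕ} (hs : SeedSize Q n k d E) (hn : 0 < n) (hk : 0 < k)
    (hd : d ≤ τ)
    (hτ : τ ≤ 3 ^ k * d) (hm : m ≤ k)
    (hA : ∀ b < m, ∀ b' < m, b ≠ b' → 3 * τ ≤ setDist (A b) (A b'))
    (hst : ∀ p, IsRoute R s t p → ∃ c < m, setDist (arcSet p) (A c) < τ)
    (h : HasFarRoutes R s t k d) : ∃ v, SeedValid Q v ∧
      ∀ i < k, GoodAt R s t A k m d τ (fun i => digit k i (v 7))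
        (fun i j => digit (τ + 1) (i * k + j) (v 8))
        (fun f j => colourOf v ((f.1 * n + f.2) * k + j)) i := by
  obtain ⟨c, a, U, g, h1, h2, h3, h4, h5⟩ := exists_goodAt hA hst h
  obtain ⟨C, hC, hCd⟩ := exists_digits (f := c) (b := k) (m := k) fun i hi => (h1 i hi).trans_le hm
  -- Since a(i,j) ≤ d ≤ τ, the entries of the matrix are digits in the base τ + 1.
  obtain ⟨D, hD, hDd⟩ := exists_digits (f := fun x => a (x / k) (x % k)) (b := τ + 1) (m := k * k)
    fun i _ => by have := h2 (i / k) (i % k); omega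
  set S := (U ×ˢ Finset.range k).image fun x => (x.1.1 * n + x.1.2 : ℕ) * k + x.2 with hS
  have hScard : S.card ≤ E := by
    refine Finset.card_image_le.trans ?_
    rw [Finset.card_product, Finset.card_range]
    calc U.card * k ≤ k * τ * k := Nat.mul_le_mul_right _ h3
      _ ≤ k * (3 ^ k * d) * k := by gcongr
      _ = 3 ^ k * d * (k * k) := by ring
      _ ≤ E := hs.le_E
  have hSX : ∀ x ∈ S, x < n * n * k := by
    intro x hx
    obtain ⟨⟨f, i⟩, hf, rfl⟩ := Finset.mem_image.1 hx
    exact pack_lt (pack_lt f.1.2 f.2.2) (Finset.mem_range.1 (Finset.mem_product.1 hf).2)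
  -- The prescribed bits are transported to the codes; codes of no pair get the default value 0.
  set g' : ℕ → ℕ := fun x => if h : x / k < n * n then g (finProdFinEquiv.symm ⟨x / k, h⟩) (x % k)
    else 0 with hg'
  have hg'2 : ∀ x, g' x < 2 := by
    intro x
    simp only [hg']
    split_ifs
    · exact h4 _ _
    · omega
  have hg'g : ∀ (f : Fin n × Fin n) i, i < k → g' ((f.1 * n + f.2) * k + i) = g f i := by
    intro f i hi
    have hlt : ((f.1 * n + f.2) * k + i) / k < n * n := by
      rw [pack_div _ hi]
      exact pack_lt f.1.2 f.2.2
    simp only [hg', dif_pos hlt, pack_mod _ hi]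
    congr 1
    rw [Equiv.symm_apply_eq]
    apply Fin.ext
    simp only [pack_div _ hi, finProdFinEquiv_apply_val]
    ring
  obtain ⟨p₀, a₀, p₁, H, T, L, b1, b2, b3, b4, b5, b6, b7, b8, b9⟩ :=
    exists_colour_eq hSX hScard (by positivity) hs.E_pos hg'2
  have h6 := hs.index_lt
  have h7 := hs.table_lt
  obtain ⟨h8, h9⟩ := hs.level_le L b6
  have h10 : p₁ ^ (L + 1) ≤ (2 * (2 * E ^ 2 + 1)) ^ (L + 1) := Nat.pow_le_pow_left b5 _
  have h11 : (τ + 1) ^ (k * k) ≤ (3 ^ k * d + 1) ^ (k * k) := Nat.pow_le_pow_left (by omega) _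
  have h12 := hs.center_le
  have h13 := hs.demand_le
  have h14 : 2 ^ (L + 3) ≤ 2 ^ 2 ^ (L + 3) := Nat.lt_two_pow_self.le
  have h15 : L < 2 ^ (L + 3) := Nat.lt_two_pow_self.trans_le (Nat.pow_le_pow_right (by omega) (by omega))
  set v : ℕ → ℕ := fun r => if r = 0 then p₀ else if r = 1 then a₀ else if r = 2 then 2 * E ^ 2 + 1
    else if r = 3 then p₁ else if r = 4 then H else if r = 5 then T else if r = 6 then L
    else if r = 7 then C else D with hv
  refine ⟨v, ⟨fun r hr => ?_, b1, b3, ?_, b4, ?_⟩, fun i hi => ?_⟩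
  · simp only [hv]
    split_ifs <;> omega
  · simp [hv]
  · simp only [hv]
    norm_num
    omega
  · refine (h5 (fun f j => colourOf v ((f.1 * n + f.2) * k + j)) (fun f hf j hj => ?_) i hi).congr hi
      (fun j hj => (hCd j hj).symm) (fun i hi j hj => ?_) (fun _ _ _ => rfl)
    · rw [← hg'g f j hj]
      exact b9 _ (Finset.mem_image.2 ⟨(f, j), Finset.mem_product.2 ⟨hf, Finset.mem_range.2 hj⟩, rfl⟩)
    · have := hDd (i * k + j) (pack_lt hi hj)
      rw [pack_div _ hj, pack_mod _ hj] at this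
      exact this.symm

end Test

/-! ### The search for a suitable colouring -/

/-- The hash function `hash`. -/
def hashE (a p K x : Expr) : Expr := ((a * x).mod p).mod K

theorem eval_hashE {V : ℕ} {a p K x : Expr} {e : Env} (ha : a.eval V e < p.eval V e)
    (hp : p.eval V e ≤ V) (hx : x.eval V e ≤ V) (hK : 0 < K.eval V e) :
    (hashE a p K x).eval V e = hash (a.eval V e) (p.eval V e) (K.eval V e) (x.eval V e) := by
  have h1 : (a * x).eval V e = a.eval V e * x.eval V e := eval_mul (by omega)
  -- The product may exceed V, but the quotient by p does not, because a < p; division truncates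
  -- only its result.
  have h2 : (a * x).eval V e / p.eval V e ≤ V := by
    rw [h1]
    refine le_trans ?_ hx
    apply Nat.div_le_of_le_mul
    exact Nat.mul_le_mul_right _ ha.le
  have h3 : ((a * x).mod p).eval V e = a.eval V e * x.eval V e % p.eval V e := by
    rw [eval_mod (by omega) h2, h1]
  have h4 := Nat.mod_lt (a.eval V e * x.eval V e) (show 0 < p.eval V e by omega)
  have h5 := Nat.div_le_self (a.eval V e * x.eval V e % p.eval V e) (K.eval V e)
  rw [hashE, eval_mod hK, h3, hash]
  rw [h3]
  omega

/-- The colour of the number in the variable `36`. -/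
def colourE : Expr := letE 31 (hashE (var 16) (var 15) (var 17) (var 36))
  (Expr.mod (.sum 41 (var 21 + 1) (letE 32 (.pow 2 (var 41 + 2))
    (digitE 2 (var 32 + hashE (digitE (var 18) (var 41) (var 19)) (var 18) (var 32) (var 31))
      (var 20)))) 2)

theorem eval_colourE {V Q : ℕ} {v : ℕ → ℕ} {e : Env} (hv : SeedValid Q v) (hQ : Q ≤ V)
    (he : ∀ r < 9, e.x (15 + r) = v r) (hx : e.x 36 ≤ V) :
    colourE.eval V e = colourOf v (e.x 36) := by
  have hlt := hv.lt
  have h15 : e.x 15 = v 0 := he 0 (by omega)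
  have h16 : e.x 16 = v 1 := he 1 (by omega)
  have h17 : e.x 17 = v 2 := he 2 (by omega)
  have h18 : e.x 18 = v 3 := he 3 (by omega)
  have h19 : e.x 19 = v 4 := he 4 (by omega)
  have h20 : e.x 20 = v 5 := he 5 (by omega)
  have h21 : e.x 21 = v 6 := he 6 (by omega)
  have l0 := hlt 0 (by omega)
  have l1 := hlt 1 (by omega)
  have l2 := hlt 2 (by omega)
  have l3 := hlt 3 (by omega)
  have l4 := hlt 4 (by omega)
  have l5 := hlt 5 (by omega)
  have l6 := hlt 6 (by omega)
  have hlev := hv.level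
  have hL : v 6 + 3 < 2 ^ (v 6 + 3) := Nat.lt_two_pow_self
  have hz : (hashE (var 16) (var 15) (var 17) (var 36)).eval V e =
      hash (v 1) (v 0) (v 2) (e.x 36) := by
    rw [eval_hashE] <;> simp [h15, h16, h17, hv.lt₀, hv.pos₁, hx]
    omega
  set z := hash (v 1) (v 0) (v 2) (e.x 36) with hzdef
  have hzV : z < v 2 := Nat.mod_lt _ hv.pos₁
  rw [colourE, eval_letE, hz]
  have hsum : (Expr.sum 41 (var 21 + 1) (letE 32 (.pow 2 (var 41 + 2))
      (digitE 2 (var 32 + hashE (digitE (var 18) (var 41) (var 19)) (var 18) (var 32) (var 31))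
      (var 20)))).eval V (e.set 31 z) = ∑ i ∈ Finset.range (v 6 + 1),
      digit 2 (2 ^ (i + 2) + hash (digit (v 3) i (v 4)) (v 3) (2 ^ (i + 2)) z) (v 5) := by
    rw [eval_sum _ (by simp [set_x, h21]; omega)]
    simp only [eval_add, eval_var, eval_one, set_x, show (21 : ℕ) ≠ 31 by decide, if_false, h21]
    apply Finset.sum_congr rfl
    intro i hi
    have hi := Finset.mem_range.1 hi
    have hpow : 2 ^ (i + 2) + 2 ^ (i + 2) ≤ 2 ^ (v 6 + 3) := by
      rw [← two_mul, ← pow_succ']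
      exact Nat.pow_le_pow_right (by omega) (by omega)
    have h0 : 0 < 2 ^ (i + 2) := by positivity
    have h32 : (Expr.pow 2 (var 41 + 2)).eval V ((e.set 31 z).set 41 i) = 2 ^ (i + 2) := by
      rw [eval_pow] <;> simp <;> omega
    rw [eval_letE, h32]
    set e' := ((e.set 31 z).set 41 i).set 32 (2 ^ (i + 2)) with he'
    have hdig : (digitE (var 18) (var 41) (var 19)).eval V e' = digit (v 3) i (v 4) := by
      rw [eval_digitE] <;> simp [he', set_x, h18, h19, hv.pos₂] <;> omega
    have hh : (hashE (digitE (var 18) (var 41) (var 19)) (var 18) (var 32) (var 31)).eval V e' =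
        hash (digit (v 3) i (v 4)) (v 3) (2 ^ (i + 2)) z := by
      rw [eval_hashE, hdig]
      · simp [he', set_x, h18]
      · rw [hdig]
        simpa [he', set_x, h18] using digit_lt hv.pos₂ _ _
      · simp [he', set_x, h18]
        omega
      · simp [he', set_x]
        omega
      · simp [he']
    have hhlt : hash (digit (v 3) i (v 4)) (v 3) (2 ^ (i + 2)) z < 2 ^ (i + 2) := Nat.mod_lt _ h0
    have hidx : (var 32 + hashE (digitE (var 18) (var 41) (var 19)) (var 18) (var 32)
        (var 31)).eval V e' = 2 ^ (i + 2) + hash (digit (v 3) i (v 4)) (v 3) (2 ^ (i + 2)) z := by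
      rw [eval_add, hh]
      simp [he']
    rw [eval_digitE, hidx]
    · simp [he', set_x, h20]
    · simp
    · simp
      omega
    · rw [hidx]
      omega
    · simp [he', set_x, h20]
      omega
  have hle : ∑ i ∈ Finset.range (v 6 + 1),
      digit 2 (2 ^ (i + 2) + hash (digit (v 3) i (v 4)) (v 3) (2 ^ (i + 2)) z) (v 5) ≤ v 6 + 1 := by
    refine (Finset.sum_le_card_nsmul _ _ 1 fun i _ => ?_).trans (by simp)
    exact Nat.lt_succ_iff.1 (digit_lt (by omega) _ _)
  rw [eval_mod (by simp), hsum, colourOf, colour]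
  · simp [hzdef]
  · rw [hsum, eval_two]
    omega

/-- Assignment of the digits of the variable `14` to the variables `15` to `23`. -/
def decodeS : Stmt :=
  .seq (.set 15 (digitE (var 6) (.const 0) (var 14)))
  (.seq (.set 16 (digitE (var 6) (.const 1) (var 14)))
  (.seq (.set 17 (digitE (var 6) (.const 2) (var 14)))
  (.seq (.set 18 (digitE (var 6) (.const 3) (var 14)))
  (.seq (.set 19 (digitE (var 6) (.const 4) (var 14)))
  (.seq (.set 20 (digitE (var 6) (.const 5) (var 14)))
  (.seq (.set 21 (digitE (var 6) (.const 6) (var 14)))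
  (.seq (.set 22 (digitE (var 6) (.const 7) (var 14)))
  (.set 23 (digitE (var 6) (.const 8) (var 14))))))))))

theorem run_decodeS {V Q : ℕ} {e : Env} (h6 : e.x 6 = Q) (hQ : 0 < Q) (hQV : Q ≤ V) (hV : 9 ≤ V)
    (h14 : e.x 14 ≤ V) : ∀ r < 9, (decodeS.run V e).x (15 + r) = digit Q r (e.x 14) := by
  have hd : ∀ r < 9, ∀ e' : Env, e'.x 6 = Q → e'.x 14 = e.x 14 →
      (digitE (var 6) (.const r) (var 14)).eval V e' = digit Q r (e.x 14) := by
    intro r hr e' h6' h14'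
    rw [eval_digitE] <;> simp [h6', h14'] <;> omega
  intro r hr
  simp only [decodeS, Stmt.run]
  repeat rw [hd _ (by omega) _ (by simp [set_x, h6]) (by simp [set_x])]
  interval_cases r <;> simp [set_x]

/-- The test of the colouring with the number in the variable `14`. -/
def seedS : Stmt := .seq decodeS (.seq (.fill 9 36 (sqE * var 4) colourE) checkS)

/-- The search for a suitable colouring. -/
def colourS : Stmt :=
  .seq (.set 7 0)
  (.seq (.set 9 (.pow 3 (var 4 - 1 - var 8) * var 2))
  (.seq (.set 10 (var 8 + var 4))
  (.seq (.set 11 (var 9 + 1))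
  (.loop 14 (.pow (var 6) 9) seedS))))

section Search

variable {V n k d m τ Q : ℕ} {s t : Fin n} {R : Fin n → Fin n → Prop} {lev : Fin n → ℕ}
  {A : ℕ → Finset (Fin n × Fin n)} {e : Env}

/-- The test for a seed. -/
theorem run_seedS (hs : Sizes V n k d) (hv : Vars n s t k d e)
    (h8 : e.x 8 = m) (h9 : e.x 9 = τ) (h10 : e.x 10 = m + k) (h11 : e.x 11 = τ + 1)
    (h6 : e.x 6 = Q) (hQ : 0 < Q) (hQV : Q ≤ V) (hV : 9 ≤ V) (h14 : e.x 14 ≤ V)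
    (hτ : τ ≤ 3 ^ k * d) (hm : m ≤ k) (hnet : Net R lev e) (hcen : Centers R s t m A e) :
    ∃ χ : Fin n × Fin n → ℕ → ℕ, (SeedValid Q (fun r => digit Q r (e.x 14)) → ∀ f, ∀ j < k,
        χ f j = colourOf (fun r => digit Q r (e.x 14)) ((f.1 * n + f.2) * k + j)) ∧
      ((seedS.run V e).x 7 = 1 ↔ e.x 7 = 1 ∨ ∀ i < k, GoodAt R s t A k m d τ
        (fun i => digit k i (digit Q 7 (e.x 14)))
        (fun i j => digit (τ + 1) (i * k + j) (digit Q 8 (e.x 14))) χ i) := by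
  have hws : WeightSize V n m (m + k) := hs.weightSize (by omega) (by omega)
  have hsq : n * n * k ≤ V := by
    have := hs.sq_le
    nlinarith
  have hdec := run_decodeS (V := V) h6 hQ hQV hV h14
  set e₁ := decodeS.run V e with he₁
  have hx₁ : ∀ i, decodeS.keepsVar i = true → e₁.x i = e.x i := fun i hi => run_x hi _
  set e₂ := (Stmt.fill 9 36 (sqE * var 4) colourE).run V e₁ with he₂
  have hx₂ : ∀ i, e₂.x i = e₁.x i := fun i => fill_x _ _
  have hx : ∀ i, decodeS.keepsVar i = true → e₂.x i = e.x i := fun i hi => (hx₂ i).trans (hx₁ i hi)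
  have ha : ∀ a, 9 ≠ a → e₂.arr a = e.arr a := fun a ha =>
    (fill_arr_of_ne ha _).trans (run_arr (by rfl) _)
  have hv₂ : Vars n s t k d e₂ := hv.congr (hx _ rfl) (hx _ rfl) (hx _ rfl) (hx _ rfl) (hx _ rfl)
  have hdl : ∀ r, digit Q r (e.x 14) ≤ V := fun r => (digit_lt hQ _ _).le.trans hQV
  have hc₂ : CheckVars V k m τ (digit Q 7 (e.x 14)) (digit Q 8 (e.x 14)) e₂ :=
    ⟨(hx _ rfl).trans h8, (hx _ rfl).trans h9, (hx _ rfl).trans h10, (hx _ rfl).trans h11,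
      (hx₂ _).trans (hdec 7 (by omega)), (hx₂ _).trans (hdec 8 (by omega)), hdl _, hdl _⟩
  have hcheck := run_checkS hs hv₂ hc₂ hτ hm (hnet.congr (ha 1 (by decide)) (ha 2 (by decide)))
    (hcen.congr (ha 3 (by decide)))
  rw [hx 7 rfl] at hcheck
  -- The witness is whatever the array 9 contains. For an invalid seed it need not be the intended
  -- colouring, but the test is sound for every colouring.
  refine ⟨_, fun hval f j hj => ?_, hcheck⟩
  have hlt : (f.1 * n + f.2) * k + j < n * n * k := pack_lt (pack_lt f.1.2 f.2.2) hj
  have hlen : (sqE * var 4).eval V e₁ = n * n * k := by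
    have h0 := eval_sqE (V := V) (e := e₁) ((hx₁ 0 rfl).trans hv.n_eq) hws.n_le
    rw [eval_mul, h0]
    · simp [hx₁ 4 rfl, hv.k_eq]
    · rw [h0]
      exact hws.sq_le
  rw [Env.colour, he₂, fill_arr rfl (by rw [hlen]; exact hsq) (by rw [hlen]; exact hlt),
    eval_colourE hval hQV]
  · rw [set_x_self]
  · intro r hr
    rw [set_x, if_neg (by omega)]
    exact hdec r hr
  · rw [set_x_self]
    omega

/-- All seeds are tried. A success yields a solution because the test is sound, and a solution
yields a valid seed by `exists_seed`. -/
theorem run_colourS {E : ℕ} (hs : Sizes V n k d) (hv : Vars n s t k d e) (h8 : e.x 8 = m)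
    (h6 : e.x 6 = Q) (hQ : Q ^ 9 ≤ V) (hss : SeedSize Q n k d E)
    (hm : m < k) (hnet : Net R lev e) (hcen : Centers R s t m A e)
    (hA : ∀ c < m, ∀ c' < c, 3 ^ (k - 1 - c) * d ≤ setDist (A c) (A c'))
    (hst : Stuck R s t k d m A) :
    (colourS.run V e).x 7 = 1 ↔ HasFarRoutes R s t k d := by
  set τ := 3 ^ (k - 1 - m) * d with hτdef
  have hpow : 3 ^ (k - 1 - m) ≤ 3 ^ k := Nat.pow_le_pow_right (by omega) (by omega)
  have hτ : τ ≤ 3 ^ k * d := Nat.mul_le_mul_right _ hpow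
  have hdτ : d ≤ τ := Nat.le_mul_of_pos_left _ (by positivity)
  have hA' : ∀ b < m, ∀ b' < m, b ≠ b' → 3 * τ ≤ setDist (A b) (A b') := by
    have hlt : ∀ c < m, ∀ c' < c, 3 * τ ≤ setDist (A c) (A c') := by
      intro c hc c' hc'
      -- As c < m, the exponent k - 1 - c is at least k - m, one more than in τ. This is the factor
      -- 3, and the reason for the powers of 3 in the greedy choice.
      refine le_trans ?_ (hA c hc c' hc')
      rw [hτdef, ← mul_assoc, ← pow_succ']
      exact Nat.mul_le_mul_right _ (Nat.pow_le_pow_right (by omega) (by omega))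
    intro b hb b' hb' hne
    rcases lt_or_gt_of_ne hne with h | h
    · rw [setDist_comm]
      exact hlt b' hb' b h
    · exact hlt b hb b' h
  have hkV : k ≤ V := (hs.weightSize (m := k) (J := k) (by omega) (by omega)).m_le
  have h3k : 3 ^ k ≤ 3 ^ k * d := Nat.le_mul_of_pos_right _ hs.d_pos
  have hbV : 3 ^ k * d + 1 ≤ V := (hs.dpSize (b := 3 ^ k * d + 1) (J := 0) (by omega) le_rfl
    (by omega)).b_le
  have h3V : 3 ≤ 3 ^ k := Nat.le_self_pow hs.k_pos.ne' 3
  have hQ2 : 2 ≤ Q := by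
    have := hss.table_lt
    omega
  have hQQ : Q ≤ Q ^ 9 := Nat.le_self_pow (by omega) _
  have h9V : 9 ≤ V := (show 9 ≤ 2 ^ 9 by norm_num).trans ((Nat.pow_le_pow_left hQ2 9).trans hQ)
  set e₀ := e.set 7 0 with he₀
  set e₁ := e₀.set 9 τ with he₁
  set e₂ := e₁.set 10 (m + k) with he₂
  set e₃ := e₂.set 11 (τ + 1) with he₃
  have hrun : colourS.run V e = (Stmt.loop 14 (.pow (var 6) 9) seedS).run V e₃ := by
    have h1 : (Expr.pow 3 (var 4 - 1 - var 8) * var 2).eval V e₀ = τ := by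
      have : (Expr.pow 3 (var 4 - 1 - var 8)).eval V e₀ = 3 ^ (k - 1 - m) := by
        rw [eval_pow] <;> simp [he₀, set_x, hv.k_eq, h8] <;> omega
      rw [eval_mul, this]
      · simp [he₀, set_x, hv.d_eq, hτdef]
      · rw [this]
        omega
    have h2 : (var 8 + var 4).eval V e₁ = m + k := by
      simp [he₁, he₀, set_x, h8, hv.k_eq]
    have h3 : (var 9 + 1).eval V e₂ = τ + 1 := by simp [he₂, he₁, set_x]
    rw [colourS, Stmt.run, Stmt.run, eval_zero, ← he₀, Stmt.run, Stmt.run, h1, ← he₁, Stmt.run,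
      Stmt.run, h2, ← he₂, Stmt.run, Stmt.run, h3, ← he₃]
  have hx : ∀ i, i ≠ 7 → i ≠ 9 → i ≠ 10 → i ≠ 11 → e₃.x i = e.x i := by
    intro i h1 h2 h3 h4
    simp [he₃, he₂, he₁, he₀, set_x, h1, h2, h3, h4]
  have hb : (Expr.pow (var 6) (.const 9)).eval V e₃ = Q ^ 9 := by
    rw [eval_pow] <;> simp [hx, h6] <;> omega
  have hnineE : (Expr.pow (var 6) 9) = .pow (var 6) (.const 9) := rfl
  rw [hrun, hnineE]
  -- The invariant consists of two implications and not of an equivalence with the existence of a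
  -- valid seed, since an invalid seed may also pass the test.
  have main := for_induction (V := V) (i := 14) (b := .pow (var 6) (.const 9)) (e := e₃) (p := seedS)
    (fun r e' => (e'.x 7 = 1 → HasFarRoutes R s t k d) ∧
      ((∃ seed < r, SeedValid Q (fun r => digit Q r seed) ∧ ∀ i < k, GoodAt R s t A k m d τ
        (fun i => digit k i (digit Q 7 seed)) (fun i j => digit (τ + 1) (i * k + j) (digit Q 8 seed))
        (fun f j => colourOf (fun r => digit Q r seed) ((f.1 * n + f.2) * k + j)) i) →
        e'.x 7 = 1)) (by rw [hb]; exact hQ) (fun j e' w h => by simpa [set_x] using h) ?_ ?_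
  · rw [hb] at main
    refine ⟨main.1, fun hfar => main.2 ?_⟩
    obtain ⟨v, hv1, hv2⟩ := exists_seed hss hs.n_pos hs.k_pos hdτ hτ hm.le hA' hst hfar
    obtain ⟨seed, hseed, hsv⟩ := exists_digits hv1.lt
    refine ⟨seed, hseed, ?_, ?_⟩
    · refine ⟨fun r hr => ?_, ?_, ?_, ?_, ?_, ?_⟩
      · rw [hsv r hr]
        exact hv1.lt r hr
      all_goals simp only [hsv 0 (by omega), hsv 1 (by omega), hsv 2 (by omega), hsv 3 (by omega),
        hsv 6 (by omega)]
      exacts [hv1.pos₀, hv1.lt₀, hv1.pos₁, hv1.pos₂, hv1.level]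
    · simp only [colourOf, hsv 0 (by omega), hsv 1 (by omega), hsv 2 (by omega), hsv 3 (by omega),
        hsv 4 (by omega), hsv 5 (by omega), hsv 6 (by omega), hsv 7 (by omega), hsv 8 (by omega)]
      exact hv2
  · constructor
    · simp [he₃, he₂, he₁, he₀, set_x]
    · rintro ⟨seed, h, _⟩
      omega
  · rw [hb]
    rintro r hr e' h14 hkv hka _ ⟨hI1, hI2⟩
    have hx' : ∀ i, i ≠ 14 → seedS.keepsVar i = true → i ≠ 7 → i ≠ 9 → i ≠ 10 → i ≠ 11 →
        e'.x i = e.x i := by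
      intro i h1 h2 h3 h4 h5 h6
      rw [hkv i h1 h2, hx i h3 h4 h5 h6]
    have hv' : Vars n s t k d e' := by
      refine hv.congr ?_ ?_ ?_ ?_ ?_ <;>
        exact hx' _ (by decide) rfl (by decide) (by decide) (by decide) (by decide)
    obtain ⟨χ, hχ, hseed⟩ := run_seedS (τ := τ) (m := m) (Q := Q) (A := A) (R := R) (lev := lev)
      (e := e') hs hv'
      ((hx' 8 (by decide) rfl (by decide) (by decide) (by decide) (by decide)).trans h8)
      ((hkv 9 (by decide) rfl).trans (by simp [he₃, he₂, he₁, set_x]))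
      ((hkv 10 (by decide) rfl).trans (by simp [he₃, he₂, set_x]))
      ((hkv 11 (by decide) rfl).trans (by simp [he₃]))
      ((hx' 6 (by decide) rfl (by decide) (by decide) (by decide) (by decide)).trans h6)
      (by omega) (by omega) h9V (by omega) hτ hm.le
      (hnet.congr (hka 1 rfl) (hka 2 rfl)) (hcen.congr (hka 3 rfl))
    rw [h14] at hχ hseed
    rw [hseed]
    constructor
    · rintro (h | h)
      · exact hI1 h
      · exact hasFarRoutes_of_goodAt hdτ hA' hst h
    · rintro ⟨seed, hlt, hval, hgood⟩
      rcases Nat.lt_succ_iff_lt_or_eq.1 hlt with h | rfl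
      · exact .inl (hI2 ⟨seed, h, hval, hgood⟩)
      · refine .inr fun i hi => (hgood i hi).congr hi (fun _ _ => rfl) (fun _ _ _ _ => rfl)
          fun f j hj => (hχ hval f j hj).symm

end Search

/-! ### Computation of the distances -/

/-- The input of the environment is the graph `G`. -/
structure GraphIn {n : ℕ} (G : WeightedDigraph (Fin n)) (e : Env) : Prop where
  adj : ∀ u v : Fin n, 0 < e.inp (u * n + v) ↔ G.Adj u v
  len : ∀ u v : Fin n, G.Adj u v → e.rmem (u * n + v) = G.len u v

/-- The vertices that have been reached, according to the array `0`. -/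
def Env.reached (e : Env) (n : ℕ) (v : Fin n) : Prop := 0 < e.arr 0 v

/-- The distances of the vertices that have been reached. -/
def Env.dist (e : Env) (n : ℕ) (v : Fin n) : ℝ := e.rmem (n * n + v)

/-- The tail of the arc in the variable `37`. -/
def tailE : Expr := var 37 / var 0

/-- The head of the arc in the variable `37`. -/
def headE : Expr := (var 37).mod (var 0)

theorem eval_tailE {V n : ℕ} {u v : Fin n} {e : Env} (h0 : e.x 0 = n) (hn : n ≤ V)
    (h : e.x 37 = u * n + v) : tailE.eval V e = u := by
  have := u.2
  have hn0 : 0 < n := by omega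
  rw [tailE, eval_div] <;> simp only [eval_var, h0, h, pack_div _ v.2] <;> omega

theorem eval_headE {V n : ℕ} {u v : Fin n} {e : Env} (h0 : e.x 0 = n) (hn : n ≤ V)
    (h : e.x 37 = u * n + v) : headE.eval V e = v := by
  have := u.2
  have hn0 : 0 < n := by omega
  rw [headE, eval_mod] <;> simp only [eval_var, h0, h, pack_div _ v.2, pack_mod _ v.2] <;> omega

/-- The assignment of the real register `0` to the distance of the head of the arc. -/
def updateS : Stmt := .seq (.store 0 headE 1) (.rstore (sqE + headE) 0)

/-- The relaxation of the arc in the variable `37`. -/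
def relaxS : Stmt :=
  .ite 0 (.inp (var 37))
    (.ite 0 (rd 0 tailE)
      (.seq (.rload 0 (sqE + tailE))
      (.seq (.rload 1 (var 37))
      (.seq (.radd 0 0 1)
      (.ite 0 (rd 0 headE)
        (.seq (.rload 1 (sqE + headE)) (.rite 0 1 updateS .skip))
        updateS)))) .skip) .skip

theorem rite_pos {V r₁ r₂ : ℕ} {p q : Stmt} {e : Env} (h : e.rreg r₁ < e.rreg r₂) :
    (Stmt.rite r₁ r₂ p q).run V e = p.run V e := if_pos h

theorem rite_neg {V r₁ r₂ : ℕ} {p q : Stmt} {e : Env} (h : ¬ e.rreg r₁ < e.rreg r₂) :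
    (Stmt.rite r₁ r₂ p q).run V e = q.run V e := if_neg h

theorem run_seq {V : ℕ} {p q : Stmt} {e : Env} :
    (Stmt.seq p q).run V e = q.run V (p.run V e) := rfl

theorem run_rload {V r i : ℕ} {a : Expr} {e : Env} (h : a.eval V e = i) : (Stmt.rload r a).run V e =
    { e with rreg := Function.update e.rreg r (e.rmem i) } := by rw [← h]; rfl

theorem run_radd {V r r₁ r₂ : ℕ} {e : Env} : (Stmt.radd r r₁ r₂).run V e =
    { e with rreg := Function.update e.rreg r (e.rreg r₁ + e.rreg r₂) } := rfl

theorem run_rstore {V r i : ℕ} {a : Expr} {e : Env} (h : a.eval V e = i) :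
    (Stmt.rstore a r).run V e =
      { e with rmem := Function.update e.rmem i (e.rreg r) } := by rw [← h]; rfl

theorem run_store {V i v : ℕ} {a : Fin 16} {b c : Expr} {e : Env} (hb : b.eval V e = i)
    (hc : c.eval V e = v) : (Stmt.store a b c).run V e = e.store a i v := by rw [← hb, ← hc]; rfl

section Relax

variable {V n : ℕ} {G : WeightedDigraph (Fin n)} {u v : Fin n} {e : Env}

/-- The effect of a change of the distance of `v`. -/
theorem run_updateS (h0 : e.x 0 = n) (hn : n ≤ V) (h37 : e.x 37 = u * n + v) :
    (∀ w : Fin n, (updateS.run V e).reached n w ↔ w = v ∨ e.reached n w) ∧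
      (∀ w : Fin n, (updateS.run V e).dist n w = if w = v then e.rreg 0 else e.dist n w) ∧
      ∀ a < n * n, (updateS.run V e).rmem a = e.rmem a := by
  have hh := eval_headE (V := V) h0 hn h37
  have h1 : (sqE + headE).eval V (e.store 0 v 1) = n * n + v := by
    rw [eval_add, eval_sqE (n := n) (by exact h0) hn, eval_headE (u := u) (v := v) (n := n)]
    exacts [h0, hn, h37]
  rw [updateS, Stmt.run, Stmt.run, hh, eval_one, Stmt.run, h1]
  refine ⟨fun w => ?_, fun w => ?_, fun a ha => ?_⟩
  · simp only [Env.reached, Env.store, Function.update_self, Function.update_apply, Fin.val_inj]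
    by_cases h : w = v <;> simp [h]
  · simp [Env.dist, Env.store, Function.update_apply, Fin.val_inj]
  · simp only [Function.update_apply]
    rw [if_neg (by omega)]
    rfl

/-- Either nothing changes and the arc was already satisfied, or its head gets the distance offered
by the arc. There is no real number for infinity; the array 0 tells which entries are meaningful. -/
theorem run_relaxS (hG : GraphIn G e) (h0 : e.x 0 = n) (hn : n ≤ V) (h37 : e.x 37 = u * n + v) :
    GraphIn G (relaxS.run V e) ∧
    ((∀ w, ((relaxS.run V e).reached n w ↔ e.reached n w) ∧
        (relaxS.run V e).dist n w = e.dist n w) ∧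
      (G.Adj u v → e.reached n u → e.reached n v ∧ e.dist n v ≤ e.dist n u + G.len u v) ∨
    G.Adj u v ∧ e.reached n u ∧ (e.reached n v → e.dist n u + G.len u v ≤ e.dist n v) ∧
      (∀ w, (relaxS.run V e).reached n w ↔ w = v ∨ e.reached n w) ∧
      ∀ w, (relaxS.run V e).dist n w = if w = v then e.dist n u + G.len u v else e.dist n w) := by
  have ht := eval_tailE (V := V) h0 hn h37
  have hh := eval_headE (V := V) h0 hn h37
  have hinp : (Expr.inp (var 37)).eval V e = e.inp (u * n + v) := by simp [h37]
  have ht0 : (rd 0 tailE).eval V e = e.arr 0 u := by rw [eval_rd, ht]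
  by_cases hadj : 0 < e.inp (u * n + v)
  swap
  · rw [relaxS, run_ite_neg (a := 0) (by rw [hinp]; exact hadj), Stmt.run]
    exact ⟨hG, .inl ⟨fun w => ⟨Iff.rfl, rfl⟩, fun h => absurd ((hG.adj u v).2 h) hadj⟩⟩
  by_cases hu : 0 < e.arr 0 u
  swap
  · rw [relaxS, run_ite_pos (a := 0) (by rw [hinp]; exact hadj),
      run_ite_neg (a := 0) (by rw [ht0]; exact hu), Stmt.run]
    exact ⟨hG, .inl ⟨fun w => ⟨Iff.rfl, rfl⟩, fun _ h => absurd h hu⟩⟩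
  have hadj' := (hG.adj u v).1 hadj
  have hst : (sqE + tailE).eval V e = n * n + u := by rw [eval_add, eval_sqE h0 hn, ht]
  rw [relaxS, run_ite_pos (a := 0) (by rw [hinp]; exact hadj),
    run_ite_pos (a := 0) (by rw [ht0]; exact hu), run_seq, run_rload hst]
  set e₁ : Env := { e with rreg := Function.update e.rreg 0 (e.rmem (n * n + u)) } with he₁
  have h37₁ : (var 37).eval V e₁ = u * n + v := h37
  rw [run_seq, run_rload h37₁]
  set e₂ : Env := { e₁ with rreg := Function.update e₁.rreg 1 (e₁.rmem (u * n + v)) } with he₂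
  rw [run_seq, run_radd]
  set e₃ : Env := { e₂ with rreg := Function.update e₂.rreg 0 (e₂.rreg 0 + e₂.rreg 1) } with he₃
  have hr3 : e₃.rreg 0 = e.dist n u + G.len u v := by
    simp [he₃, he₂, he₁, Env.dist, hG.len u v hadj']
  have hh₃ : headE.eval V e₃ = v := eval_headE (u := u) h0 hn h37
  have hcond : (rd 0 headE).eval V e₃ = e.arr 0 v := by rw [eval_rd, hh₃]
  have hupd : ∀ e' : Env, e'.arr = e.arr → e'.inp = e.inp → e'.rmem = e.rmem → e'.x = e.x →
      e'.rreg 0 = e.dist n u + G.len u v → (e.reached n v → e.dist n u + G.len u v ≤ e.dist n v) →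
      GraphIn G (updateS.run V e') ∧
      ((∀ w, ((updateS.run V e').reached n w ↔ e.reached n w) ∧
        (updateS.run V e').dist n w = e.dist n w) ∧
      (G.Adj u v → e.reached n u → e.reached n v ∧ e.dist n v ≤ e.dist n u + G.len u v) ∨
      G.Adj u v ∧ e.reached n u ∧ (e.reached n v → e.dist n u + G.len u v ≤ e.dist n v) ∧
      (∀ w, (updateS.run V e').reached n w ↔ w = v ∨ e.reached n w) ∧
      ∀ w, (updateS.run V e').dist n w =
        if w = v then e.dist n u + G.len u v else e.dist n w) := by
    intro e' ha hi hm hx hr hle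
    obtain ⟨h1, h2, h3⟩ := run_updateS (V := V) (e := e') (u := u) (v := v) (by rw [hx, h0]) hn
      (by rw [hx, h37])
    refine ⟨⟨fun a b => ?_, fun a b hab => ?_⟩, .inr ⟨hadj', hu, hle, fun w => ?_, fun w => ?_⟩⟩
    · rw [run_inp, hi, hG.adj]
    · rw [h3 _ (pack_lt a.2 b.2), hm, hG.len a b hab]
    · rw [h1, Env.reached, ha, Env.reached]
    · have hd : e'.dist n w = e.dist n w := by rw [Env.dist, hm, Env.dist]
      rw [h2, hr, hd]
  by_cases hv : 0 < e.arr 0 v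
  swap
  · rw [run_ite_neg (a := 0) (by rw [hcond]; exact hv)]
    exact hupd e₃ rfl rfl rfl rfl hr3 fun h => absurd h hv
  have hsh : (sqE + headE).eval V e₃ = n * n + v := by
    rw [eval_add, eval_sqE (n := n) (by exact h0) hn, hh₃]
  rw [run_ite_pos (a := 0) (by rw [hcond]; exact hv), run_seq, run_rload hsh]
  set e₄ : Env := { e₃ with rreg := Function.update e₃.rreg 1 (e₃.rmem (n * n + v)) } with he₄
  have hr4 : e₄.rreg 0 = e.dist n u + G.len u v := by
    rw [← hr3, he₄]
    simp
  have hr41 : e₄.rreg 1 = e.dist n v := by simp [he₄, he₃, he₂, he₁, Env.dist]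
  by_cases hlt : e₄.rreg 0 < e₄.rreg 1
  · rw [rite_pos hlt]
    refine hupd e₄ rfl rfl rfl rfl hr4 fun _ => ?_
    rw [hr4, hr41] at hlt
    exact hlt.le
  · rw [rite_neg hlt, Stmt.run]
    rw [hr4, hr41] at hlt
    exact ⟨⟨hG.adj, hG.len⟩, .inl ⟨fun w => ⟨Iff.rfl, rfl⟩, fun _ _ => ⟨hv, not_lt.1 hlt⟩⟩⟩

theorem IsPath.eq_or_exists_concat {V : Type*} {G : WeightedDigraph V} {s v : V} {p : List V}
    (hp : IsPath G s v p) : p = [s] ∧ v = s ∨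
      ∃ q u, IsPath G s u q ∧ G.Adj u v ∧ p = q ++ [v] := by
  rw [isPath_iff] at hp
  obtain ⟨hr, hnd⟩ := hp
  rcases List.eq_nil_or_concat p with rfl | ⟨l, x, rfl⟩
  · simp [IsRoute] at hr
  rw [List.concat_eq_append] at hr hnd ⊢
  obtain rfl : x = v := by simpa using hr.2.1
  rcases List.eq_nil_or_concat l with rfl | ⟨l, u, rfl⟩
  · obtain ⟨h1, _⟩ := isRoute_singleton_iff.1 (by simpa using hr)
    exact .inl ⟨by simp [h1], h1⟩
  · right
    rw [List.concat_eq_append] at hr hnd ⊢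
    have h1 : l ++ [u] ++ [x] = l ++ u :: [x] := by simp
    rw [h1] at hr hnd
    obtain ⟨h2, h3⟩ := isRoute_append.1 hr
    refine ⟨l ++ [u], u, isPath_iff.2 ⟨h2, ?_⟩, (isRoute_cons_cons.1 h3).2.1, by simp⟩
    exact hnd.sublist (List.Sublist.append_left (by simp) _)

/-- The distances belong to paths. -/
def Sound (G : WeightedDigraph (Fin n)) (s : Fin n) (e : Env) : Prop :=
  ∀ v, e.reached n v → ∃ p, IsPath G s v p ∧ pathLength G p ≤ e.dist n v

theorem Sound.relax {s : Fin n} (hs : Sound G s e) (hG : GraphIn G e) (h0 : e.x 0 = n) (hn : n ≤ V)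
    (h37 : e.x 37 = u * n + v) : Sound G s (relaxS.run V e) := by
  obtain ⟨_, ⟨h1, _⟩ | ⟨h1, h2, _, h3, h4⟩⟩ := run_relaxS (V := V) hG h0 hn h37
  · intro w hw
    rw [(h1 w).2]
    exact hs w ((h1 w).1.1 hw)
  · intro w hw
    rw [h4]
    split_ifs with hwv
    · obtain ⟨p, hp, hpl⟩ := hs u h2
      obtain ⟨q, hq, _, hql⟩ := exists_isPath_concat hp h1
      exact ⟨q, hwv ▸ hq, by linarith⟩
    · exact hs w (((h3 w).1 hw).resolve_left hwv)

theorem relax_le (hG : GraphIn G e) (h0 : e.x 0 = n) (hn : n ≤ V) (h37 : e.x 37 = u * n + v)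
    {w : Fin n} (hw : e.reached n w) :
    (relaxS.run V e).reached n w ∧ (relaxS.run V e).dist n w ≤ e.dist n w := by
  obtain ⟨_, ⟨h1, _⟩ | ⟨h1, h2, h5, h3, h4⟩⟩ := run_relaxS (V := V) hG h0 hn h37
  · exact ⟨(h1 w).1.2 hw, (h1 w).2.le⟩
  · refine ⟨(h3 w).2 (.inr hw), ?_⟩
    rw [h4]
    split_ifs with hwv
    · subst hwv
      exact h5 hw
    · exact le_rfl

theorem relax_arc (hG : GraphIn G e) (h0 : e.x 0 = n) (hn : n ≤ V) (h37 : e.x 37 = u * n + v)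
    (ha : G.Adj u v) (hu : e.reached n u) : (relaxS.run V e).reached n v ∧
      (relaxS.run V e).dist n v ≤ e.dist n u + G.len u v := by
  obtain ⟨_, ⟨h1, h6⟩ | ⟨h1, h2, h5, h3, h4⟩⟩ := run_relaxS (V := V) hG h0 hn h37
  · obtain ⟨h7, h8⟩ := h6 ha hu
    exact ⟨(h1 v).1.2 h7, (h1 v).2.trans_le h8⟩
  · refine ⟨(h3 v).2 (.inl rfl), ?_⟩
    rw [h4, if_pos rfl]

/-- A round of relaxations. -/
theorem run_round {s : Fin n} (hs : Sound G s e) (hG : GraphIn G e) (h0 : e.x 0 = n) (hn : n ≤ V)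
    (hnn : n * n ≤ V) :
    GraphIn G ((Stmt.loop 37 sqE relaxS).run V e) ∧ Sound G s ((Stmt.loop 37 sqE relaxS).run V e) ∧
      (∀ v, e.reached n v → ((Stmt.loop 37 sqE relaxS).run V e).reached n v ∧
        ((Stmt.loop 37 sqE relaxS).run V e).dist n v ≤ e.dist n v) ∧
      ∀ u v, G.Adj u v → e.reached n u → ((Stmt.loop 37 sqE relaxS).run V e).reached n v ∧
        ((Stmt.loop 37 sqE relaxS).run V e).dist n v ≤ e.dist n u + G.len u v := by
  have hb : sqE.eval V e = n * n := eval_sqE h0 hn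
  have main := for_induction (V := V) (i := 37) (b := sqE) (e := e) (p := relaxS)
    (fun j e' => GraphIn G e' ∧ Sound G s e' ∧
      (∀ v, e.reached n v → e'.reached n v ∧ e'.dist n v ≤ e.dist n v) ∧
      ∀ u v : Fin n, u * n + v < j → G.Adj u v → e.reached n u →
        e'.reached n v ∧ e'.dist n v ≤ e.dist n u + G.len u v) (by rw [hb]; exact hnn)
    (fun j e' w h => ⟨⟨h.1.adj, h.1.len⟩, h.2⟩)
    ⟨hG, hs, fun v hv => ⟨hv, le_rfl⟩, fun u v h => absurd h (by omega)⟩ ?_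
  · rw [hb] at main
    obtain ⟨h1, h2, h3, h4⟩ := main
    exact ⟨h1, h2, h3, fun u v => h4 u v (pack_lt u.2 v.2)⟩
  · rw [hb]
    rintro j hj e' h37 hkv _ _ ⟨h1, h2, h3, h4⟩
    have h0' : e'.x 0 = n := (hkv 0 (by decide) rfl).trans h0
    have hn0 : 0 < n := by
      rcases Nat.eq_zero_or_pos n with rfl | h
      · omega
      · exact h
    set u : Fin n := ⟨j / n, Nat.div_lt_of_lt_mul hj⟩ with hu
    set v : Fin n := ⟨j % n, Nat.mod_lt _ hn0⟩ with hv
    have hjuv : j = u * n + v := (Nat.div_add_mod' j n).symm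
    rw [hjuv] at h37
    refine ⟨(run_relaxS h1 h0' hn h37).1, h2.relax h1 h0' hn h37, fun w hw => ?_,
      fun a b hab hadj ha => ?_⟩
    · obtain ⟨h5, h6⟩ := h3 w hw
      obtain ⟨h7, h8⟩ := relax_le h1 h0' hn h37 h5
      exact ⟨h7, h8.trans h6⟩
    · rcases Nat.lt_succ_iff_lt_or_eq.1 hab with h | h
      · obtain ⟨h5, h6⟩ := h4 a b h hadj ha
        obtain ⟨h7, h8⟩ := relax_le h1 h0' hn h37 h5
        exact ⟨h7, h8.trans h6⟩
      · obtain ⟨h9, h10⟩ := pack_inj b.2 v.2 (h.trans hjuv)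
        obtain rfl : a = u := Fin.ext h9
        obtain rfl : b = v := Fin.ext h10
        obtain ⟨h5, h6⟩ := h3 _ ha
        obtain ⟨h7, h8⟩ := relax_arc h1 h0' hn h37 hadj h5
        exact ⟨h7, by linarith⟩

/-- The computation of the distances from the vertex in the variable `3`. -/
def distS : Stmt :=
  .seq (.store 0 (var 3) 1) (.seq (.rstore (sqE + var 3) 9)
    (.loop 36 (var 0) (.loop 37 sqE relaxS)))

/-- The method of Bellman and Ford. After r rounds the entry of v is at most the length of every
path to v with at most r + 1 vertices: such a path without its last vertex was covered one round
earlier, and the round relaxes its last arc. As paths have at most n vertices, n rounds suffice;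
`Sound` gives the opposite inequality. -/
theorem run_distS {s : Fin n} (hG : GraphIn G e) (h0 : e.x 0 = n) (h3 : e.x 3 = s) (hn : n ≤ V)
    (hnn : n * n ≤ V) (hz : ∀ i, e.arr 0 i = 0) (hr : e.rreg 9 = 0) :
    GraphIn G (distS.run V e) ∧
      IsDist G s ((distS.run V e).reached n) ((distS.run V e).dist n) := by
  have hv3 : (var 3).eval V e = s := h3
  have hsq : (sqE + var 3).eval V (e.store 0 s 1) = n * n + s := by
    rw [eval_add, eval_sqE (n := n) (by exact h0) hn]
    simp [Env.store, h3]
  rw [distS, run_seq, run_store hv3 eval_one, run_seq, run_rstore hsq]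
  set e₁ := e.store 0 s 1 with he₁
  -- There are no real constants, so the zero for the source is taken from a real register that is
  -- still in its initial state.
  have hr₁ : e₁.rreg 9 = 0 := hr
  rw [hr₁]
  set e₂ : Env := { e₁ with rmem := Function.update e₁.rmem (n * n + s) 0 } with he₂
  have hG₂ : GraphIn G e₂ := by
    refine ⟨hG.adj, fun u v huv => ?_⟩
    have : (u * n + v : ℕ) < n * n := pack_lt u.2 v.2
    simp only [he₂, Function.update_apply]
    rw [if_neg (by omega)]
    exact hG.len u v huv
  have hreach : ∀ v, e₂.reached n v ↔ v = s := by
    intro v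
    simp only [Env.reached, he₂, he₁, Env.store, Function.update_self, Function.update_apply,
      Fin.val_inj, hz]
    by_cases h : v = s <;> simp [h]
  have hds : e₂.dist n s = 0 := by simp [Env.dist, he₂]
  have hb : (var 0).eval V e₂ = n := h0
  have main := for_induction (V := V) (i := 36) (b := var 0) (e := e₂) (p := .loop 37 sqE relaxS)
    (fun r e' => GraphIn G e' ∧ Sound G s e' ∧ ∀ v p, IsPath G s v p → p.length ≤ r + 1 →
      e'.reached n v ∧ e'.dist n v ≤ pathLength G p) (by rw [hb]; exact hn)
    (fun j e' w h => ⟨⟨h.1.adj, h.1.len⟩, h.2⟩) ⟨hG₂, fun v hv => ?_, fun v p hp hl => ?_⟩ ?_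
  · rw [hb] at main
    obtain ⟨h1, h2, h4⟩ := main
    refine ⟨h1, h2, fun v p hp => h4 v p hp ?_⟩
    have := hp.2.2.2.length_le_card
    rw [Fintype.card_fin] at this
    omega
  · obtain rfl := (hreach v).1 hv
    exact ⟨[v], isPath_iff.2 ⟨isRoute_singleton v, by simp⟩, by rw [hds, pathLength_singleton]⟩
  · rcases hp.eq_or_exists_concat with ⟨rfl, rfl⟩ | ⟨q, u, hq, _, rfl⟩
    · exact ⟨(hreach v).2 rfl, by rw [hds, pathLength_singleton]⟩
    · have : q ≠ [] := by
        rintro rfl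
        simp [IsPath] at hq
      have := List.length_pos_of_ne_nil this
      rw [List.length_append, List.length_singleton] at hl
      omega
  · rintro r _ e' _ hkv _ _ ⟨h1, h2, h4⟩
    have h0' : e'.x 0 = n := (hkv 0 (by decide) rfl).trans h0
    obtain ⟨h5, h6, h7, h8⟩ := run_round (V := V) h2 h1 h0' hn hnn
    refine ⟨h5, h6, fun v p hp hl => ?_⟩
    rcases hp.eq_or_exists_concat with ⟨rfl, rfl⟩ | ⟨q, u, hq, huv, rfl⟩
    · obtain ⟨h9, h10⟩ := h4 v [v] hp (by simp)
      obtain ⟨h11, h12⟩ := h7 v h9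
      exact ⟨h11, h12.trans h10⟩
    · obtain ⟨h9, h10⟩ := h4 u q hq (by simpa using hl)
      obtain ⟨h11, h12⟩ := h8 u v huv h9
      refine ⟨h11, ?_⟩
      rw [pathLength_concat G hq.2.1]
      linarith

end Relax

/-! ### Computation of the tight arcs and of the levels -/

/-- The comparison for the arc in the variable `37`: whether its tail is closer to the source than its
head, and whether it is tight. -/
def compareS : Stmt :=
  .seq (.store 1 (var 37) 0) (.seq (.store 10 (var 37) 0)
  (.ite 0 (rd 0 tailE)
    (.seq (.rload 0 (sqE + tailE))
    (.seq (.rload 1 (sqE + headE))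
    (.seq (.rite 0 1 (.store 10 (var 37) 1) .skip)
    (.ite 0 (.inp (var 37))
      (.seq (.rload 2 (var 37))
      (.seq (.radd 0 0 2)
      (.rite 0 1 .skip (.rite 1 0 .skip (.store 1 (var 37) 1))))) .skip)))) .skip))

section Compare

variable {V n : ℕ} {G : WeightedDigraph (Fin n)} {u v : Fin n} {e : Env}

open Classical in
-- Real numbers can only be compared strictly, so an arc is tight when both comparisons fail. The
-- entry of an unreached head may be arbitrary; this is harmless, since `Tight` and `level` refer to
-- the same entries.
theorem run_compareS (hG : GraphIn G e) (h0 : e.x 0 = n) (hn : n ≤ V) (h37 : e.x 37 = u * n + v) :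
    (compareS.run V e).rmem = e.rmem ∧
    (∀ i, (compareS.run V e).arr 1 i = if i = u * n + v then
      if Tight G (e.reached n) (e.dist n) u v then 1 else 0 else e.arr 1 i) ∧
    ∀ i, (compareS.run V e).arr 10 i = if i = u * n + v then
      if e.reached n u ∧ e.dist n u < e.dist n v then 1 else 0 else e.arr 10 i := by
  have hv37 : ∀ e' : Env, e'.x = e.x → (var 37).eval V e' = u * n + v := fun e' h => by simp [h, h37]
  have ht : ∀ e' : Env, e'.x = e.x → tailE.eval V e' = u := fun e' h =>
    eval_tailE (by rw [h, h0]) hn (by rw [h, h37])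
  have hh : ∀ e' : Env, e'.x = e.x → headE.eval V e' = v := fun e' h =>
    eval_headE (by rw [h, h0]) hn (by rw [h, h37])
  have hsq : ∀ e' : Env, e'.x = e.x → sqE.eval V e' = n * n := fun e' h =>
    eval_sqE (by rw [h, h0]) hn
  set i₀ : ℕ := u * n + v with hi₀
  rw [compareS, run_seq, run_store (hv37 e rfl) eval_zero]
  set e₁ := e.store 1 i₀ 0 with he₁
  rw [run_seq, run_store (hv37 e₁ rfl) eval_zero]
  set e₂ := e₁.store 10 i₀ 0 with he₂
  have ha1 : ∀ i, e₂.arr 1 i = if i = i₀ then 0 else e.arr 1 i := fun i => by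
    simp [he₂, he₁, Env.store, Function.update_apply]
  have ha10 : ∀ i, e₂.arr 10 i = if i = i₀ then 0 else e.arr 10 i := fun i => by
    simp [he₂, he₁, Env.store, Function.update_apply]
  have ha0 : e₂.arr 0 = e.arr 0 := by
    simp [he₂, he₁, Env.store]
  have ht2 : (rd 0 tailE).eval V e₂ = e.arr 0 u := by rw [eval_rd, ht e₂ rfl, ha0]
  by_cases hu : 0 < e.arr 0 u
  swap
  · have hu' : ¬ e.reached n u := hu
    rw [run_ite_neg (a := 0) (by rw [ht2]; exact hu), Stmt.run]
    refine ⟨rfl, fun i => ?_, fun i => ?_⟩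
    · rw [ha1, if_neg (c := Tight _ _ _ _ _) fun h => hu' h.1]
    · rw [ha10, if_neg (c := _ ∧ _) fun h => hu' h.1]
  have hst : (sqE + tailE).eval V e₂ = n * n + u := by rw [eval_add, hsq e₂ rfl, ht e₂ rfl]
  rw [run_ite_pos (a := 0) (by rw [ht2]; exact hu), run_seq, run_rload hst]
  set e₃ : Env := { e₂ with rreg := Function.update e₂.rreg 0 (e₂.rmem (n * n + u)) } with he₃
  have hsh : (sqE + headE).eval V e₃ = n * n + v := by rw [eval_add, hsq e₃ rfl, hh e₃ rfl]
  rw [run_seq, run_rload hsh]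
  set e₄ : Env := { e₃ with rreg := Function.update e₃.rreg 1 (e₃.rmem (n * n + v)) } with he₄
  have hr0 : e₄.rreg 0 = e.dist n u := by simp [he₄, he₃, he₂, he₁, Env.dist, Env.store]
  have hr1 : e₄.rreg 1 = e.dist n v := by simp [he₄, he₃, he₂, he₁, Env.dist, Env.store]
  have hstep : ∃ e₅ : Env, (Stmt.rite 0 1 (.store 10 (var 37) 1) .skip).run V e₄ = e₅ ∧
      e₅.x = e.x ∧ e₅.inp = e.inp ∧ e₅.rmem = e.rmem ∧ e₅.rreg 0 = e.dist n u ∧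
      e₅.rreg 1 = e.dist n v ∧ (∀ i, e₅.arr 1 i = if i = i₀ then 0 else e.arr 1 i) ∧
      ∀ i, e₅.arr 10 i = if i = i₀ then
        if e.reached n u ∧ e.dist n u < e.dist n v then 1 else 0 else e.arr 10 i := by
    by_cases hlt : e.dist n u < e.dist n v
    · refine ⟨e₄.store 10 i₀ 1, ?_, rfl, rfl, rfl, hr0, hr1, fun i => ?_, fun i => ?_⟩
      · rw [rite_pos (by rwa [hr0, hr1]), run_store (hv37 e₄ rfl) eval_one]
      · rw [← ha1]
        simp [Env.store, he₄, he₃]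
      · rw [if_pos (c := e.reached n u ∧ e.dist n u < e.dist n v) ⟨hu, hlt⟩]
        have := ha10 i
        by_cases hi : i = i₀
        · simp [hi, Env.store]
        · rw [if_neg hi] at this ⊢
          rw [← this]
          simp [Env.store, hi, he₄, he₃]
    · refine ⟨e₄, ?_, rfl, rfl, rfl, hr0, hr1, ha1, fun i => ?_⟩
      · rw [rite_neg (by rwa [hr0, hr1])]
        rfl
      · rw [if_neg (c := _ ∧ _) fun h => hlt h.2]
        exact ha10 i
  obtain ⟨e₅, he₅, h5x, h5i, h5m, h50, h51, h5a, h5b⟩ := hstep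
  rw [run_seq, he₅]
  have hinp : (Expr.inp (var 37)).eval V e₅ = e.inp i₀ := by rw [eval_inp, hv37 e₅ h5x, h5i]
  by_cases hadj : 0 < e.inp i₀
  swap
  · have hadj' : ¬ G.Adj u v := fun h => hadj ((hG.adj u v).2 h)
    rw [run_ite_neg (a := 0) (by rw [hinp]; exact hadj), Stmt.run]
    refine ⟨h5m, fun i => ?_, h5b⟩
    rw [h5a, if_neg (c := Tight _ _ _ _ _) fun h => hadj' h.2.1]
  have hadj' : G.Adj u v := (hG.adj u v).1 hadj
  rw [run_ite_pos (a := 0) (by rw [hinp]; exact hadj), run_seq, run_rload (hv37 e₅ h5x)]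
  set e₆ : Env := { e₅ with rreg := Function.update e₅.rreg 2 (e₅.rmem i₀) } with he₆
  rw [run_seq, run_radd]
  set e₇ : Env := { e₆ with rreg := Function.update e₆.rreg 0 (e₆.rreg 0 + e₆.rreg 2) } with he₇
  have h70 : e₇.rreg 0 = e.dist n u + G.len u v := by
    simp [he₇, he₆, h50, h5m, hi₀, hG.len u v hadj']
  have h71 : e₇.rreg 1 = e.dist n v := by simp [he₇, he₆, h51]
  have htight : Tight G (e.reached n) (e.dist n) u v ↔ e.dist n u + G.len u v = e.dist n v :=
    ⟨fun h => h.2.2, fun h => ⟨hu, hadj', h⟩⟩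
  by_cases hlt : e₇.rreg 0 < e₇.rreg 1
  · rw [rite_pos hlt, Stmt.run]
    refine ⟨h5m, fun i => ?_, h5b⟩
    rw [h70, h71] at hlt
    rw [if_neg (c := Tight _ _ _ _ _) fun h => hlt.ne (htight.1 h)]
    exact h5a i
  rw [rite_neg hlt]
  by_cases hgt : e₇.rreg 1 < e₇.rreg 0
  · rw [rite_pos hgt, Stmt.run]
    refine ⟨h5m, fun i => ?_, h5b⟩
    rw [h70, h71] at hgt
    rw [if_neg (c := Tight _ _ _ _ _) fun h => hgt.ne' (htight.1 h)]
    exact h5a i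
  rw [rite_neg hgt, run_store (hv37 e₇ h5x) eval_one]
  rw [h70, h71] at hlt hgt
  refine ⟨h5m, fun i => ?_, fun i => ?_⟩
  · rw [if_pos (c := Tight _ _ _ _ _) (htight.2 (le_antisymm (not_lt.1 hgt) (not_lt.1 hlt)))]
    have := h5a i
    by_cases hi : i = i₀
    · simp [hi, Env.store]
    · rw [if_neg hi] at this ⊢
      rw [← this]
      simp [Env.store, hi, he₇, he₆]
  · rw [← h5b]
    simp [Env.store, he₇, he₆]

/-- The computation of the tight arcs and of the levels. -/
def netS : Stmt := .seq distS (.seq (.loop 37 sqE compareS)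
  (.fill 2 36 (var 0) (.sum 41 (var 0) (rd 10 (var 41 * var 0 + var 36)))))

/-- The array 10 marks the pairs (u, v) such that u is reached and closer to the source than v, so
the levels are its column sums. -/
theorem run_netS {s : Fin n} (hG : GraphIn G e) (h0 : e.x 0 = n) (h3 : e.x 3 = s) (hn : n ≤ V)
    (hnn : n * n ≤ V) (hz : ∀ i, e.arr 0 i = 0) (hr : e.rreg 9 = 0) :
    ∃ F D, IsDist G s F D ∧ Net (Tight G F D) (level F D) (netS.run V e) := by
  classical
  obtain ⟨hG₁, hdist⟩ := run_distS hG h0 h3 hn hnn hz hr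
  rw [netS, run_seq, run_seq]
  set e₁ := distS.run V e with he₁
  have h0₁ : e₁.x 0 = n := (run_x rfl _).trans h0
  clear_value e₁
  refine ⟨_, _, hdist, ?_⟩
  have hb : sqE.eval V e₁ = n * n := eval_sqE h0₁ hn
  have main := for_induction (V := V) (i := 37) (b := sqE) (e := e₁) (p := compareS)
    (fun j e' => e'.rmem = e₁.rmem ∧ ∀ u v : Fin n, u * n + v < j →
      e'.arr 1 (u * n + v) = (if Tight G (e₁.reached n) (e₁.dist n) u v then 1 else 0) ∧
      e'.arr 10 (u * n + v) =
        if e₁.reached n u ∧ e₁.dist n u < e₁.dist n v then 1 else 0)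
    (by rw [hb]; exact hnn) (fun _ _ _ h => h) ⟨rfl, fun _ _ h => absurd h (by omega)⟩ ?_
  · rw [hb] at main
    set e₂ := (Stmt.loop 37 sqE compareS).run V e₁ with he₂
    have h0₂ : e₂.x 0 = n := (run_x rfl _).trans h0₁
    obtain ⟨_, main⟩ := main
    have hv0 : (var 0).eval V e₂ = n := h0₂
    refine ⟨fun u v => ?_, fun u => ?_, level_lt⟩
    · rw [fill_arr_of_ne (by decide), (main u v (pack_lt u.2 v.2)).1]
      split_ifs with h <;> simp [h]
    · rw [fill_arr rfl (by rw [hv0]; exact hn) (by rw [hv0]; exact u.2),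
        eval_sum _ (by simp [set_x, h0₂, hn])]
      simp only [eval_var, set_x, show (0 : ℕ) ≠ 36 by decide, if_false, h0₂]
      rw [level, Set.ncard_eq_toFinset_card', Set.toFinset_ofPred, Finset.card_filter,
        Finset.sum_range]
      apply Finset.sum_congr rfl
      intro w _
      have hidx : (var 41 * var 0 + var 36).eval V ((e₂.set 36 u).set 41 w) = w * n + u := by
        have := w.2
        rw [eval_add, eval_mul] <;> simp [set_x, h0₂]
        omega
      rw [eval_rd, hidx]
      exact (main w u (pack_lt w.2 u.2)).2
  · rw [hb]
    rintro j hj e' h37 hkv hka hki ⟨hm, hI⟩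
    have h0' : e'.x 0 = n := (hkv 0 (by decide) rfl).trans h0₁
    have hn0 : 0 < n := by
      rcases Nat.eq_zero_or_pos n with rfl | h
      · omega
      · exact h
    have hre : e'.reached n = e₁.reached n := by unfold Env.reached; rw [hka 0 rfl]
    have hdi : e'.dist n = e₁.dist n := by unfold Env.dist; rw [hm]
    set u : Fin n := ⟨j / n, Nat.div_lt_of_lt_mul hj⟩ with hu
    set v : Fin n := ⟨j % n, Nat.mod_lt _ hn0⟩ with hv
    have hjuv : j = u * n + v := (Nat.div_add_mod' j n).symm
    rw [hjuv] at h37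
    have hG' : GraphIn G e' := ⟨by rw [hki]; exact hG₁.adj, by rw [hm]; exact hG₁.len⟩
    obtain ⟨h1, h2, h4⟩ := run_compareS hG' h0' hn h37
    rw [hre, hdi] at h2 h4
    refine ⟨h1.trans hm, fun a b hab => ?_⟩
    rw [h2, h4]
    rcases Nat.lt_succ_iff_lt_or_eq.1 hab with h | h
    · have hne : (a * n + b : ℕ) ≠ u * n + v := hjuv ▸ h.ne
      rw [if_neg hne, if_neg hne]
      exact hI a b h
    · obtain ⟨h9, h10⟩ := pack_inj b.2 v.2 (h.trans hjuv)
      obtain rfl : a = u := Fin.ext h9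
      obtain rfl : b = v := Fin.ext h10
      rw [if_pos rfl, if_pos rfl]
      exact ⟨rfl, rfl⟩

end Compare

/-! ### The algorithm in the language of bounded loops -/

theorem hasDissimilarShortestPaths_iff {n k d : ℕ} {G : WeightedDigraph (Fin n)} {s t : Fin n}
    {F : Fin n → Prop} {D : Fin n → ℝ} (h : IsDist G s F D) :
    HasDissimilarShortestPaths G s t k d ↔ HasFarRoutes (Tight G F D) s t k d := by
  constructor
  · rintro ⟨P, h1, h2⟩
    refine ⟨fun i => if hi : i < k then P ⟨i, hi⟩ else [], fun i hi => ?_, fun i hi j hj hij => ?_⟩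
    · simp only [dif_pos hi]
      exact h.isShortestPath_iff.1 (h1 _)
    · simp only [dif_pos hi, dif_pos hj]
      exact h2 ⟨i, hi⟩ ⟨j, hj⟩ hij
  · rintro ⟨P, h1, h2⟩
    exact ⟨fun i => P i, fun i => h.isShortestPath_iff.2 (h1 i i.2),
      fun i j hij => h2 i i.2 j j.2 hij⟩

/-- A full set of k centres is itself a solution: all thresholds are at least d. -/
theorem Centers.hasFarRoutes {n k d : ℕ} {s t : Fin n} {R : Fin n → Fin n → Prop}
    {A : ℕ → Finset (Fin n × Fin n)} {e : Env} (h : Centers R s t k A e)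
    (hA : ∀ c < k, ∀ c' < c, 3 ^ (k - 1 - c) * d ≤ setDist (A c) (A c')) :
    HasFarRoutes R s t k d := by
  choose! P hP hPA using h.route
  refine ⟨P, hP, fun i hi j hj hij => ?_⟩
  rw [← hPA i hi, ← hPA j hj, setDist_comm]
  exact (Nat.le_mul_of_pos_left _ (by positivity)).trans (hA j hj i hij)

/-- The decision, for positive `k` and `d`. -/
def decideS : Stmt := .seq netS (.seq greedyS (.seq (.ite (var 8) (var 4) colourS (.set 7 1))
  (.set 0 (var 7))))

theorem run_decideS {V n k d Q E : ℕ} {G : WeightedDigraph (Fin n)} {s t : Fin n} {e : Env}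
    (hs : Sizes V n k d) (hv : Vars n s t k d e) (hG : GraphIn G e) (h6 : e.x 6 = Q)
    (hQ : Q ^ 9 ≤ V) (hss : SeedSize Q n k d E) (hz0 : ∀ i, e.arr 0 i = 0)
    (hz3 : ∀ i, e.arr 3 i = 0) (hr : e.rreg 9 = 0) :
    (decideS.run V e).x 0 = 1 ↔ HasDissimilarShortestPaths G s t k d := by
  have hw := hs.weightSize (m := 1) (J := 1) (by have := hs.k_pos; omega)
    (by have := hs.k_pos; omega)
  have hsq : n * n ≤ V := by have := hw.Jsq_le; omega
  obtain ⟨F, D, hdist, hnet⟩ := run_netS hG hv.n_eq hv.s_eq hw.n_le hsq hz0 hr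
  rw [hasDissimilarShortestPaths_iff hdist, decideS, run_seq, run_seq, run_seq]
  set e₁ := netS.run V e with he₁
  have hx₁ : ∀ i, netS.keepsVar i = true → e₁.x i = e.x i := fun i hi => run_x hi e
  have hz₁ : ∀ i, e₁.arr 3 i = 0 := by
    rw [he₁, run_arr rfl]
    exact hz3
  have hv₁ : Vars n s t k d e₁ :=
    hv.congr (hx₁ 0 rfl) (hx₁ 1 rfl) (hx₁ 2 rfl) (hx₁ 3 rfl) (hx₁ 4 rfl)
  have h6₁ : e₁.x 6 = Q := (hx₁ 6 rfl).trans h6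
  clear_value e₁
  obtain ⟨m, hmk, A, h8, hcen, hA, hm⟩ := run_greedyS hs hv₁ hnet hz₁
  set e₂ := greedyS.run V e₁ with he₂
  have hx₂ : ∀ i, greedyS.keepsVar i = true → e₂.x i = e₁.x i := fun i hi => run_x hi e₁
  have hv₂ : Vars n s t k d e₂ :=
    hv₁.congr (hx₂ 0 rfl) (hx₂ 1 rfl) (hx₂ 2 rfl) (hx₂ 3 rfl) (hx₂ 4 rfl)
  have h6₂ : e₂.x 6 = Q := (hx₂ 6 rfl).trans h6₁
  have hnet₂ : Net (Tight G F D) (level F D) e₂ := hnet.congr (run_arr rfl e₁) (run_arr rfl e₁)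
  clear_value e₂
  rw [Stmt.run, set_x_self, eval_var]
  rcases hmk.lt_or_eq with hlt | rfl
  · rw [run_ite_pos (by simp [h8, hv₂.k_eq, hlt])]
    exact run_colourS hs hv₂ h8 h6₂ hQ hss hlt hnet₂ hcen hA (hm.resolve_left hlt.ne)
  · rw [run_ite_neg (by simp [h8, hv₂.k_eq]), Stmt.run, set_x_self]
    simpa using hcen.hasFarRoutes hA

/-! ### The sizes of the numbers -/

theorem quadratic_le_two_pow (N : ℕ) : (N + 2) * (2 * N + 5) ≤ 20 * 2 ^ N := by
  induction N with
  | zero => norm_num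
  | succ N ih =>
    rcases Nat.eq_zero_or_pos N with rfl | hN
    · norm_num
    · rw [pow_succ]
      nlinarith

section Bounds

variable {n k d E : ℕ}

/-- There are about log E levels, with multipliers below a polynomial in E. The packed multipliers
thus have 2^O((log E)²) possible values, well within 2^O(E). -/
theorem level_bound (hE : 0 < E) {L : ℕ} (hL : 2 ^ L ≤ 2 * E) :
    (2 * (2 * E ^ 2 + 1)) ^ (L + 1) ≤ 2 ^ (20 * E) := by
  obtain ⟨N, hN1, hN2⟩ : ∃ N, 2 ^ N ≤ E ∧ E < 2 ^ (N + 1) :=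
    ⟨Nat.log 2 E, Nat.pow_log_le_self 2 hE.ne', Nat.lt_pow_succ_log_self (by norm_num) E⟩
  have hL' : L < N + 2 := by
    apply (Nat.pow_lt_pow_iff_right (show 1 < 2 by norm_num)).1
    rw [pow_succ]
    omega
  have hb : 2 * (2 * E ^ 2 + 1) ≤ 2 ^ (2 * N + 5) := by
    have h1 : E ^ 2 ≤ (2 ^ (N + 1)) ^ 2 := Nat.pow_le_pow_left hN2.le 2
    have h2 : (2 ^ (N + 1)) ^ 2 = 2 ^ (2 * N + 2) := by rw [← pow_mul]; ring
    have h3 : 2 ^ (2 * N + 5) = 8 * 2 ^ (2 * N + 2) := by ring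
    have h4 : 0 < 2 ^ (2 * N + 2) := by positivity
    omega
  calc (2 * (2 * E ^ 2 + 1)) ^ (L + 1) ≤ (2 ^ (2 * N + 5)) ^ (N + 2) :=
        (Nat.pow_le_pow_left hb _).trans (Nat.pow_le_pow_right (by positivity) (by omega))
    _ = 2 ^ ((N + 2) * (2 * N + 5)) := by rw [← pow_mul]; ring
    _ ≤ 2 ^ (20 * E) := Nat.pow_le_pow_right (by norm_num)
        ((quadratic_le_two_pow N).trans (by omega))

theorem succ_le_two_pow (y : ℕ) : y + 1 ≤ 2 ^ y := Nat.lt_two_pow_self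

/-- Put G = n 2^E. Each of the nine numbers of a seed is below Q = G^20, so there are Q^9 = G^180
packed seeds, and the table of the dynamic program has at most n(3^k d + 1)^(2k) ≤ G^3 entries. The
bound V = G^200 exceeds all of this. -/
theorem sizes_of_pos (hn : 0 < n) (hk : 0 < k) (hd : 0 < d) (hE : E = 3 ^ k * d * (k * k)) :
    k ≤ E ∧ d ≤ E ∧ 3 ≤ E ∧ SeedSize ((n * 2 ^ E) ^ 20) n k d E ∧
      Sizes ((n * 2 ^ E) ^ 200) n k d := by
  set y := 3 ^ k * d with hy
  have h3 : 3 ≤ 3 ^ k := Nat.le_self_pow hk.ne' 3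
  have h3y : 3 ^ k ≤ y := Nat.le_mul_of_pos_right _ hd
  have hdy : d ≤ y := Nat.le_mul_of_pos_left _ (by positivity)
  have hkk : k ≤ k * k := Nat.le_mul_self k
  have hyE : y ≤ E := hE ▸ Nat.le_mul_of_pos_right _ (by positivity)
  have hkE : k * k ≤ E := hE ▸ Nat.le_mul_of_pos_left _ (by omega)
  have hykE : y * k ≤ E := hE ▸ Nat.mul_le_mul_left _ hkk
  have hW := succ_le_two_pow E
  set W := 2 ^ E with hWdef
  set G := n * W with hG
  have hWG : W ≤ G := Nat.le_mul_of_pos_left _ hn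
  have hnG : n ≤ G := Nat.le_mul_of_pos_right _ (by positivity)
  have h8 : 8 ≤ W := (show 8 ≤ 2 ^ 3 by norm_num).trans (Nat.pow_le_pow_right (by norm_num) (by omega))
  have hG0 : 0 < G := by omega
  have hmono : ∀ {i j : ℕ}, i ≤ j → G ^ i ≤ G ^ j := fun h => Nat.pow_le_pow_right hG0 h
  have h420 : G ^ 4 < G ^ 20 := Nat.pow_lt_pow_right (by omega) (by norm_num)
  have hidx : 2 * (n * n * k) ≤ G ^ 4 :=
    calc 2 * (n * n * k) ≤ G * (G * G * G) := by gcongr <;> omega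
      _ = G ^ 4 := by ring
  refine ⟨by omega, by omega, by omega, ⟨by omega, hE ▸ le_rfl, by omega, ?_, fun L hL => ⟨?_, ?_⟩,
    ?_, ?_⟩, ⟨hn, hk, hd, ?_, ?_⟩⟩
  · refine lt_of_le_of_lt ?_ h420
    have h1 : E ^ 2 ≤ G ^ 2 := Nat.pow_le_pow_left (by omega) 2
    have h2 : 64 ≤ G ^ 2 := by nlinarith
    have h4 : G ^ 4 = G ^ 2 * G ^ 2 := by ring
    nlinarith
  · refine (level_bound (by omega) hL).trans ?_
    rw [mul_comm, pow_mul]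
    exact Nat.pow_le_pow_left hWG 20
  · have : 2 ^ (L + 3) ≤ E * 20 := by
      rw [pow_add]
      omega
    refine (Nat.pow_le_pow_right (by norm_num) this).trans ?_
    rw [pow_mul]
    exact Nat.pow_le_pow_left hWG 20
  · calc k ^ k ≤ (2 ^ k) ^ k := Nat.pow_le_pow_left ((succ_le_two_pow k).trans' (by omega)) k
      _ = 2 ^ (k * k) := (pow_mul _ _ _).symm
      _ ≤ W := Nat.pow_le_pow_right (by norm_num) hkE
      _ ≤ G ^ 1 := by rwa [pow_one]
      _ ≤ G ^ 20 := hmono (by norm_num)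
  · calc (y + 1) ^ (k * k) ≤ (2 ^ y) ^ (k * k) := Nat.pow_le_pow_left (succ_le_two_pow y) _
      _ = W := by rw [← pow_mul, ← hE]
      _ ≤ G ^ 1 := by rwa [pow_one]
      _ ≤ G ^ 20 := hmono (by norm_num)
  · calc 2 * k * (n * n) = 2 * (n * n * k) := by ring
      _ ≤ G ^ 4 := hidx
      _ ≤ G ^ 200 := hmono (by norm_num)
  · calc n * (y + 1) ^ (2 * k) ≤ G * (2 ^ y) ^ (2 * k) := by
          gcongr
          exact succ_le_two_pow y
      _ = G * (2 ^ (y * k)) ^ 2 := by rw [← pow_mul, ← pow_mul]; ring_nf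
      _ ≤ G * G ^ 2 := by
          gcongr
          exact (Nat.pow_le_pow_right (by norm_num) hykE).trans hWG
      _ = G ^ 3 := by ring
      _ ≤ G ^ 200 := hmono (by norm_num)

end Bounds

/-- The program runs with several successive values of the bound V, all at most 300 G^200, so one
constant serves for all its stages. -/
theorem PolyBound.exists_pow {B : ℕ → ℕ} (hB : PolyBound B) :
    ∃ c, ∀ G, 0 < G → ∀ x ≤ 300 * G ^ 200, B x ≤ c * G ^ c := by
  obtain ⟨C, D, h⟩ := hB
  refine ⟨C * 301 ^ D + 200 * D, fun G hG x hx => (h x).trans ?_⟩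
  have h1 : 0 < G ^ 200 := by positivity
  calc C * (x + 1) ^ D ≤ C * (301 * G ^ 200) ^ D := by
        gcongr
        omega
    _ = (C * 301 ^ D) * G ^ (200 * D) := by rw [mul_pow, ← pow_mul, mul_assoc]
    _ ≤ _ := Nat.mul_le_mul (by omega) (Nat.pow_le_pow_right hG (by omega))

/-! ### The program of the machine -/

/-- The even registers hold `x`, the register `1` holds `V`, and the memory is that of the initial
state. -/
structure State.Loaded (I : Instance) (x : ℕ → ℕ) (V : ℕ) (σ : State) : Prop where
  even : ∀ i, σ.reg (2 * i) = x i
  bound : σ.reg 1 = V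
  mem : σ.mem = I.initialState.mem
  rreg : σ.rreg = I.initialState.rreg
  rmem : σ.rmem = I.initialState.rmem

theorem State.Loaded.update {I : Instance} {x : ℕ → ℕ} {V : ℕ} {σ : State} (h : σ.Loaded I x V)
    (i v : ℕ) : State.Loaded I (Function.update x i v) V
      { σ with reg := Function.update σ.reg (2 * i) v } := by
  refine ⟨fun j => ?_, ?_, h.mem, h.rreg, h.rmem⟩
  · by_cases hj : j = i
    · subst hj
      simp
    · rw [Function.update_of_ne hj, ← h.even]
      exact Function.update_of_ne (by omega) _ _
  · rw [← h.bound]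
    exact Function.update_of_ne (by omega) _ _

theorem State.Loaded.update_bound {I : Instance} {x : ℕ → ℕ} {V : ℕ} {σ : State}
    (h : σ.Loaded I x V) (v : ℕ) :
    State.Loaded I x v { σ with reg := Function.update σ.reg 1 v } := by
  refine ⟨fun j => ?_, by simp, h.mem, h.rreg, h.rmem⟩
  rw [← h.even]
  exact Function.update_of_ne (by omega) _ _

theorem exists_assign (i : ℕ) (a : Expr) : ∃ p B, PolyBound B ∧ ∀ I x V σ, State.Loaded I x V σ →
    ∃ σ' e, Runs p σ σ' (B V) ∧ e.x = x ∧ σ'.Loaded I (Function.update x i (a.eval V e)) V := by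
  obtain ⟨p, B, hB, h⟩ := a.realizes 0
  refine ⟨.seq p (.instr (.move (2 * i) 3)), _, hB.add (.const 1), fun I x V σ hσ => ?_⟩
  obtain ⟨σ₁, hr, hk, hv⟩ := h σ
  rw [hσ.bound] at hr hv
  have h₁ : State.Loaded I x V σ₁ := ⟨fun j => (hk.1 j).trans (hσ.even j), hk.2.1.trans hσ.bound,
    hk.2.2.2.1.trans hσ.mem, hk.2.2.2.2.1.trans hσ.rreg, hk.2.2.2.2.2.trans hσ.rmem⟩
  refine ⟨_, σ.env, hr.seq (.instr _ _), funext hσ.even, ?_⟩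
  have h3 : σ₁.reg 3 = a.eval V σ.env := hv
  rw [← h3]
  exact h₁.update i _

theorem exists_assign_bound (i : ℕ) (a : Expr) : ∃ p B, PolyBound B ∧ ∀ I x V σ,
    State.Loaded I x V σ → ∃ σ' e, Runs p σ σ' (B V) ∧ e.x = x ∧
      σ'.Loaded I (Function.update x i (a.eval V e)) (a.eval V e) := by
  obtain ⟨p, B, hB, h⟩ := exists_assign i a
  refine ⟨.seq p (.instr (.move 1 (2 * i))), _, hB.add (.const 1), fun I x V σ hσ => ?_⟩
  obtain ⟨σ₁, e, hr, he, h₁⟩ := h I x V σ hσ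
  refine ⟨_, e, hr.seq (.instr _ _), he, ?_⟩
  have h3 : σ₁.reg (2 * i) = a.eval V e := (h₁.even i).trans (Function.update_self ..)
  have := h₁.update_bound (a.eval V e)
  rwa [← h3] at this ⊢

theorem State.Loaded.graphIn {I : Instance} {x : ℕ → ℕ} {V : ℕ} {σ : State} (h : σ.Loaded I x V)
    (hV : I.n * I.n ≤ V) : GraphIn I.G σ.env := by
  have key : ∀ u v : Fin I.n, ∃ h : (u * I.n + v : ℕ) < I.n * I.n,
      (⟨_, h⟩ : Fin (I.n * I.n)).divNat = u ∧ (⟨_, h⟩ : Fin (I.n * I.n)).modNat = v := fun u v =>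
    ⟨pack_lt u.2 v.2, Fin.ext (pack_div _ v.2), Fin.ext (pack_mod _ v.2)⟩
  constructor
  · intro u v
    obtain ⟨hlt, h1, h2⟩ := key u v
    simp only [State.env, h.bound, h.mem, Instance.initialState, dif_pos hlt,
      if_pos (hlt.trans_le hV)]
    split_ifs with hA <;> rw [h1, h2] at hA <;> simp [hA]
  · intro u v huv
    obtain ⟨hlt, h1, h2⟩ := key u v
    simp only [State.env, h.rmem, Instance.initialState, dif_pos hlt]
    rw [if_pos (by rwa [h1, h2]), h1, h2]

/-- A change of the bound moves the arrays in the memory. As long as V ≥ n², they lie behind the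
input, where the memory still is 0. -/
theorem State.Loaded.arr_eq_zero {I : Instance} {x : ℕ → ℕ} {V : ℕ} {σ : State}
    (h : σ.Loaded I x V) (hV : I.n * I.n ≤ V) (a : Fin 16) (i : ℕ) : σ.env.arr a i = 0 := by
  simp only [State.env, h.bound, h.mem, Instance.initialState]
  rw [dif_neg (by omega)]

/-- The bound V has to be raised in stages, since every evaluation is truncated at the current
bound. Starting from n + k + d + 3, one can compute E, because right factors and powers are not
truncated; the bound E + n + 2 allows for G = n 2^E, and G + 200 allows for the powers G^20 and
G^200. The decision itself runs with V = G^200. -/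
theorem exists_decide_of_pos : ∃ (p : Program) (c : ℕ), ∀ I x V σ k d, State.Loaded I x V σ →
    0 < k → 0 < d → Vars I.n I.s I.t k d σ.env → V = I.n + k + d + 3 →
    ∃ σ', Runs p σ σ' (c * (I.n * 2 ^ (3 ^ k * d * (k * k))) ^ c) ∧
      (σ'.reg 0 = 1 ↔ HasDissimilarShortestPaths I.G I.s I.t k d) := by
  obtain ⟨p₁, B₁, hB₁, h₁⟩ := exists_assign 5 (var 2 * (var 4 * (var 4 * .pow 3 (var 4))))
  obtain ⟨p₂, B₂, hB₂, h₂⟩ := exists_assign_bound 7 (var 5 + var 0 + 2)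
  obtain ⟨p₃, B₃, hB₃, h₃⟩ := exists_assign 8 (var 0 * .pow 2 (var 5))
  obtain ⟨p₄, B₄, hB₄, h₄⟩ := exists_assign_bound 7 (var 8 + .const 200)
  obtain ⟨p₅, B₅, hB₅, h₅⟩ := exists_assign 6 (.pow (var 8) (.const 20))
  obtain ⟨p₆, B₆, hB₆, h₆⟩ := exists_assign_bound 7 (.pow (var 8) (.const 200))
  obtain ⟨p₇, B₇, hB₇, h₇⟩ := decideS.performs 0
  obtain ⟨c, hc⟩ := (hB₁.add (hB₂.add (hB₃.add (hB₄.add (hB₅.add (hB₆.add hB₇)))))).exists_pow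
  refine ⟨.seq p₁ (.seq p₂ (.seq p₃ (.seq p₄ (.seq p₅ (.seq p₆ p₇))))), 7 * c,
    fun I x V σ k d hσ hk hd hv hV => ?_⟩
  obtain ⟨hn1, ht1, hd1, hs1, hk1⟩ := hv
  have hx : σ.env.x = x := funext hσ.even
  rw [hx] at hn1 ht1 hd1 hs1 hk1
  have hn : 0 < I.n := I.s.pos
  set n := I.n with hn_def
  set E := 3 ^ k * d * (k * k) with hE
  obtain ⟨hkE, hdE, hE3, hseed, hsizes⟩ := sizes_of_pos hn hk hd hE
  set G := n * 2 ^ E with hG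
  have hEG : E < G := (succ_le_two_pow E).trans (Nat.le_mul_of_pos_left _ hn)
  have hnG : n ≤ G := Nat.le_mul_of_pos_right _ (by positivity)
  have hG1 : G ≤ G ^ 200 := Nat.le_self_pow (by norm_num) _
  clear_value E G
  obtain ⟨σ₁, e₁, r₁, he₁, l₁⟩ := h₁ I x V σ hσ
  have v₁ : (var 2 * (var 4 * (var 4 * .pow 3 (var 4)))).eval V e₁ = E := by
    rw [eval_mul, eval_mul, eval_mul, eval_pow] <;> simp [he₁, hk1, hd1] <;> first | omega | skip
    rw [hE]; ring
  rw [v₁] at l₁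
  obtain ⟨σ₂, e₂, r₂, he₂, l₂⟩ := h₂ _ _ _ _ l₁
  have v₂ : (var 5 + var 0 + 2).eval V e₂ = E + n + 2 := by simp [he₂, hn1]
  rw [v₂] at l₂
  obtain ⟨σ₃, e₃, r₃, he₃, l₃⟩ := h₃ _ _ _ _ l₂
  have v₃ : (var 0 * .pow 2 (var 5)).eval (E + n + 2) e₃ = G := by
    rw [eval_mul, eval_pow] <;> simp [he₃, hn1, hG] <;> omega
  rw [v₃] at l₃
  obtain ⟨σ₄, e₄, r₄, he₄, l₄⟩ := h₄ _ _ _ _ l₃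
  have v₄ : (var 8 + .const 200).eval (E + n + 2) e₄ = G + 200 := by simp [he₄]
  rw [v₄] at l₄
  obtain ⟨σ₅, e₅, r₅, he₅, l₅⟩ := h₅ _ _ _ _ l₄
  have v₅ : (Expr.pow (var 8) (.const 20)).eval (G + 200) e₅ = G ^ 20 := by
    rw [eval_pow] <;> simp [he₅]
  rw [v₅] at l₅
  obtain ⟨σ₆, e₆, r₆, he₆, l₆⟩ := h₆ _ _ _ _ l₅
  have v₆ : (Expr.pow (var 8) (.const 200)).eval (G + 200) e₆ = G ^ 200 := by
    rw [eval_pow] <;> simp [he₆]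
  rw [v₆] at l₆
  obtain ⟨σ₇, r₇, _, _, he₇⟩ := h₇ σ₆
  rw [l₆.bound] at he₇ r₇
  have hx₆ : σ₆.env.x = _ := funext l₆.even
  have hw := hsizes.weightSize (m := 1) (J := 1) (by omega) (by omega)
  refine ⟨σ₇, (r₁.seq (r₂.seq (r₃.seq (r₄.seq (r₅.seq (r₆.seq r₇)))))).mono ?_, ?_⟩
  · have hG0 : 0 < G := by omega
    have b₁ := hc G hG0 V (by omega)
    have b₂ := hc G hG0 (E + n + 2) (by omega)
    have b₃ := hc G hG0 (G + 200) (by omega)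
    have b₄ := hc G hG0 (G ^ 200) (by omega)
    have b₅ : 7 * (c * G ^ c) ≤ 7 * c * G ^ (7 * c) := by
      rw [← mul_assoc]
      exact Nat.mul_le_mul_left _ (Nat.pow_le_pow_right hG0 (by omega))
    omega
  · have hz := l₆.arr_eq_zero hw.sq_le
    have := run_decideS hsizes (e := σ₆.env)
      (⟨by simp [hx₆, hn1], by simp [hx₆, ht1], by simp [hx₆, hd1], by simp [hx₆, hs1],
        by simp [hx₆, hk1]⟩ : Vars n I.s I.t k d σ₆.env) (l₆.graphIn hw.sq_le)
      (show σ₆.env.x 6 = G ^ 20 by simp [hx₆]) (by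
        rw [← pow_mul]
        exact Nat.pow_le_pow_right (by omega) (by norm_num)) hseed (hz 0) (hz 3)
      (congrFun l₆.rreg 9)
    have h0 : σ₇.reg 0 = (decideS.run (G ^ 200) σ₆.env).x 0 := congrFun (congrArg Env.x he₇) 0
    rw [← this, h0]

/-- For d = 0 a path may be repeated, so the question is whether there is a shortest path at all.
The same question results from a single path and any distance. -/
theorem hasDissimilarShortestPaths_zero {V : Type*} [DecidableEq V] (G : WeightedDigraph V)
    (s t : V) {k k' d' : ℕ} (hk : 0 < k) (hk' : k' = 1) :
    HasDissimilarShortestPaths G s t k' d' ↔ HasDissimilarShortestPaths G s t k 0 := by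
  subst hk'
  constructor
  · rintro ⟨P, hP, _⟩
    exact ⟨fun _ => P 0, fun _ => hP 0, fun _ _ _ => Nat.zero_le _⟩
  · rintro ⟨P, hP, _⟩
    exact ⟨fun _ => P ⟨0, hk⟩, fun _ => hP _, fun i j hij => absurd hij (by omega)⟩

/-- Initially the register reserved for the bound holds the source vertex, which therefore appears
as the bound. -/
theorem State.Loaded.of_initialState (I : Instance) :
    I.initialState.Loaded I (fun i => I.initialState.reg (2 * i)) I.s :=
  ⟨fun _ => rfl, by simp [Instance.initialState], rfl, rfl, rfl⟩

/-- The initial arrangement of the registers. -/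
def arrange : Program :=
  .seq (.instr (.move 6 1)) (.seq (.instr (.move 8 3)) (.instr (.const 3 0)))

theorem runs_arrange (I : Instance) : ∃ σ x, Runs arrange I.initialState σ 3 ∧ σ.reg 3 = 0 ∧
    σ.Loaded I x I.s ∧ x 0 = I.n ∧ x 1 = I.t ∧ x 2 = I.d ∧ x 3 = I.s ∧ x 4 = I.k := by
  have h := ((State.Loaded.of_initialState I).update 3 I.s).update 4 I.k
  refine ⟨_, Function.update (Function.update (fun i => I.initialState.reg (2 * i)) 3 I.s) 4 I.k,
    (Runs.instr _ _).seq ((Runs.instr _ _).seq (Runs.instr _ _)), by simp [Instr.run],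
    ⟨fun i => ?_, ?_, h.mem, h.rreg, h.rmem⟩, ?_, ?_, ?_, ?_, ?_⟩
  · rw [← h.even i]
    simp only [Instr.run]
    rw [Function.update_of_ne (by omega)]
    simp [Instance.initialState]
  · simp [Instr.run, Instance.initialState]
  all_goals simp [Instance.initialState]

/-- If `d = 0`, then `k` and `d` are replaced by `1`; the register `3` holds `0`. -/
def normalize : Program :=
  .ite (.lt 3 4) .skip (.seq (.instr (.const 4 1)) (.instr (.const 8 1)))

theorem runs_normalize {I : Instance} {x : ℕ → ℕ} {V : ℕ} {σ : State} (h : σ.Loaded I x V)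
    (h3 : σ.reg 3 = 0) : ∃ σ' x', Runs normalize σ σ' 3 ∧ σ'.Loaded I x' V ∧ x' 0 = x 0 ∧
      x' 1 = x 1 ∧ x' 3 = x 3 ∧ (0 < x 2 → x' 2 = x 2 ∧ x' 4 = x 4) ∧
      (x 2 = 0 → x' 2 = 1 ∧ x' 4 = 1) := by
  have h4 : σ.reg 4 = x 2 := h.even 2
  by_cases hd : 0 < x 2
  · exact ⟨σ, x, (Runs.ite_true (by simp only [Test.Holds, h3, h4, hd]) (.skip σ)).mono
      (by omega), h, rfl, rfl, rfl, fun _ => ⟨rfl, rfl⟩, fun h => absurd h hd.ne'⟩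
  · exact ⟨_, _, Runs.ite_false (by simp only [Test.Holds, h3, h4, hd, not_false_iff])
      ((Runs.instr _ _).seq (Runs.instr _ _)), (h.update 2 1).update 4 1, by simp, by simp, by simp,
      fun h => absurd h hd, fun _ => by simp⟩

/-- The register `1` is set to `n + k + d + 3`. -/
def sumBound : Program :=
  .seq (.instr (.const 3 3)) (.seq (.instr (.add 3 4 3)) (.seq (.instr (.add 3 8 3))
    (.instr (.add 1 0 3))))

theorem runs_sumBound {I : Instance} {x : ℕ → ℕ} {V : ℕ} {σ : State} (h : σ.Loaded I x V) :
    ∃ σ', Runs sumBound σ σ' 4 ∧ σ'.Loaded I x (x 0 + x 4 + x 2 + 3) := by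
  refine ⟨_, (Runs.instr _ _).seq ((Runs.instr _ _).seq ((Runs.instr _ _).seq (Runs.instr _ _))),
    fun i => ?_, ?_, h.mem, h.rreg, h.rmem⟩
  · rw [← h.even]
    simp only [Instr.run]
    simp (disch := omega) only [Function.update_of_ne]
  · have h0 := h.even 0
    have h4 := h.even 2
    have h8 := h.even 4
    norm_num at h0 h4 h8
    simp [Instr.run, h0, h4, h8]
    omega

/-- For k = 0 the answer is yes. For d = 0 the instance is replaced by k = d = 1, and all other
instances are passed on unchanged. -/
theorem exists_decidesInTime : ∃ (p : Program) (c : ℕ),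
    DecidesInTime p fun I => c * 2 ^ (c * (3 ^ I.k * I.d * I.k ^ 2)) * I.n ^ c := by
  obtain ⟨p, c, hp⟩ := exists_decide_of_pos
  refine ⟨.seq arrange (.ite (.lt 3 8) (.seq normalize (.seq sumBound p)) (.instr (.const 0 1))),
    -- The summand 12 absorbs the initial instructions and tests. The factor 2^(3c) absorbs the case
    -- d = 0: the replaced instance has the exponent 3, while the claimed bound has the exponent 0.
    (c + 12) * 2 ^ (3 * c), fun I => ?_⟩
  set C := (c + 12) * 2 ^ (3 * c) with hC
  have hcC : c + 12 ≤ C := Nat.le_mul_of_pos_right _ (by positivity)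
  have hn : 0 < I.n := I.s.pos
  obtain ⟨σ₁, x, r₁, h3, l₁, hx0, hx1, hx2, hx3, hx4⟩ := runs_arrange I
  have h8 : σ₁.reg 8 = I.k := (l₁.even 4).trans hx4
  have hpow : ∀ E, 0 < 2 ^ (C * E) * I.n ^ C := fun E => by positivity
  rcases Nat.eq_zero_or_pos I.k with hk | hk
  · obtain ⟨T, hT, hTB⟩ := r₁.seq (Runs.ite_false (b := .lt 3 8)
      (p := .seq normalize (.seq sumBound p)) (by simp only [Test.Holds, h3, h8]; omega)
      (Runs.instr (.const 0 1) σ₁))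
    refine ⟨_, T, hT, ?_, iff_of_true (by simp [Instr.run]) ?_⟩
    · dsimp only
      rw [mul_assoc]
      have := Nat.le_mul_of_pos_right C (hpow (3 ^ I.k * I.d * I.k ^ 2))
      omega
    · rw [Instance.IsYes, hk]
      exact ⟨fun i => i.elim0, fun i => i.elim0, fun i => i.elim0⟩
  obtain ⟨σ₂, x', r₂, l₂, hx0', hx1', hx3', hpos, hzero⟩ := runs_normalize l₁ h3
  obtain ⟨σ₃, r₃, l₃⟩ := runs_sumBound l₂
  have hx₃ : σ₃.env.x = x' := funext l₃.even
  obtain ⟨k, d, hk', hd', hkx, hdx, hiff, hE⟩ : ∃ k d, 0 < k ∧ 0 < d ∧ x' 4 = k ∧ x' 2 = d ∧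
      (HasDissimilarShortestPaths I.G I.s I.t k d ↔ I.IsYes) ∧
      3 ^ k * d * (k * k) ≤ 3 + 3 ^ I.k * I.d * I.k ^ 2 := by
    rcases Nat.eq_zero_or_pos I.d with hd | hd
    · obtain ⟨e2, e4⟩ := hzero (hx2.trans hd)
      refine ⟨1, 1, one_pos, one_pos, e4, e2, ?_, by norm_num⟩
      rw [Instance.IsYes, hd]
      exact hasDissimilarShortestPaths_zero _ _ _ hk rfl
    · obtain ⟨e2, e4⟩ := hpos (by omega)
      exact ⟨I.k, I.d, hk, hd, e4.trans hx4, e2.trans hx2, Iff.rfl, by rw [sq]; omega⟩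
  obtain ⟨σ₄, r₄, h₄⟩ := hp I x' _ σ₃ k d l₃ hk' hd'
    ⟨by rw [hx₃, hx0', hx0], by rw [hx₃, hx1', hx1], by rw [hx₃, hdx], by rw [hx₃, hx3', hx3],
      by rw [hx₃, hkx]⟩ (by rw [hx0', hx0, hkx, hdx])
  obtain ⟨T, hT, hTB⟩ := r₁.seq (Runs.ite_true (b := .lt 3 8) (q := .instr (.const 0 1))
    (by simp only [Test.Holds, h3, h8]; omega) (r₂.seq (r₃.seq r₄)))
  refine ⟨σ₄, T, hT, hTB.trans ?_, h₄.trans hiff⟩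
  set E := 3 ^ I.k * I.d * I.k ^ 2 with hEdef
  calc 3 + (1 + (3 + (4 + c * (I.n * 2 ^ (3 ^ k * d * (k * k))) ^ c)))
      ≤ 12 + c * (I.n * 2 ^ (3 + E)) ^ c := by
        have : c * (I.n * 2 ^ (3 ^ k * d * (k * k))) ^ c ≤ c * (I.n * 2 ^ (3 + E)) ^ c := by
          gcongr
          norm_num
        omega
    _ ≤ (c + 12) * (I.n * 2 ^ (3 + E)) ^ c := by
        have : 0 < (I.n * 2 ^ (3 + E)) ^ c := by positivity
        nlinarith
    _ = C * (2 ^ (c * E) * I.n ^ c) := by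
        rw [hC, mul_pow, ← pow_mul, add_mul 3 E c, pow_add, mul_comm E c]
        ring
    _ ≤ C * (2 ^ (C * E) * I.n ^ C) := by
        have h1 : c * E ≤ C * E := Nat.mul_le_mul_right _ (by omega)
        have h2 : I.n ^ c ≤ I.n ^ C := Nat.pow_le_pow_right hn (by omega)
        exact Nat.mul_le_mul_left _ (Nat.mul_le_mul (Nat.pow_le_pow_right (by norm_num) h1) h2)
    _ = _ := by ring

theorem primrec_pow : Primrec₂ fun a b : ℕ => a ^ b := by
  have h : Primrec₂ fun a b : ℕ => b.rec (motive := fun _ => ℕ) 1 fun _ r => r * a :=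
    Primrec.nat_rec (Primrec.const 1)
      (Primrec.nat_mul.comp₂ (Primrec.snd.comp₂ Primrec₂.right) Primrec₂.left)
  refine h.of_eq fun a b => ?_
  induction b with
  | zero => rfl
  | succ b ih => rw [pow_succ, ← ih]

/-- Both k and d are at most m = k + d and the bound is monotone in them, so replacing each by m
gives a primitive recursive function of the parameter. -/
theorem fixedParameterTractable : FixedParameterTractable fun I => I.k + I.d := by
  obtain ⟨p, c, hp⟩ := exists_decidesInTime
  refine ⟨p, fun m => c * 2 ^ (c * (3 ^ m * m * (m * m))), c, Primrec.to_comp ?_, fun I => ?_⟩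
  · have hid : Primrec fun m : ℕ => m := Primrec.id
    exact Primrec.nat_mul.comp (Primrec.const c) (primrec_pow.comp (Primrec.const 2)
      (Primrec.nat_mul.comp (Primrec.const c) (Primrec.nat_mul.comp (Primrec.nat_mul.comp
        (primrec_pow.comp (Primrec.const 3) hid) hid) (Primrec.nat_mul.comp hid hid))))
  · obtain ⟨σ, T, h1, h2, h3⟩ := hp I
    refine ⟨σ, T, h1, h2.trans ?_, h3⟩
    dsimp only
    rw [sq]
    gcongr <;> norm_num

end DissimilarPaths

theorem theorem1 :
    (∃ (p : DissimilarPaths.Program) (c : ℕ),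
      DissimilarPaths.DecidesInTime p
        fun I => c * 2 ^ (c * (3 ^ I.k * I.d * I.k ^ 2)) * I.n ^ c) ∧
    DissimilarPaths.FixedParameterTractable (fun I => I.k + I.d) :=
  ⟨DissimilarPaths.exists_decidesInTime, DissimilarPaths.fixedParameterTractable⟩
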